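/- Theorem (leapfrog). *Definitions.* A connected finite planar graph $G=(V,E)$ is semi-circular, with circles $C_{m_1},\dots,C_{m_q}$ ($q\ge 1$, all $m_i\ge 3$, listed from the inside to the outside), if it can be drawn in the plane without crossings as follows. There are concentric circles $O_1,\dots,O_q$ of radii $0<r_1<\dots<r_q$; exactly $m_i$ vertices lie on $O_i$, and the subgraph they induce is the cycle $C_{m_i}$ drawn along $O_i$; every other edge between vertices on circles joins two consecutive circles $O_i,O_{i+1}$ and is drawn in the annulus between them; the set $V_0$ of the remaining vertices, together with the edges at them, lies inside the disk bounded by $O_1$. If $V_0=\emptyset$ is possible, $G$ is circular, with circular structure $C_{m_1},\dots,C_{m_q}$. A fullerene is a connected finite simple planar cubic graph all of whose faces, including the unbounded one, are pentagons or hexagons. For $k=5$ or $k=6$ and $\ell\ge 1$, a pentacap ($k=5$) or hexacap ($k=6$) with $\ell$ middle circles is a fullerene $F$ drawn as a circular graph with circles $C_k$, then $\ell$ copies of $C_{2k}$, then $C_k$. The leapfrog $Le(F)$ is the graph dual to the triangulation obtained from the plane graph $F$ by placing a new vertex in every face (including the unbounded one) and joining it to all vertices on the boundary of that face. *Statement.*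 Let $F$ be a pentacap or hexacap with $\ell\ge 1$ middle circles $C_{2k}$, $k\in\{5,6\}$. Then $Le(F)$ is a fullerene, and it is circular if and only if $\ell$ is odd. If $\ell$ is odd, then $Le(F)$ has the circular structure $C_k,\ C_{3k},\ \tfrac{3\ell-1}{2}$ copies of $C_{4k},\ C_{3k},\ C_k$. If $\ell$ is even, then $Le(F)$ has the following semi-circular structure: the first $\tfrac{3\ell}{2}$ circles are $C_{4k}$, circle number $\tfrac{3\ell}{2}+1$ is $C_{3k}$, and the last circle is $C_k$. Inside the first circle there are $2k$ vertices: the $k$ vertices of a cycle $C_k$ and $k$ further vertices; the subgraph they induce consists of $C_k$ and a perfect matching between $C_k$ and the $k$ further vertices. -/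

import Mathlib

/-- A combinatorial map with set of darts `D` (a graph drawn on an oriented surface, each edge
being cut into its two oriented copies, the darts).  The vertices are the cycles of `rot`, the
edges the cycles of `rev`. -/
structure CombMap (D : Type*) where
  /-- the next dart, counterclockwise, among the darts with the same tail -/
  rot : Equiv.Perm D
  /-- the same edge with the opposite orientation -/
  rev : Equiv.Perm D
  rev_rev : ∀ d, rev (rev d) = d
  rev_ne : ∀ d, rev d ≠ d

namespace CombMap

variable {D : Type*} (M : CombMap D)

/-- The next dart on the boundary of the face that lies to the left of `d`.
The faces are the cycles of this permutation. -/
def face : Equiv.Perm D := M.rev.trans M.rot.symm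

/-- The vertices of a combinatorial map. -/
abbrev Vertex : Type _ := Quotient (Equiv.Perm.SameCycle.setoid M.rot)

/-- The edges of a combinatorial map. -/
abbrev Edge : Type _ := Quotient (Equiv.Perm.SameCycle.setoid M.rev)

/-- The faces of a combinatorial map (on the sphere: including the unbounded face). -/
abbrev Face : Type _ := Quotient (Equiv.Perm.SameCycle.setoid M.face)

/-- The vertex from which the dart `d` starts. -/
def tail (d : D) : M.Vertex := Quotient.mk _ d

/-- The graph underlying a combinatorial map: two distinct vertices are adjacent when a dart
leads from one to the other. -/
def graph : SimpleGraph M.Vertex where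
  Adj u v := u ≠ v ∧ ∃ d, M.tail d = u ∧ M.tail (M.rev d) = v
  symm := ⟨by
    rintro u v ⟨h, d, hu, hv⟩
    exact ⟨h.symm, M.rev d, hv, by rw [M.rev_rev]; exact hu⟩⟩
  loopless := ⟨fun _ h => h.1 rfl⟩

/-- The Poincaré dual: its vertices are the faces of `M`, and the dart dual to `d` leads from the
face on the left of `d` to the face on the right of `d`. -/
def dual : CombMap D where
  rot := M.face
  rev := M.rev
  rev_rev := M.rev_rev
  rev_ne := M.rev_ne

/-- The darts of the stellation.  If `d` leads from `u` to `v` and `w` is the new vertex inside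
the face on the left of `d`, then `side d` is the old dart `u → v`, `toCenter d` is `v → w`, and
`fromCenter d` is `w → u`; these three bound one triangle. -/
inductive StellationDart (D : Type*) where
  | side : D → StellationDart D
  | toCenter : D → StellationDart D
  | fromCenter : D → StellationDart D

open StellationDart

/-- The stellation of a map: a new vertex is put inside every face and joined, within the face,
to the vertices on the boundary of that face (once for every corner of the face). -/
def stellation : CombMap (StellationDart D) where
  rot :=
    { toFun := fun x => match x with
        | side d => toCenter (M.face.symm d)
        | toCenter d => side (M.rev d)
        | fromCenter d => fromCenter (M.face d)
      invFun := fun x => match x with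
        | side d => toCenter (M.rev d)
        | toCenter d => side (M.face d)
        | fromCenter d => fromCenter (M.face.symm d)
      left_inv := by rintro (d | d | d) <;> simp [M.rev_rev]
      right_inv := by rintro (d | d | d) <;> simp [M.rev_rev] }
  rev :=
    { toFun := fun x => match x with
        | side d => side (M.rev d)
        | toCenter d => fromCenter (M.face d)
        | fromCenter d => toCenter (M.face.symm d)
      invFun := fun x => match x with
        | side d => side (M.rev d)
        | toCenter d => fromCenter (M.face d)
        | fromCenter d => toCenter (M.face.symm d)
      left_inv := by rintro (d | d | d) <;> simp [M.rev_rev]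
      right_inv := by rintro (d | d | d) <;> simp [M.rev_rev] }
  rev_rev := by rintro (d | d | d) <;> simp [M.rev_rev]
  rev_ne := by rintro (d | d | d) <;> simp [M.rev_ne]

/-- All faces of the stellation are the triangles `side d, toCenter d, fromCenter d`. -/
theorem stellation_face (d : D) :
    M.stellation.face (side d) = toCenter d ∧ M.stellation.face (toCenter d) = fromCenter d ∧
      M.stellation.face (fromCenter d) = side d := by
  simp [stellation, face, M.rev_rev]

/-- The leapfrog of a map: the Poincaré dual of its stellation. -/
def leapfrog : CombMap (StellationDart D) := M.stellation.dual

end CombMap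

/-- A drawing in the plane (equivalently, on the sphere), without crossings and up to
orientation preserving homeomorphism, of the finite connected simple graph `G`, given by its
rotation system; that the surface is the sphere is expressed by Euler's formula. -/
structure PlaneEmbedding {V : Type*} (G : SimpleGraph V) where
  /-- the combinatorial map on the darts of `G` -/
  map : CombMap G.Dart
  rev_eq : ∀ d, map.rev d = d.symm
  sameCycle_rot_iff : ∀ d e, map.rot.SameCycle d e ↔ d.fst = e.fst
  finite : Finite V
  connected : G.Connected
  euler : Nat.card V + Nat.card map.Face = Nat.card G.edgeSet + 2

namespace PlaneEmbedding

variable {V : Type*} {G : SimpleGraph V} (P : PlaneEmbedding G)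

/-- A fullerene: every vertex has degree three, every face is a pentagon or a hexagon. -/
def IsFullerene : Prop :=
  (∀ v, (G.neighborSet v).ncard = 3) ∧
    ∀ d, Function.minimalPeriod P.map.face d = 5 ∨ Function.minimalPeriod P.map.face d = 6

/-- Turning counterclockwise around the common tail of `x`, `y`, `z`, starting from `x`, one meets
`y` before `z`. -/
def MeetsBefore (x y z : G.Dart) : Prop :=
  ∃ n : ℕ, P.map.rot^[n] x = y ∧ ∀ j ≤ n, P.map.rot^[j] x ≠ z

/-- The graph `Le(G)`, for the plane graph `G` drawn by `P`. -/
def leapfrog : SimpleGraph P.map.leapfrog.Vertex := P.map.leapfrog.graph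

end PlaneEmbedding

/-- A representation of the plane graph drawn by `P` through concentric circles of lengths
`m = [m₁, …, m_q]`, listed from the inside to the outside.  At a vertex of a circle that is run
through counterclockwise, the directions are met in the following order when one turns
counterclockwise: forward along the circle, the interior of the circle, backward along the
circle, the exterior of the circle. -/
structure CircleDrawing {V : Type*} {G : SimpleGraph V} (P : PlaneEmbedding G)
    (m : List ℕ) where
  ne_nil : m ≠ []
  three_le : ∀ i : Fin m.length, 3 ≤ m.get i
  /-- the vertices of the circles, in counterclockwise order -/
  circle : (i : Fin m.length) → ZMod (m.get i) → V
  injective : Function.Injective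
    (fun x : (i : Fin m.length) × ZMod (m.get i) => circle x.1 x.2)
  adj_succ : ∀ i a, G.Adj (circle i a) (circle i (a + 1))
  /-- the vertices of a circle induce just the cycle -/
  induced : ∀ i a b, G.Adj (circle i a) (circle i b) → b = a + 1 ∨ a = b + 1
  /-- an edge between two different circles joins two consecutive circles -/
  consecutive : ∀ i j a b, G.Adj (circle i a) (circle j b) →
    i.val ≤ j.val + 1 ∧ j.val ≤ i.val + 1
  /-- a vertex that is on no circle is inside the first circle: no edge joins it to a vertex of
  another circle -/
  interior_adj : ∀ v, (∀ i a, circle i a ≠ v) → ∀ i a, G.Adj (circle i a) v → i.val = 0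
  /-- the edges from a circle to the previous circle leave it inwards -/
  inward : ∀ i a (d bwd fwd : G.Dart), d.fst = circle i a →
    fwd.fst = circle i a → fwd.snd = circle i (a + 1) →
    bwd.fst = circle i a → bwd.snd = circle i (a - 1) →
    (∃ j b, j.val + 1 = i.val ∧ d.snd = circle j b) → P.MeetsBefore fwd d bwd
  /-- the edges from a circle (the first one, by `interior_adj`) to vertices that are on no circle
  leave it inwards -/
  inward_interior : ∀ i a (d bwd fwd : G.Dart), d.fst = circle i a →
    fwd.fst = circle i a → fwd.snd = circle i (a + 1) →
    bwd.fst = circle i a → bwd.snd = circle i (a - 1) →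
    (∀ j b, circle j b ≠ d.snd) → P.MeetsBefore fwd d bwd
  /-- the edges from a circle to the next circle leave it outwards -/
  outward : ∀ i a (d bwd fwd : G.Dart), d.fst = circle i a →
    fwd.fst = circle i a → fwd.snd = circle i (a + 1) →
    bwd.fst = circle i a → bwd.snd = circle i (a - 1) →
    (∃ j b, j.val = i.val + 1 ∧ d.snd = circle j b) → P.MeetsBefore bwd d fwd

namespace CircleDrawing

variable {V : Type*} {G : SimpleGraph V} {P : PlaneEmbedding G} {m : List ℕ}

/-- The set `V₀` of the vertices that are on no circle; they lie inside the first circle. -/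
def interior (C : CircleDrawing P m) : Set V := {v | ∀ i a, C.circle i a ≠ v}

/-- The vertices inside the first circle are the `k` vertices `c a` of a cycle `C_k` and `k`
further vertices `p a`, and the subgraph that they induce consists of the cycle and of the
edges that join `c a` to `p a`. -/
def InteriorIsSun (C : CircleDrawing P m) (k : ℕ) : Prop :=
  ∃ c p : ZMod k → V, Function.Injective (Sum.elim c p) ∧
    C.interior = Set.range c ∪ Set.range p ∧
    (∀ a b, G.Adj (c a) (c b) ↔ b = a + 1 ∨ a = b + 1) ∧
    (∀ a b, G.Adj (c a) (p b) ↔ a = b) ∧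
    (∀ a b, ¬ G.Adj (p a) (p b))

end CircleDrawing

namespace SimpleGraph

variable {V : Type*} (G : SimpleGraph V)

/-- The graph `G` is a fullerene (graph). -/
def IsFullerene : Prop := ∃ P : PlaneEmbedding G, P.IsFullerene

/-- The graph `G` is circular, with the circle structure `m` (from the inside to the outside):
it can be drawn with circles of these lengths and no further vertices. -/
def IsCircularWith (m : List ℕ) : Prop :=
  ∃ (P : PlaneEmbedding G) (C : CircleDrawing P m), C.interior = ∅

/-- The graph `G` is circular. -/
def IsCircular : Prop := ∃ m, G.IsCircularWith m

end SimpleGraph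

/-- The plane graph drawn by `P` is a pentacap (`k = 5`) or a hexacap (`k = 6`) with `ℓ` middle
circles: a fullerene, drawn with circles `C_k, C_{2k}, …, C_{2k}, C_k` and no further vertices. -/
def IsCapFullerene {V : Type*} {F : SimpleGraph V} (P : PlaneEmbedding F) (k ℓ : ℕ) : Prop :=
  (k = 5 ∨ k = 6) ∧ 1 ≤ ℓ ∧ P.IsFullerene ∧
    ∃ C : CircleDrawing P ([k] ++ List.replicate ℓ (2 * k) ++ [k]), C.interior = ∅

/-! The vertices of `Le(F)` are the triangles `triangle d` of the stellation, one for each dart `d`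
of `F`. Counterclockwise, the neighbours of `triangle d` are the triangles of `rev d`, `face d` and
`face.symm d` (`turn_triangle`). The faces of `Le(F)` are the vertices of the stellation: the
vertices of `F`, which give hexagons, and the faces of `F`, which keep their lengths. Hence `Le(F)`
is a fullerene.

A circular drawing of a cubic graph is encoded by a `LevelFrame`: a permutation `nx` running along
the circles, and one rung at each vertex, leading to a neighbouring level. In a cap every face has
one ascending rung and length five or six. Adding up the gaps between rungs once around a circle,
and comparing with the lengths `k` and `2k`, leaves only one possibility (`gap_zero`, `gap_mid`): on
a middle circle, inward and outward rungs alternate. So `F` has explicit coordinates `vt`: level and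
angle.

In these coordinates the darts of `F` are sorted into rows, and a local check (`OnCircle.hasTurn`)
shows that each of the first `3 * ((ℓ + 1) / 2) + 2` rows is a circle on which the third neighbour
lies in the next or in the previous row. For odd `ℓ` these rows contain all darts. For even `ℓ` the
darts along the outer cap are left over; they form the cycle with pendant edges, and the drawing is
turned inside out so that they come to lie inside the first circle.

It remains to see that `Le(F)` is not circular for even `ℓ`. A hypothetical circular drawing `Q` may
differ from the leapfrog drawing, so a rigidity argument is needed: in any drawing with faces of
length five and six, each circle of `Q` has its outward rungs on one side and its inward rungs on
the other (`ShortFaces.outLeft_or`). The reason is that a face of length at most six has at most one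
ascent and one descent. Therefore the number of circles to be crossed is a well-defined height on
the faces of the leapfrog drawing. It is the dual distance from one face, and its complement to the
number `N` of circles is the distance from another (`LevelFrame.exists_isFaceDistance`). In the
dual, the stellation of `F`, there are thus two vertices `f`, `f'` such that every vertex `x`
satisfies `d(f, x) + d(x, f') = N`.

For even `ℓ` the stellation is a triangulated cylinder of circumference `2k` with two cones, with
columns `j` and heights `Y` from `0` to `2L = 3ℓ + 6`. The distances to the two apices force the
heights of `f` and `f'` to have the sum `2L`. If `f`, `f'` are the apices, then a point at height
`3` is on no shortest path between them. Otherwise a short path between `f` and `f'` forces the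
lower of them, say `f`, to have even height at most `6`, and then the point at height `3` five
columns away from `f` is on no shortest path (`IsCylinderDistance.false_of_le`). -/

open Function


/-! ### Rotations and faces of cubic plane graphs -/

namespace PlaneEmbedding

variable {V : Type*} {G : SimpleGraph V} (P : PlaneEmbedding G)

theorem finite_dart {V : Type*} {G : SimpleGraph V} (P : PlaneEmbedding G) : Finite G.Dart := by
  have := P.finite
  exact Finite.of_injective (fun d : G.Dart => d.toProd) fun a b h => SimpleGraph.Dart.ext _ _ h

theorem ncard_fst_eq (v : V) : {d : G.Dart | d.fst = v}.ncard = (G.neighborSet v).ncard := by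
  refine Set.ncard_congr (fun d _ => d.snd) ?_ ?_ ?_
  · rintro d rfl
    exact d.adj
  · rintro a b rfl hb h
    exact SimpleGraph.Dart.ext _ _ (Prod.ext hb.symm h)
  · intro w hw
    exact ⟨⟨(v, w), hw⟩, rfl, rfl⟩

/-- A cycle is an orbit of the group generated by `f`. This turns the degree of a vertex into the
order of the rotation there. -/
theorem ncard_sameCycle {D : Type*} [Finite D] (f : Equiv.Perm D) (d : D) :
    {e | f.SameCycle d e}.ncard = minimalPeriod f d := by
  have : {e | f.SameCycle d e} = MulAction.orbit (Subgroup.zpowers f) d := by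
    ext e
    simp only [Set.mem_ofPred_eq, MulAction.mem_orbit_iff, Subtype.exists, Subgroup.mem_zpowers_iff,
      Equiv.Perm.SameCycle]
    constructor
    · rintro ⟨i, rfl⟩
      exact ⟨f ^ i, ⟨i, rfl⟩, rfl⟩
    · rintro ⟨_, ⟨i, rfl⟩, h⟩
      exact ⟨i, h⟩
  rw [this, ← Nat.card_coe_set_eq]
  classical
  have : Finite (MulAction.orbit (Subgroup.zpowers f) d) :=
    Finite.of_injective _ Subtype.val_injective
  have := Fintype.ofFinite (MulAction.orbit (Subgroup.zpowers f) d)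
  rw [Nat.card_eq_fintype_card, ← MulAction.minimalPeriod_eq_card]
  rfl

theorem minimalPeriod_rot (d : G.Dart) :
    minimalPeriod P.map.rot d = (G.neighborSet d.fst).ncard := by
  have := P.finite_dart
  rw [← ncard_sameCycle, ← ncard_fst_eq]
  congr 1
  ext e
  simp [P.sameCycle_rot_iff, eq_comm]

/-- every vertex has three neighbours -/
def IsCubic (_ : PlaneEmbedding G) : Prop := ∀ v, (G.neighborSet v).ncard = 3

variable {P}

theorem fst_rot (d : G.Dart) : (P.map.rot d).fst = d.fst :=
  ((P.sameCycle_rot_iff d _).1 ⟨1, rfl⟩).symm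

theorem IsCubic.rot_rot_rot (h : P.IsCubic) (d : G.Dart) :
    P.map.rot (P.map.rot (P.map.rot d)) = d := by
  have := isPeriodicPt_minimalPeriod P.map.rot d
  rw [P.minimalPeriod_rot, h] at this
  exact this

theorem IsCubic.rot_ne (h : P.IsCubic) (d : G.Dart) : P.map.rot d ≠ d := by
  intro hd
  have h1 := P.minimalPeriod_rot d
  rw [h, minimalPeriod_eq_one_iff_isFixedPt.2 hd] at h1
  omega

theorem IsCubic.rot_rot_ne (h : P.IsCubic) (d : G.Dart) : P.map.rot (P.map.rot d) ≠ d := by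
  intro hd
  have h1 := h.rot_rot_rot d
  rw [hd] at h1
  exact h.rot_ne d h1

theorem IsCubic.eq_or (h : P.IsCubic) {d e : G.Dart} (he : e.fst = d.fst) :
    e = d ∨ e = P.map.rot d ∨ e = P.map.rot (P.map.rot d) := by
  have := P.finite_dart
  obtain ⟨n, hn⟩ := ((P.sameCycle_rot_iff d e).2 he.symm).exists_nat_pow_eq
  rw [Equiv.Perm.coe_pow] at hn
  have h3 : minimalPeriod P.map.rot d = 3 := by rw [P.minimalPeriod_rot, h]
  rw [← iterate_mod_minimalPeriod_eq, h3] at hn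
  have : n % 3 < 3 := Nat.mod_lt _ (by norm_num)
  interval_cases h : n % 3 <;> simp_all

theorem face_apply (d : G.Dart) : P.map.face d = P.map.rot.symm d.symm := by
  simp [CombMap.face, P.rev_eq]

theorem face_eq_iff {d e : G.Dart} : P.map.face d = e ↔ P.map.rot e = d.symm := by
  rw [face_apply, Equiv.symm_apply_eq, eq_comm]

theorem fst_face (d : G.Dart) : (P.map.face d).fst = d.snd := by
  have := fst_rot (P := P) (P.map.face d)
  rw [← this, face_apply, Equiv.apply_symm_apply]
  rfl

end PlaneEmbedding

/-- In a closed walk of length five or six on the integers that never moves twice in succession,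
there is at most one ascent. -/
theorem dvd_of_ascent {l : ℕ → ℤ} {n : ℕ} (hn : n = 5 ∨ n = 6) (hp : Periodic l n)
    (hs : ∀ t, l (t + 1) = l t ∨ l (t + 1) = l t + 1 ∨ l (t + 1) = l t - 1)
    (hc : ∀ t, l (t + 1) ≠ l t → l (t + 2) = l (t + 1))
    (h0 : l 1 = l 0 + 1) {t : ℕ} (ht : l (t + 1) = l t + 1) : n ∣ t := by
  have h1 : l (t % n + 1) = l (t % n) + 1 := by
    have a := hp.map_mod_nat t
    have b := hp.map_mod_nat (t + 1)
    have c := hp.map_mod_nat (t % n + 1)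
    rw [Nat.mod_add_mod] at c
    rw [a, ← c, b, ht]
  -- A second ascent within one period needs two descents as well, and each of the four moves is
  -- followed by a pause: eight steps, more than the period. Unrolling six steps leaves this to
  -- linear arithmetic.
  rw [Nat.dvd_iff_mod_eq_zero]
  have e0 := hp 0
  have e1 := hp 1
  simp only [Nat.zero_add] at e0
  have hlt : t % n < n := Nat.mod_lt _ (by omega)
  have s0 := hs 0
  have s1 := hs 1
  have s2 := hs 2
  have s3 := hs 3
  have s4 := hs 4
  have s5 := hs 5
  have c0 := hc 0
  have c1 := hc 1
  have c2 := hc 2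
  have c3 := hc 3
  have c4 := hc 4
  have c5 := hc 5
  norm_num at s0 s1 s2 s3 s4 s5 c0 c1 c2 c3 c4 c5
  rcases hn with rfl | rfl
  · norm_num at e1
    generalize t % 5 = u at *
    interval_cases u <;> norm_num at h1 <;> omega
  · norm_num at e1
    generalize t % 6 = u at *
    interval_cases u <;> norm_num at h1 <;> omega


/-- A cubic graph whose vertices are distributed to cycles of the graph, the levels, so that each
vertex has one further neighbour, in the next or in the previous level. -/
structure LevelFrame {V : Type*} (G : SimpleGraph V) where
  /-- the next vertex on the cycle -/
  nx : Equiv.Perm V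
  /-- the neighbour that is on another cycle -/
  rung : V → V
  /-- the level of a vertex -/
  lev : V → ℤ
  /-- the number of levels -/
  q : ℤ
  adj_nx : ∀ v, G.Adj v (nx v)
  adj_rung : ∀ v, G.Adj v (rung v)
  nx_nx_ne : ∀ v, nx (nx v) ≠ v
  adj_cases : ∀ v w, G.Adj v w → w = nx v ∨ w = nx⁻¹ v ∨ w = rung v
  lev_nx : ∀ v, lev (nx v) = lev v
  lev_rung : ∀ v, lev (rung v) = lev v + 1 ∨ lev (rung v) = lev v - 1
  sameCycle : ∀ u v, lev u = lev v → nx.SameCycle u v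
  lev_nonneg : ∀ v, 0 ≤ lev v
  lev_lt : ∀ v, lev v < q
  exists_lev : ∀ i, 0 ≤ i → i < q → ∃ v, lev v = i

theorem perm_apply_inv {α : Type*} (f : Equiv.Perm α) (x : α) : f (f⁻¹ x) = x :=
  f.apply_symm_apply x

theorem perm_inv_apply {α : Type*} (f : Equiv.Perm α) (x : α) : f⁻¹ (f x) = x :=
  f.symm_apply_apply x

/-! ### Level frames, and how the faces of a drawing run along the levels -/

namespace LevelFrame

variable {V : Type*} {G : SimpleGraph V} (A : LevelFrame G)

theorem lev_inv (v : V) : A.lev (A.nx⁻¹ v) = A.lev v := by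
  have := A.lev_nx (A.nx⁻¹ v)
  rwa [perm_apply_inv, eq_comm] at this

theorem lev_zpow (n : ℤ) (v : V) : A.lev ((A.nx ^ n) v) = A.lev v := by
  induction n with
  | zero => simp
  | succ n ih => rw [add_comm, zpow_add, Equiv.Perm.mul_apply, zpow_one, A.lev_nx, ih]
  | pred n ih => rw [sub_eq_add_neg, add_comm, zpow_add, Equiv.Perm.mul_apply, zpow_neg_one,
      A.lev_inv, ih]

theorem lev_iterate (n : ℕ) (v : V) : A.lev (A.nx^[n] v) = A.lev v := by
  have := A.lev_zpow n v
  rwa [zpow_natCast, Equiv.Perm.coe_pow] at this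

theorem adj_inv (v : V) : G.Adj v (A.nx⁻¹ v) := by
  have := (A.adj_nx (A.nx⁻¹ v)).symm
  rwa [perm_apply_inv] at this

theorem lev_rung_ne (v : V) : A.lev (A.rung v) ≠ A.lev v := by
  have := A.lev_rung v
  omega

/-- A rung changes the level and the two neighbours on the cycle do not, so the edge back can only
be the rung at the other end. -/
theorem rung_rung (v : V) : A.rung (A.rung v) = v := by
  rcases A.adj_cases _ _ (A.adj_rung v).symm with h | h | h
  · exact absurd (by rw [h, A.lev_nx, ← h]) (A.lev_rung_ne v)
  · exact absurd (by rw [h, A.lev_inv, ← h]) (A.lev_rung_ne v)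
  · exact h.symm

theorem inv_ne_nx (v : V) : A.nx⁻¹ v ≠ A.nx v := by
  intro h
  apply A.nx_nx_ne (A.nx⁻¹ v)
  rw [perm_apply_inv, h]

theorem rung_ne_nx (v : V) : A.rung v ≠ A.nx v := by
  intro h
  exact A.lev_rung_ne v (by rw [h, A.lev_nx])

theorem rung_ne_inv (v : V) : A.rung v ≠ A.nx⁻¹ v := by
  intro h
  exact A.lev_rung_ne v (by rw [h, A.lev_inv])

/-- the dart that leads to the next vertex of the level -/
def fw (v : V) : G.Dart := ⟨(v, A.nx v), A.adj_nx v⟩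

/-- the dart that leads to the previous vertex of the level -/
def bw (v : V) : G.Dart := ⟨(v, A.nx⁻¹ v), A.adj_inv v⟩

/-- the dart that leads to the vertex of another level -/
def rg (v : V) : G.Dart := ⟨(v, A.rung v), A.adj_rung v⟩

theorem dart_cases (d : G.Dart) : d = A.fw d.fst ∨ d = A.bw d.fst ∨ d = A.rg d.fst := by
  rcases A.adj_cases _ _ d.adj with h | h | h
  · exact .inl (SimpleGraph.Dart.ext _ _ (Prod.ext rfl h))
  · exact .inr (.inl (SimpleGraph.Dart.ext _ _ (Prod.ext rfl h)))
  · exact .inr (.inr (SimpleGraph.Dart.ext _ _ (Prod.ext rfl h)))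

theorem bw_ne_fw (v : V) : A.bw v ≠ A.fw v := fun h =>
  A.inv_ne_nx v (congrArg (fun d : G.Dart => d.snd) h)

theorem rg_ne_fw (u v : V) : A.rg u ≠ A.fw v := fun h => by
  have h1 : u = v := congrArg (fun d : G.Dart => d.fst) h
  subst h1
  exact A.rung_ne_nx u (congrArg (fun d : G.Dart => d.snd) h)

theorem rg_ne_bw (u v : V) : A.rg u ≠ A.bw v := fun h => by
  have h1 : u = v := congrArg (fun d : G.Dart => d.fst) h
  subst h1
  exact A.rung_ne_inv u (congrArg (fun d : G.Dart => d.snd) h)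

theorem rg_injective {u v : V} (h : A.rg u = A.rg v) : u = v :=
  congrArg (fun d : G.Dart => d.fst) h

theorem symm_fw (v : V) : (A.fw v).symm = A.bw (A.nx v) :=
  SimpleGraph.Dart.ext _ _ (by simp [fw, bw])

theorem symm_bw (v : V) : (A.bw v).symm = A.fw (A.nx⁻¹ v) :=
  SimpleGraph.Dart.ext _ _ (by simp [fw, bw])

theorem symm_rg (v : V) : (A.rg v).symm = A.rg (A.rung v) :=
  SimpleGraph.Dart.ext _ _ (by simp [rg, A.rung_rung])

theorem isCubic {V : Type*} {G : SimpleGraph V} (A : LevelFrame G)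
    (P : PlaneEmbedding G) : P.IsCubic := by
  intro v
  rw [Set.ncard_eq_three]
  refine ⟨A.nx v, A.nx⁻¹ v, A.rung v, (A.inv_ne_nx v).symm, (A.rung_ne_nx v).symm,
    (A.rung_ne_inv v).symm, ?_⟩
  ext w
  simp only [SimpleGraph.mem_neighborSet, Set.mem_insert_iff, Set.mem_singleton_iff]
  refine ⟨A.adj_cases v w, ?_⟩
  rintro (rfl | rfl | rfl)
  exacts [A.adj_nx v, A.adj_inv v, A.adj_rung v]

/-- the same levels, run through in the opposite direction -/
def mirror : LevelFrame G where
  nx := A.nx⁻¹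
  rung := A.rung
  lev := A.lev
  q := A.q
  adj_nx := A.adj_inv
  adj_rung := A.adj_rung
  nx_nx_ne v h := A.nx_nx_ne v (by
    rw [← Equiv.Perm.mul_apply, ← mul_inv_rev, Equiv.Perm.inv_eq_iff_eq] at h
    exact h.symm)
  adj_cases v w h := by
    rw [inv_inv]
    have := A.adj_cases v w h
    tauto
  lev_nx := A.lev_inv
  lev_rung := A.lev_rung
  sameCycle u v h := (A.sameCycle u v h).inv
  lev_nonneg := A.lev_nonneg
  lev_lt := A.lev_lt
  exists_lev := A.exists_lev

/-- the same levels in reversed order -/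
def flip : LevelFrame G where
  nx := A.nx
  rung := A.rung
  lev v := A.q - 1 - A.lev v
  q := A.q
  adj_nx := A.adj_nx
  adj_rung := A.adj_rung
  nx_nx_ne := A.nx_nx_ne
  adj_cases := A.adj_cases
  lev_nx v := by rw [A.lev_nx]
  lev_rung v := by have := A.lev_rung v; omega
  sameCycle u v h := A.sameCycle u v (by omega)
  lev_nonneg v := by have := A.lev_lt v; omega
  lev_lt v := by have := A.lev_nonneg v; omega
  exists_lev i h0 h1 := by
    obtain ⟨v, hv⟩ := A.exists_lev (A.q - 1 - i) (by omega) (by omega)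
    exact ⟨v, by omega⟩

theorem mirror_fw (v : V) : A.mirror.fw v = A.bw v := rfl

theorem mirror_bw (v : V) : A.mirror.bw v = A.fw v :=
  SimpleGraph.Dart.ext _ _ (by simp [fw, bw, mirror])

theorem mirror_rg (v : V) : A.mirror.rg v = A.rg v := rfl

/-- the vertex `v` is joined to the next level -/
def Up (v : V) : Prop := A.lev (A.rung v) = A.lev v + 1

theorem not_up {v : V} : ¬ A.Up v ↔ A.lev (A.rung v) = A.lev v - 1 := by
  have := A.lev_rung v
  unfold Up
  omega

theorem up_rung {v : V} : A.Up (A.rung v) ↔ ¬ A.Up v := by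
  rw [not_up, Up, A.rung_rung]
  omega

theorem mirror_up {v : V} : A.mirror.Up v ↔ A.Up v := Iff.rfl

theorem flip_up {v : V} : A.flip.Up v ↔ ¬ A.Up v := by
  have := A.lev_rung v
  simp only [Up, flip]
  omega

variable (P : PlaneEmbedding G)

/-- in the drawing `P`, the rung at `v` is on the left of the level of `v` -/
def Left (v : V) : Prop := P.map.rot (A.fw v) = A.rg v

variable {A P}

theorem Left.rot_rg {v : V} (h : A.Left P v) : P.map.rot (A.rg v) = A.bw v := by
  rcases (A.isCubic P).eq_or (d := A.fw v) (e := A.bw v) rfl with h1 | h1 | h1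
  · exact absurd h1 (A.bw_ne_fw v)
  · exact absurd (h1.trans h).symm (A.rg_ne_bw v v)
  · rw [h1, ← h]

theorem Left.rot_bw {v : V} (h : A.Left P v) : P.map.rot (A.bw v) = A.fw v := by
  rw [← h.rot_rg, ← h]
  exact (A.isCubic P).rot_rot_rot _

theorem rot_fw {v : V} (h : ¬ A.Left P v) : P.map.rot (A.fw v) = A.bw v := by
  rcases (A.isCubic P).eq_or (d := A.rg v) (e := P.map.rot (A.fw v))
    (PlaneEmbedding.fst_rot _) with h1 | h1 | h1
  · exact absurd h1 h
  · exact absurd (P.map.rot.injective h1).symm (A.rg_ne_fw v v)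
  · have h2 := P.map.rot.injective h1
    rw [h2, (A.isCubic P).eq_or (d := A.rg v) (e := A.bw v) rfl |>.resolve_left
      (fun h => A.rg_ne_bw v v h.symm) |>.resolve_left (fun h => A.bw_ne_fw v (h.trans h2.symm))]

theorem left_mirror {v : V} : A.mirror.Left P v ↔ ¬ A.Left P v := by
  unfold Left
  rw [mirror_fw, mirror_rg]
  constructor
  · intro h h1
    have := Left.rot_bw h1
    exact A.rg_ne_fw v v (h.symm.trans this)
  · intro h
    rcases (A.isCubic P).eq_or (d := A.bw v) (e := A.rg v) rfl with h1 | h1 | h1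
    · exact absurd h1 (A.rg_ne_bw v v)
    · exact h1.symm
    · exfalso
      have h2 := rot_fw (P := P) h
      rw [← h2] at h1
      rw [(A.isCubic P).rot_rot_rot] at h1
      exact A.rg_ne_fw v v h1

theorem rot_rg {v : V} (h : ¬ A.Left P v) : P.map.rot (A.rg v) = A.fw v := by
  have := Left.rot_rg (A := A.mirror) (left_mirror.2 h)
  rwa [mirror_bw, mirror_rg] at this

theorem rot_bw {v : V} (h : ¬ A.Left P v) : P.map.rot (A.bw v) = A.rg v :=
  left_mirror.2 h

theorem face_fw_of_left {u : V} (h : A.Left P (A.nx u)) :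
    P.map.face (A.fw u) = A.rg (A.nx u) := by
  rw [PlaneEmbedding.face_eq_iff, h.rot_rg, A.symm_fw]

theorem face_fw_of_not_left {u : V} (h : ¬ A.Left P (A.nx u)) :
    P.map.face (A.fw u) = A.fw (A.nx u) := by
  rw [PlaneEmbedding.face_eq_iff, rot_fw h, A.symm_fw]

theorem face_bw_of_left {u : V} (h : A.Left P (A.nx⁻¹ u)) :
    P.map.face (A.bw u) = A.bw (A.nx⁻¹ u) := by
  rw [PlaneEmbedding.face_eq_iff, h.rot_bw, A.symm_bw]

theorem face_bw_of_not_left {u : V} (h : ¬ A.Left P (A.nx⁻¹ u)) :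
    P.map.face (A.bw u) = A.rg (A.nx⁻¹ u) := by
  rw [PlaneEmbedding.face_eq_iff, rot_rg h, A.symm_bw]

theorem face_rg_of_left {u : V} (h : A.Left P (A.rung u)) :
    P.map.face (A.rg u) = A.fw (A.rung u) := by
  rw [PlaneEmbedding.face_eq_iff, h, A.symm_rg]

theorem face_rg_of_not_left {u : V} (h : ¬ A.Left P (A.rung u)) :
    P.map.face (A.rg u) = A.bw (A.rung u) := by
  rw [PlaneEmbedding.face_eq_iff, rot_bw h, A.symm_rg]

theorem iterate_face_fw_eq_fw {u : V} {s : ℕ} (hs : ∀ j, j < s → ¬ A.Left P (A.nx^[j + 1] u)) :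
    P.map.face^[s] (A.fw u) = A.fw (A.nx^[s] u) := by
  induction s with
  | zero => rfl
  | succ s ih =>
    rw [iterate_succ_apply', ih fun j hj => hs j (by omega), face_fw_of_not_left,
      iterate_succ_apply']
    have := hs s (by omega)
    rwa [iterate_succ_apply'] at this

/-- The face on the left of a level follows the level until it meets a rung. -/
theorem iterate_face_fw {u : V} {s : ℕ} (hs : ∀ j, j < s → ¬ A.Left P (A.nx^[j + 1] u))
    (h : A.Left P (A.nx^[s + 1] u)) :
    P.map.face^[s + 1] (A.fw u) = A.rg (A.nx^[s + 1] u) := by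
  rw [iterate_succ_apply', iterate_face_fw_eq_fw hs, face_fw_of_left, iterate_succ_apply']
  rwa [iterate_succ_apply'] at h

theorem iterate_face_bw_eq_bw {u : V} {s : ℕ}
    (hs : ∀ j, j < s → A.Left P ((⇑A.nx⁻¹)^[j + 1] u)) :
    P.map.face^[s] (A.bw u) = A.bw ((⇑A.nx⁻¹)^[s] u) :=
  iterate_face_fw_eq_fw (A := A.mirror) fun j hj => by rw [left_mirror, not_not]; exact hs j hj

theorem iterate_face_bw {u : V} {s : ℕ} (hs : ∀ j, j < s → A.Left P ((⇑A.nx⁻¹)^[j + 1] u))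
    (h : ¬ A.Left P ((⇑A.nx⁻¹)^[s + 1] u)) :
    P.map.face^[s + 1] (A.bw u) = A.rg ((⇑A.nx⁻¹)^[s + 1] u) :=
  iterate_face_fw (A := A.mirror) (fun j hj => by rw [left_mirror, not_not]; exact hs j hj)
    (left_mirror.2 h)

/-- On a level, any vertex is reached from any other vertex. -/
theorem exists_iterate [Finite V] {u v : V} (h : A.lev u = A.lev v) : ∃ n, A.nx^[n] u = v := by
  obtain ⟨n, hn⟩ := (A.sameCycle u v h).exists_nat_pow_eq
  exact ⟨n, by rwa [Equiv.Perm.coe_pow] at hn⟩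

/-- The first vertex after `u` with a given property that some vertex of the level has. -/
theorem exists_first [Finite V] {p : V → Prop} {u : V} (h : ∃ v, A.lev u = A.lev v ∧ p v) :
    ∃ s, (∀ j, j < s → ¬ p (A.nx^[j + 1] u)) ∧ p (A.nx^[s + 1] u) := by
  classical
  have : ∃ s, p (A.nx^[s + 1] u) := by
    obtain ⟨v, h1, h2⟩ := h
    obtain ⟨n, hn⟩ := exists_iterate (A := A) (u := A.nx u) (v := v) (by rw [A.lev_nx, h1])
    exact ⟨n, by rwa [iterate_succ_apply, hn]⟩
  exact ⟨Nat.find this, fun j hj => Nat.find_min this hj, Nat.find_spec this⟩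

variable (P)

/-- In the drawing `P`, the faces are as long as in a fullerene. -/
def ShortFaces (_ : LevelFrame G) (P : PlaneEmbedding G) : Prop :=
  ∀ d, minimalPeriod P.map.face d = 5 ∨ minimalPeriod P.map.face d = 6

variable {P}

theorem lev_snd (d : G.Dart) : A.lev d.snd = A.lev d.fst ∨ A.lev d.snd = A.lev d.fst + 1 ∨
    A.lev d.snd = A.lev d.fst - 1 := by
  rcases A.adj_cases _ _ d.adj with h | h | h
  · exact .inl (by rw [show d.snd = _ from h, A.lev_nx])
  · exact .inl (by rw [show d.snd = _ from h, A.lev_inv])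
  · exact .inr (by rw [show d.snd = _ from h]; exact A.lev_rung _)

/-- A face of length at most six contains at most one ascending rung. -/
theorem ShortFaces.iterate_eq (hP : A.ShortFaces P) {u v : V} (hu : A.Up u) (hv : A.Up v) {t : ℕ}
    (ht : P.map.face^[t] (A.rg u) = A.rg v) : u = v := by
  have hl : ∀ t, A.lev (P.map.face^[t + 1] (A.rg u)).fst = A.lev (P.map.face^[t] (A.rg u)).snd := by
    intro t
    rw [iterate_succ_apply', PlaneEmbedding.fst_face]
  have := dvd_of_ascent (l := fun t => A.lev (P.map.face^[t] (A.rg u)).fst) (hP (A.rg u))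
    (fun t => by
      show A.lev (P.map.face^[t + minimalPeriod P.map.face (A.rg u)] (A.rg u)).fst = _
      rw [iterate_add_minimalPeriod_eq])
    (fun t => by simp only [hl]; exact lev_snd _)
    (fun t h => by
      simp only [hl t] at h
      simp only [hl]
      rw [iterate_succ_apply']
      set d := P.map.face^[t] (A.rg u)
      -- Only a rung changes the level, and the dart of the face after a rung runs along a level.
      rcases A.dart_cases d with h1 | h1 | h1
      · exact absurd (by rw [h1]; exact A.lev_nx _) h
      · exact absurd (by rw [h1]; exact A.lev_inv _) h
      · rw [h1]
        by_cases h2 : A.Left P (A.rung d.fst)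
        · rw [face_rg_of_left h2]
          exact A.lev_nx _
        · rw [face_rg_of_not_left h2]
          exact A.lev_inv _)
    (by simp only [hl 0]; exact hu) (t := t) (by simp only [hl]; rw [ht]; exact hv)
  obtain ⟨m, rfl⟩ := this
  rw [(isPeriodicPt_minimalPeriod P.map.face (A.rg u)).mul_const m] at ht
  exact A.rg_injective ht

/-- Reversing the order of the levels exchanges ascents and descents. -/
theorem ShortFaces.iterate_eq_of_not_up (hP : A.ShortFaces P) {u v : V} (hu : ¬ A.Up u)
    (hv : ¬ A.Up v) {t : ℕ} (ht : P.map.face^[t] (A.rg u) = A.rg v) : u = v :=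
  ShortFaces.iterate_eq (A := A.flip) hP (A.flip_up.2 hu) (A.flip_up.2 hv) ht

end LevelFrame


/-! ### Drawings by concentric circles: Euler's formula and the shape of a face -/

namespace LevelFrame

variable {V : Type*} {G : SimpleGraph V} {A : LevelFrame G} {P : PlaneEmbedding G}

/-- An upper bound for the level that is not exceeded by a rung is not exceeded at all. -/
theorem exists_up (hG : G.Connected) {v : V} (hv : A.lev v < A.q - 1) :
    ∃ u, A.lev v = A.lev u ∧ A.Up u := by
  by_contra! hno
  obtain ⟨w, hw⟩ := A.exists_lev (A.q - 1) (by have := A.lev_nonneg v; omega) (by omega)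
  obtain ⟨p⟩ := hG.preconnected v w
  have : ∀ x y : V, G.Walk x y → A.lev x ≤ A.lev v → A.lev y ≤ A.lev v := by
    intro x y p
    induction p with
    | nil => exact id
    | @cons x y z hxy p ih =>
      intro hx
      apply ih
      have h1 := A.lev_nx x
      have h2 := A.lev_inv x
      have h3 := A.lev_rung x
      rcases A.adj_cases _ _ hxy with rfl | rfl | rfl
      · omega
      · omega
      · by_contra! h
        exact hno x (by omega) (show _ = _ by omega)
  have := this v w p le_rfl
  omega

theorem exists_not_up (hG : G.Connected) {v : V} (hv : 0 < A.lev v) :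
    ∃ u, A.lev v = A.lev u ∧ ¬ A.Up u := by
  obtain ⟨u, h1, h2⟩ := exists_up (A := A.flip) hG (v := v)
    (by show A.q - 1 - A.lev v < A.q - 1; omega)
  refine ⟨u, ?_, A.flip_up.1 h2⟩
  change A.q - 1 - A.lev v = A.q - 1 - A.lev u at h1
  omega

theorem up_of_lev_eq_zero {v : V} (h : A.lev v = 0) : A.Up v := by
  by_contra h1
  rw [not_up] at h1
  have := A.lev_nonneg (A.rung v)
  omega

theorem not_up_of_lev_eq {v : V} (h : A.lev v = A.q - 1) : ¬ A.Up v := by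
  intro h1
  have := A.lev_lt (A.rung v)
  unfold Up at h1
  omega

/-- In the drawing `P` the levels are concentric circles, run through counterclockwise, from the
inside to the outside. -/
def Oriented (A : LevelFrame G) (P : PlaneEmbedding G) : Prop := ∀ v, A.Left P v ↔ ¬ A.Up v

theorem Oriented.reverse (h : A.Oriented P) : A.flip.mirror.Oriented P := by
  intro v
  rw [left_mirror, mirror_up, flip_up]
  exact not_congr (h v)

theorem sameCycle_iterate {α : Type*} (f : Equiv.Perm α) (n : ℕ) (x : α) :
    f.SameCycle x (f^[n] x) := ⟨n, by rw [zpow_natCast, Equiv.Perm.coe_pow]⟩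

/-- A backward dart has the exterior of its circle on the left; the face there follows the circle up
to the next outward rung. Such a rung exists by connectedness, unless the circle is the last one.
This and the next two lemmas show that every face but the innermost and the outermost has an
ascending rung. -/
theorem Oriented.sameCycle_bw [Finite V] (h : A.Oriented P) (hG : G.Connected) {v : V}
    (hv : A.lev v < A.q - 1) : ∃ u, A.Up u ∧ P.map.face.SameCycle (A.rg u) (A.bw v) := by
  obtain ⟨s, h1, h2⟩ := exists_first (A := A.mirror) (exists_up hG hv)
  refine ⟨_, h2, ?_⟩
  have := iterate_face_bw (A := A) (P := P) (u := v) (s := s)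
    (fun j hj => (h _).2 (h1 j hj)) (fun h3 => (h _).1 h3 h2)
  refine Equiv.Perm.SameCycle.symm ?_
  have h4 := sameCycle_iterate P.map.face (s + 1) (A.bw v)
  rwa [this] at h4

theorem Oriented.sameCycle_rg [Finite V] (h : A.Oriented P) (hG : G.Connected) (v : V) :
    ∃ u, A.Up u ∧ P.map.face.SameCycle (A.rg u) (A.rg v) := by
  by_cases hv : A.Up v
  · exact ⟨v, hv, Equiv.Perm.SameCycle.refl _ _⟩
  · have h1 : A.lev (A.rung v) < A.q - 1 := by
      have := A.lev_lt v
      rw [not_up] at hv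
      omega
    obtain ⟨u, hu, h2⟩ := h.sameCycle_bw hG h1
    refine ⟨u, hu, h2.trans ?_⟩
    have h3 := sameCycle_iterate P.map.face 1 (A.rg v)
    rw [iterate_one, face_rg_of_not_left (fun h4 => (h _).1 h4 (A.up_rung.2 hv))] at h3
    exact h3.symm

theorem Oriented.sameCycle_fw [Finite V] (h : A.Oriented P) (hG : G.Connected) {v : V}
    (hv : 0 < A.lev v) : ∃ u, A.Up u ∧ P.map.face.SameCycle (A.rg u) (A.fw v) := by
  obtain ⟨s, h1, h2⟩ := exists_first (exists_not_up hG hv)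
  obtain ⟨u, hu, h3⟩ := h.sameCycle_rg hG (A.nx^[s + 1] v)
  refine ⟨u, hu, h3.trans (Equiv.Perm.SameCycle.symm ?_)⟩
  rw [← iterate_face_fw (P := P) (fun j hj h4 => h1 j hj fun h5 => (h _).1 h4 h5) ((h _).2 h2)]
  exact sameCycle_iterate _ _ _

theorem Oriented.sameCycle_fw_fw [Finite V] (h : A.Oriented P) {u v : V}
    (hu : A.lev u = 0) (hv : A.lev v = 0) : P.map.face.SameCycle (A.fw u) (A.fw v) := by
  obtain ⟨n, rfl⟩ := exists_iterate (A := A) (u := u) (v := v) (by omega)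
  rw [← iterate_face_fw_eq_fw (P := P)]
  · exact sameCycle_iterate _ _ _
  · intro j _ h1
    exact (h _).1 h1 (up_of_lev_eq_zero (by rw [A.lev_iterate, hu]))

theorem Oriented.sameCycle_bw_bw [Finite V] (h : A.Oriented P) {u v : V}
    (hu : A.lev u = A.q - 1) (hv : A.lev v = A.q - 1) :
    P.map.face.SameCycle (A.bw u) (A.bw v) := by
  have := h.reverse.sameCycle_fw_fw (u := u) (v := v)
    (show A.q - 1 - A.lev u = 0 by omega) (show A.q - 1 - A.lev v = 0 by omega)
  exact this

theorem two_mul_card_edgeSet [Finite V] (A : LevelFrame G) :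
    2 * Nat.card G.edgeSet = 3 * Nat.card V := by
  classical
  have := Fintype.ofFinite V
  have h := G.sum_degrees_eq_twice_card_edges
  have hd : ∀ v, G.degree v = 3 := by
    intro v
    have : (G.neighborSet v).ncard = 3 := by
      rw [Set.ncard_eq_three]
      refine ⟨A.nx v, A.nx⁻¹ v, A.rung v, (A.inv_ne_nx v).symm, (A.rung_ne_nx v).symm,
        (A.rung_ne_inv v).symm, ?_⟩
      ext w
      simp only [SimpleGraph.mem_neighborSet, Set.mem_insert_iff, Set.mem_singleton_iff]
      refine ⟨A.adj_cases v w, ?_⟩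
      rintro (rfl | rfl | rfl)
      exacts [A.adj_nx v, A.adj_inv v, A.adj_rung v]
    rw [← this, Set.ncard_eq_toFinset_card', SimpleGraph.degree, SimpleGraph.neighborFinset]
  simp only [hd, Finset.sum_const, Finset.card_univ, smul_eq_mul] at h
  rw [Nat.card_eq_fintype_card, Nat.card_eq_fintype_card, ← SimpleGraph.edgeFinset_card]
  omega

/-- Every rung has one lower and one upper end, so `rung` exchanges the two kinds of vertices. -/
theorem two_mul_card_up [Finite V] (A : LevelFrame G) :
    2 * Nat.card {v // A.Up v} = Nat.card V := by
  classical
  have e : {v // A.Up v} ≃ {v // ¬ A.Up v} :=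
    { toFun := fun v => ⟨A.rung v, fun h => (A.up_rung.1 h) v.2⟩
      invFun := fun v => ⟨A.rung v, A.up_rung.2 v.2⟩
      left_inv := fun v => Subtype.ext (A.rung_rung v)
      right_inv := fun v => Subtype.ext (A.rung_rung v) }
  have h1 := Nat.card_congr (Equiv.sumCompl A.Up)
  rw [Nat.card_sum, ← Nat.card_congr e] at h1
  omega

/-- Every face has at most one ascending rung. -/
def UniqueAscent (A : LevelFrame G) (P : PlaneEmbedding G) : Prop :=
  ∀ u v, A.Up u → A.Up v → P.map.face.SameCycle (A.rg u) (A.rg v) → u = v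

theorem ShortFaces.uniqueAscent (h : A.ShortFaces P) : A.UniqueAscent P := by
  intro u v hu hv h1
  have := P.finite_dart
  obtain ⟨n, hn⟩ := h1.exists_nat_pow_eq
  rw [Equiv.Perm.coe_pow] at hn
  exact h.iterate_eq hu hv hn

/-- By Euler's formula there are just two faces without ascending rungs, and each of the other faces
has just one of them. -/
theorem Oriented.uniqueAscent (h : A.Oriented P) : A.UniqueAscent P := by
  have := P.finite
  have := P.finite_dart
  have hG := P.connected
  intro u v hu hv huv
  have hq : 0 < A.q := (A.lev_nonneg u).trans_lt (A.lev_lt u)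
  obtain ⟨a, ha⟩ := A.exists_lev 0 le_rfl hq
  obtain ⟨b, hb⟩ := A.exists_lev (A.q - 1) (by omega) (by omega)
  -- The two extra values stand for the innermost face, on the left of `A.fw a`, and the outermost
  -- face, on the left of `A.bw b`.
  let φ : Option (Option {v // A.Up v}) → P.map.Face
    | some (some u) => Quotient.mk _ (A.rg u)
    | some none => Quotient.mk _ (A.fw a)
    | none => Quotient.mk _ (A.bw b)
  have hφ : Surjective φ := by
    intro x
    induction x using Quotient.inductionOn with | _ d =>
    have fin : (∃ u, A.Up u ∧ P.map.face.SameCycle (A.rg u) d) → ∃ y, φ y = ⟦d⟧ := by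
      rintro ⟨u, hu, h1⟩
      exact ⟨some (some ⟨u, hu⟩), Quotient.sound h1⟩
    rcases A.dart_cases d with h1 | h1 | h1
    · rcases (A.lev_nonneg d.fst).eq_or_lt with h0 | h0
      · refine ⟨some none, Quotient.sound ?_⟩
        rw [h1]
        exact h.sameCycle_fw_fw ha h0.symm
      · rw [h1] at fin ⊢
        exact fin (h.sameCycle_fw hG h0)
    · rcases lt_or_ge (A.lev d.fst) (A.q - 1) with h0 | h0
      · rw [h1] at fin ⊢
        exact fin (h.sameCycle_bw hG h0)
      · refine ⟨none, Quotient.sound ?_⟩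
        rw [h1]
        exact h.sameCycle_bw_bw hb (by have := A.lev_lt d.fst; omega)
    · rw [h1] at fin ⊢
      exact fin (h.sameCycle_rg hG _)
  -- With `n` vertices there are `3n/2` edges, hence `n/2 + 2` faces by Euler's formula, while the
  -- source of `φ` has `n/2 + 2` elements. A surjection between finite sets of equal size is
  -- injective.
  have hc : Nat.card (Option (Option {v // A.Up v})) ≤ Nat.card P.map.Face := by
    have h1 := P.euler
    have h2 := A.two_mul_card_edgeSet
    have h3 := A.two_mul_card_up
    rw [Finite.card_option, Finite.card_option]
    omega
  have hinj := (hφ.bijective_of_nat_card_le hc).1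
  have h2 := @hinj (some (some ⟨u, hu⟩)) (some (some ⟨v, hv⟩)) (Quotient.sound huv)
  simpa using h2

theorem inv_iterate_iterate {α : Type*} (f : Equiv.Perm α) {m n : ℕ} (h : m ≤ n) (x : α) :
    (⇑f⁻¹)^[m] (f^[n] x) = f^[n - m] x := by
  obtain ⟨c, rfl⟩ := Nat.exists_eq_add_of_le h
  rw [iterate_add_apply, (show LeftInverse (⇑f⁻¹) f from perm_inv_apply f).iterate m]
  congr 1
  omega

theorem iterate_inv_iterate {α : Type*} (f : Equiv.Perm α) {m n : ℕ} (h : m ≤ n) (x : α) :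
    f^[m] ((⇑f⁻¹)^[n] x) = (⇑f⁻¹)^[n - m] x := by
  obtain ⟨c, rfl⟩ := Nat.exists_eq_add_of_le h
  rw [iterate_add_apply, (show LeftInverse f (⇑f⁻¹) from perm_apply_inv f).iterate m]
  congr 1
  omega

/-- The face on the left of an ascending rung. -/
theorem Oriented.exists_gaps (h : A.Oriented P) (hU : A.UniqueAscent P) {u : V} (hu : A.Up u) :
    ∃ s t, (∀ j, j < s → A.Up (A.nx^[j + 1] (A.rung u))) ∧ ¬ A.Up (A.nx^[s + 1] (A.rung u)) ∧
      (∀ j, j < t → ¬ A.Up (A.nx^[j + 1] u)) ∧ A.Up (A.nx^[t + 1] u) ∧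
      A.rung (A.nx^[t + 1] u) = A.nx^[s + 1] (A.rung u) ∧
      minimalPeriod P.map.face (A.rg u) = s + t + 4 := by
  have := P.finite
  have hu' : ¬ A.Up (A.rung u) := fun h1 => A.up_rung.1 h1 hu
  obtain ⟨s, h1, h2⟩ := exists_first (A := A) (p := fun v => ¬ A.Up v) (u := A.rung u)
    ⟨_, rfl, hu'⟩
  simp only [not_not] at h1
  set v := A.nx^[s + 1] (A.rung u) with hv
  have hlev : A.lev (A.rung v) = A.lev u := by
    rw [A.not_up.1 h2, hv, A.lev_iterate, hu]
    omega
  obtain ⟨t, h3, h4⟩ := exists_first (A := A.mirror) (p := A.Up) (u := A.rung v)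
    ⟨u, hlev, hu⟩
  change ∀ j, j < t → ¬ A.Up ((⇑A.nx⁻¹)^[j + 1] (A.rung v)) at h3
  change A.Up ((⇑A.nx⁻¹)^[t + 1] (A.rung v)) at h4
  have e1 : P.map.face (A.rg u) = A.fw (A.rung u) := face_rg_of_left ((h _).2 hu')
  have e2 : ∀ j ≤ s, P.map.face^[j] (A.fw (A.rung u)) = A.fw (A.nx^[j] (A.rung u)) := fun j hj =>
    iterate_face_fw_eq_fw fun i hi => fun hl => (h _).1 hl (h1 i (by omega))
  have e3 : P.map.face^[s + 1] (A.fw (A.rung u)) = A.rg v :=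
    iterate_face_fw (fun i hi => fun hl => (h _).1 hl (h1 i hi)) ((h _).2 h2)
  have e4 : P.map.face (A.rg v) = A.bw (A.rung v) :=
    face_rg_of_not_left fun hl => (h _).1 hl (A.up_rung.2 h2)
  have e5 : ∀ j ≤ t, P.map.face^[j] (A.bw (A.rung v)) = A.bw ((⇑A.nx⁻¹)^[j] (A.rung v)) :=
    fun j hj => iterate_face_bw_eq_bw fun i hi => (h _).2 (h3 i (by omega))
  have e6 : P.map.face^[t + 1] (A.bw (A.rung v)) = A.rg ((⇑A.nx⁻¹)^[t + 1] (A.rung v)) :=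
    iterate_face_bw (fun i hi => (h _).2 (h3 i hi)) (fun hl => (h _).1 hl h4)
  have e7 : P.map.face^[s + t + 4] (A.rg u) = A.rg ((⇑A.nx⁻¹)^[t + 1] (A.rung v)) := by
    rw [show s + t + 4 = (t + 1) + 1 + ((s + 1) + 1) by omega, iterate_add_apply,
      iterate_add_apply _ (s + 1), iterate_one, e1, e3, iterate_add_apply, iterate_one, e4, e6]
  -- The walk has come to an ascending rung of the same face, and this face has only one.
  have e8 : (⇑A.nx⁻¹)^[t + 1] (A.rung v) = u := by
    refine (hU _ _ hu h4 ?_).symm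
    rw [← e7]
    exact sameCycle_iterate _ _ _
  have e9 : A.nx^[t + 1] u = A.rung v := by
    have := iterate_inv_iterate A.nx (le_refl (t + 1)) (A.rung v)
    rwa [e8, Nat.sub_self, iterate_zero, id] at this
  refine ⟨s, t, h1, h2, fun j hj => ?_, ?_, ?_, ?_⟩
  · have := iterate_inv_iterate A.nx (show j + 1 ≤ t + 1 by omega) (A.rung v)
    rw [e8] at this
    rw [this]
    have h5 := h3 (t - j - 1) (by omega)
    rwa [show t - j - 1 + 1 = t + 1 - (j + 1) by omega] at h5
  · rw [e9]
    exact A.up_rung.2 h2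
  · rw [e9, A.rung_rung]
  · rw [e8] at e7
    apply le_antisymm
    · exact IsPeriodicPt.minimalPeriod_le (by omega) e7
    -- A shorter period would return to `A.rg u` at a dart listed above, but each of these runs
    -- along a level or descends.
    · by_contra! hlt
      have hp := isPeriodicPt_minimalPeriod P.map.face (A.rg u)
      have hpos : 0 < minimalPeriod P.map.face (A.rg u) :=
        IsPeriodicPt.minimalPeriod_pos (n := s + t + 4) (by omega) e7
      set n := minimalPeriod P.map.face (A.rg u)
      change P.map.face^[n] (A.rg u) = A.rg u at hp
      rcases lt_trichotomy n (s + 2) with hn | hn | hn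
      · obtain ⟨j, hj⟩ := Nat.exists_eq_succ_of_ne_zero hpos.ne'
        rw [hj, iterate_succ_apply, e1, e2 j (by omega)] at hp
        exact A.rg_ne_fw _ _ hp.symm
      · rw [hn, iterate_succ_apply, e1, e3] at hp
        rw [A.rg_injective hp] at h2
        exact h2 hu
      · obtain ⟨j, hj⟩ := Nat.exists_eq_add_of_le' (show s + 3 ≤ n by omega)
        rw [hj, iterate_add_apply, iterate_succ_apply, e1, iterate_succ_apply', e3, e4,
          e5 j (by omega)] at hp
        exact A.rg_ne_bw _ _ hp.symm

end LevelFrame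


/-! ### Rigidity: levels in arbitrary drawings with short faces, and the height of a face -/

namespace LevelFrame

variable {V : Type*} {G : SimpleGraph V} {A : LevelFrame G} {P : PlaneEmbedding G}

/-- Successive rungs on the left of a level have the same direction. -/
theorem ShortFaces.up_iff_up_iterate (hP : A.ShortFaces P) {u : V} {s : ℕ}
    (hu : A.Left P u) (hs : ∀ j, j < s → ¬ A.Left P (A.nx^[j + 1] u))
    (hv : A.Left P (A.nx^[s + 1] u)) : A.Up u ↔ A.Up (A.nx^[s + 1] u) := by
  have e : P.map.face^[s + 2] (A.rg (A.rung u)) = A.rg (A.nx^[s + 1] u) := by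
    rw [iterate_succ_apply, face_rg_of_left (by rwa [A.rung_rung]), A.rung_rung,
      iterate_face_fw hs hv]
  have hne : A.rung u ≠ A.nx^[s + 1] u := fun h =>
    A.lev_rung_ne u (by rw [h, A.lev_iterate])
  -- The face enters by the rung at `u` and leaves by the next rung on the left. If these have
  -- different directions as seen from the level, the face makes two ascents or two descents, which
  -- is too many for its length.
  by_cases h1 : A.Up u <;> by_cases h2 : A.Up (A.nx^[s + 1] u) <;> simp only [h1, h2]
  · exact (hne (hP.iterate_eq_of_not_up (fun h => A.up_rung.1 h h1) h2 e)).elim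
  · exact (hne (hP.iterate_eq (A.up_rung.2 h1) h2 e)).elim

/-- The rungs on the left of a level have all the same direction. -/
theorem ShortFaces.up_iff_up_of_left [Finite V] (hP : A.ShortFaces P) {u v : V}
    (h : A.lev u = A.lev v) (hu : A.Left P u) (hv : A.Left P v) : A.Up u ↔ A.Up v := by
  obtain ⟨n, rfl⟩ := exists_iterate h
  clear h
  induction n using Nat.strong_induction_on generalizing u with
  | _ n ih =>
    rcases n with _ | n
    · rfl
    · obtain ⟨s, h1, h2⟩ := exists_first (A := A) (p := A.Left P) (u := u)
        ⟨_, (A.lev_iterate (n + 1) u).symm, hv⟩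
      have hsn : s ≤ n := by
        by_contra! hlt
        exact h1 n hlt hv
      have e : A.nx^[n + 1] u = A.nx^[n - s] (A.nx^[s + 1] u) := by
        rw [← iterate_add_apply]
        congr 1
        omega
      rw [hP.up_iff_up_iterate hu h1 h2, e]
      refine ih (n - s) (by omega) h2 ?_
      rwa [← e]

/-- the rungs on the left of level `i` are those that lead to the next level -/
def OutLeft (A : LevelFrame G) (P : PlaneEmbedding G) (i : ℤ) : Prop :=
  ∀ v, A.lev v = i → (A.Left P v ↔ A.Up v)

/-- the rungs on the right of level `i` are those that lead to the next level -/
def OutRight (A : LevelFrame G) (P : PlaneEmbedding G) (i : ℤ) : Prop :=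
  ∀ v, A.lev v = i → (A.Left P v ↔ ¬ A.Up v)

/-- Rungs on the same side agree in direction (the right side is the left side of the mirrored
frame). If both directions occur on the level, each side must therefore carry exactly one of them.
-/
theorem ShortFaces.outLeft_or_outRight [Finite V] (hP : A.ShortFaces P) {u w : V}
    (h : A.lev u = A.lev w) (hu : A.Up u) (hw : ¬ A.Up w) :
    A.OutLeft P (A.lev u) ∨ A.OutRight P (A.lev u) := by
  have key : ∀ x y, A.lev x = A.lev y → (A.Left P x ↔ A.Left P y) → (A.Up x ↔ A.Up y) := by
    intro x y h1 h2
    by_cases h3 : A.Left P x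
    · exact hP.up_iff_up_of_left h1 h3 (h2.1 h3)
    · exact ShortFaces.up_iff_up_of_left (A := A.mirror) hP h1 (left_mirror.2 h3)
        (left_mirror.2 (fun h4 => h3 (h2.2 h4)))
  by_cases h1 : A.Left P u <;> by_cases h2 : A.Left P w
  · exact absurd ((key u w h (by tauto)).1 hu) hw
  · left
    intro v hv
    have := key v u hv
    have := key v w (hv.trans h)
    tauto
  · right
    intro v hv
    have := key v u hv
    have := key v w (hv.trans h)
    tauto
  · exact absurd ((key u w h (by tauto)).1 hu) hw

/-- there are no cycles of length three or four -/
def NoShortCycle (G : SimpleGraph V) : Prop :=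
  (∀ a b c, G.Adj a b → G.Adj b c → G.Adj c a → False) ∧
    ∀ a b c d, G.Adj a b → G.Adj b c → G.Adj c d → G.Adj d a → a ≠ c → b ≠ d → False

theorem NoShortCycle.four_lt (hg : NoShortCycle G) {n : ℕ} {u : V} (h : A.nx^[n + 1] u = u) :
    4 < n + 1 := by
  by_contra! hn
  have a : ∀ v, G.Adj v (A.nx v) := A.adj_nx
  have h2 := A.nx_nx_ne
  rcases n with _ | _ | _ | _ | n
  · have h0 := a u
    rw [show A.nx u = u from h] at h0
    exact h0.ne rfl
  · exact h2 u h
  · refine hg.1 u (A.nx u) (A.nx (A.nx u)) (a _) (a _) ?_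
    have h0 := a (A.nx (A.nx u))
    rwa [show A.nx (A.nx (A.nx u)) = u from h] at h0
  · refine hg.2 u (A.nx u) (A.nx (A.nx u)) (A.nx (A.nx (A.nx u))) (a _) (a _) (a _) ?_
      (h2 _).symm (h2 _).symm
    have h0 := a (A.nx (A.nx (A.nx u)))
    rwa [show A.nx (A.nx (A.nx (A.nx u))) = u from h] at h0
  · omega

/-- On the extreme levels all rungs have the same direction, so comparing directions says nothing
and the adjacent level has to help. The face that ascends at `u` follows level `1`, descends to
`A.nx u`, and must return to its only ascent, the rung at `u`. If it turned forward there, it would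
have to go around the whole of level `0`, which is too long. So it turns backward, and arrives at
`u` with the rung on the other side. -/
theorem ShortFaces.not_left_of_lev_eq_zero [Finite V] (hP : A.ShortFaces P)
    (hg : NoShortCycle G)
    (h0 : ∀ u, A.lev u = 0 → ∃ s, (∀ j, j < s → A.Up (A.nx^[j + 1] (A.rung u))) ∧
      A.rung (A.nx u) = A.nx^[s + 1] (A.rung u))
    (h1 : A.OutRight P 1) {u : V} (hu : A.lev u = 0) : ¬ A.Left P u := by
  obtain ⟨s, hs, hv⟩ := h0 u hu
  have up0 : ∀ w, A.lev w = 0 → A.Up w := fun w => up_of_lev_eq_zero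
  have l1 : A.lev (A.rung u) = 1 := by rw [up0 u hu, hu]; rfl
  have hnu : A.lev (A.nx u) = 0 := by rw [A.lev_nx, hu]
  have e1 : P.map.face (A.rg u) = A.fw (A.rung u) :=
    face_rg_of_left ((h1 _ l1).2 fun h => A.up_rung.1 h (up0 u hu))
  have hs' : ∀ j < s, ¬ A.Left P (A.nx^[j + 1] (A.rung u)) := fun j hj hl =>
    (h1 _ (by rw [A.lev_iterate, l1])).1 hl (hs j hj)
  have hd : ¬ A.Up (A.rung (A.nx u)) := fun h => A.up_rung.1 h (up0 _ hnu)
  have e3 : P.map.face^[s + 1] (A.fw (A.rung u)) = A.rg (A.rung (A.nx u)) := by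
    rw [hv]
    refine iterate_face_fw hs' ?_
    rw [← hv]
    refine (h1 _ ?_).2 hd
    rw [hv, A.lev_iterate, l1]
  have e4 : P.map.face^[s + 2] (A.rg u) = A.rg (A.rung (A.nx u)) := by
    rw [iterate_succ_apply, e1, e3]
  by_cases hl : A.Left P (A.nx u)
  · exfalso
    have e5 : P.map.face^[s + 3] (A.rg u) = A.fw (A.nx u) := by
      rw [iterate_succ_apply', e4, face_rg_of_left (by rwa [A.rung_rung]), A.rung_rung]
    obtain ⟨t, h2, h3⟩ := exists_first (A := A) (p := A.Left P) (u := A.nx u) ⟨_, rfl, hl⟩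
    have e6 : ∀ j ≤ t, P.map.face^[j + (s + 3)] (A.rg u) = A.fw (A.nx^[j] (A.nx u)) := by
      intro j hj
      rw [iterate_add_apply, e5, iterate_face_fw_eq_fw fun i hi => h2 i (by omega)]
    have e7 : P.map.face^[t + 1 + (s + 3)] (A.rg u) = A.rg (A.nx^[t + 1] (A.nx u)) := by
      rw [iterate_add_apply, e5, iterate_face_fw h2 h3]
    have e8 := hP.iterate_eq (up0 u hu) (up0 _ (by rw [A.lev_iterate, hnu])) e7
    -- A level has at least five vertices, so `t` is at least `3`. Together with the `s + 3` darts
    -- before, the face has more than six darts.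
    have h4 := hg.four_lt (A := A) (n := t + 1) (u := u) (by rw [iterate_succ_apply, ← e8])
    have hp := isPeriodicPt_minimalPeriod P.map.face (A.rg u)
    have hn := hP (A.rg u)
    set n := minimalPeriod P.map.face (A.rg u)
    change P.map.face^[n] (A.rg u) = A.rg u at hp
    rcases lt_trichotomy n (s + 2) with hn' | hn' | hn'
    · obtain ⟨j, hj⟩ := Nat.exists_eq_succ_of_ne_zero (show n ≠ 0 by omega)
      rw [hj, iterate_succ_apply, e1, iterate_face_fw_eq_fw fun i hi => hs' i (by omega)] at hp
      exact A.rg_ne_fw _ _ hp.symm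
    · rw [hn', e4] at hp
      exact hd (by rw [A.rg_injective hp]; exact up0 u hu)
    · obtain ⟨j, hj⟩ := Nat.exists_eq_add_of_le' (show s + 3 ≤ n by omega)
      rw [hj, e6 j (by omega)] at hp
      exact A.rg_ne_fw _ _ hp.symm
  · have e5 : P.map.face^[s + 3] (A.rg u) = A.bw (A.nx u) := by
      rw [iterate_succ_apply', e4, face_rg_of_not_left (by rwa [A.rung_rung]), A.rung_rung]
    obtain ⟨t, h2, h3⟩ := exists_first (A := A.mirror) (p := fun v => ¬ A.Left P v)
      (u := A.nx u) ⟨_, rfl, hl⟩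
    simp only [not_not] at h2
    have e7 : P.map.face^[t + 1 + (s + 3)] (A.rg u) = A.rg ((⇑A.nx⁻¹)^[t + 1] (A.nx u)) := by
      rw [iterate_add_apply, e5]
      exact iterate_face_bw h2 h3
    have l3 : A.lev ((⇑A.nx⁻¹)^[t + 1] (A.nx u)) = 0 :=
      (A.mirror.lev_iterate (t + 1) (A.nx u)).trans hnu
    -- The vertex where the face ascends again is `u`, and it was chosen as a vertex whose rung is
    -- not on the left.
    rw [hP.iterate_eq (up0 u hu) (up0 _ l3) e7]
    exact h3

/-- The circular drawing `Q` is used for one combinatorial fact that does not refer to `P`: between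
the ends of two successive rungs from level `0`, all vertices of level `1` are joined outwards.
Level `1` has rungs of both directions, so it is already known to separate them; up to mirroring, it
does so as in `Q`. -/
theorem ShortFaces.outLeft_or_outRight_zero (hP : A.ShortFaces P) (hg : NoShortCycle G)
    {Q : PlaneEmbedding G} (hQ : A.Oriented Q) : A.OutLeft P 0 ∨ A.OutRight P 0 := by
  have := P.finite
  have up0 : ∀ w, A.lev w = 0 → A.Up w := fun w => up_of_lev_eq_zero
  have h0 : ∀ u, A.lev u = 0 → ∃ s, (∀ j, j < s → A.Up (A.nx^[j + 1] (A.rung u))) ∧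
      A.rung (A.nx u) = A.nx^[s + 1] (A.rung u) := by
    intro u hu
    obtain ⟨s, t, h1, -, h2, -, h3, -⟩ := hQ.exists_gaps hQ.uniqueAscent (up0 u hu)
    refine ⟨s, h1, ?_⟩
    rcases t with _ | t
    · exact h3
    · exact absurd (up0 _ (by rw [A.lev_iterate, hu])) (h2 0 (by omega))
  have h0' : ∀ u, A.lev u = 0 →
      ∃ s, (∀ j, j < s → A.Up ((⇑A.nx⁻¹)^[j + 1] (A.rung u))) ∧
      A.rung (A.nx⁻¹ u) = (⇑A.nx⁻¹)^[s + 1] (A.rung u) := by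
    intro u hu
    obtain ⟨s, h1, h2⟩ := h0 (A.nx⁻¹ u) (by rw [A.lev_inv, hu])
    rw [perm_apply_inv] at h2
    refine ⟨s, fun j hj => ?_, ?_⟩
    · rw [h2, inv_iterate_iterate _ (by omega)]
      have := h1 (s - j - 1) (by omega)
      rwa [show s - j - 1 + 1 = s + 1 - (j + 1) by omega] at this
    · rw [h2, inv_iterate_iterate _ le_rfl, Nat.sub_self, iterate_zero, id]
  by_cases hex : ∃ w, A.lev w = 0
  swap
  · exact .inl fun v hv => absurd ⟨v, hv⟩ hex
  obtain ⟨u, hu⟩ := hex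
  have hru : A.lev (A.rung u) = 1 := by rw [up0 u hu, hu]; rfl
  have hd : ¬ A.Up (A.rung u) := fun h => A.up_rung.1 h (up0 u hu)
  -- Without an outward rung on level `1`, two successive rungs from level `0` would bound a
  -- quadrangle.
  have hup : ∃ w, A.lev w = 1 ∧ A.Up w := by
    by_contra! hno
    obtain ⟨s, h1, h2⟩ := h0 u hu
    rcases s with _ | s
    · change A.rung (A.nx u) = A.nx (A.rung u) at h2
      refine hg.2 u (A.nx u) (A.rung (A.nx u)) (A.rung u) (A.adj_nx _) (A.adj_rung _) ?_
        (A.adj_rung _).symm ?_ (A.rung_ne_nx u).symm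
      · rw [h2]
        exact (A.adj_nx _).symm
      · intro h
        have h3 := congrArg A.lev h
        rw [h2, A.lev_nx, hru, hu] at h3
        omega
    · exact hno _ (by rw [A.lev_iterate, hru]) (h1 0 (by omega))
  obtain ⟨w, hw, hw'⟩ := hup
  have h1 := hP.outLeft_or_outRight (hw.trans hru.symm) hw' hd
  rw [hw] at h1
  rcases h1 with h1 | h1
  · left
    intro v hv
    have := ShortFaces.not_left_of_lev_eq_zero (A := A.mirror) (P := P) hP hg h0'
      (fun v hv => by rw [left_mirror, h1 v hv]; rfl) (u := v) hv
    rw [left_mirror, not_not] at this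
    exact ⟨fun _ => up0 v hv, fun _ => this⟩
  · right
    intro v hv
    have := hP.not_left_of_lev_eq_zero hg h0 h1 hv
    have := up0 v hv
    tauto

/-- On every level, the rungs to the next level are on one side and the rungs to the previous level
are on the other side, in any drawing as a fullerene. -/
theorem ShortFaces.outLeft_or (hP : A.ShortFaces P) (hg : NoShortCycle G)
    {Q : PlaneEmbedding G} (hQ : A.Oriented Q) (i : ℤ) : A.OutLeft P i ∨ A.OutRight P i := by
  have := P.finite
  have hG := P.connected
  by_cases hex : ∃ v, A.lev v = i
  swap
  · exact .inl fun v hv => absurd ⟨v, hv⟩ hex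
  obtain ⟨v, rfl⟩ := hex
  rcases (A.lev_nonneg v).eq_or_lt with h0 | h0
  · rw [← h0]
    exact hP.outLeft_or_outRight_zero hg hQ
  rcases (show A.lev v ≤ A.q - 1 by have := A.lev_lt v; omega).eq_or_lt with h1 | h1
  · have key : ∀ w, A.lev w = A.lev v → A.flip.mirror.lev w = 0 := by
      intro w hw
      show A.q - 1 - A.lev w = 0
      omega
    rcases ShortFaces.outLeft_or_outRight_zero (A := A.flip.mirror) (P := P) hP hg hQ.reverse
      with h2 | h2
    · left
      intro w hw
      have h3 := h2 w (key w hw)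
      rw [left_mirror, mirror_up, flip_up] at h3
      exact not_iff_not.1 h3
    · right
      intro w hw
      have h3 := h2 w (key w hw)
      rw [left_mirror, mirror_up, flip_up] at h3
      exact not_iff_not.1 h3
  · obtain ⟨a, ha, ha'⟩ := exists_up hG h1
    obtain ⟨b, hb, hb'⟩ := exists_not_up hG h0
    rw [ha]
    exact hP.outLeft_or_outRight (ha.symm.trans hb) ha' hb'

open Classical in
/-- The number of levels that one has to cross, in the drawing `P`, to come from the innermost face
to the face on the left of a dart. -/
noncomputable def height (A : LevelFrame G) (P : PlaneEmbedding G) (d : G.Dart) : ℤ :=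
  if d = A.fw d.fst then (if A.OutLeft P (A.lev d.fst) then A.lev d.fst + 1 else A.lev d.fst)
  else if d = A.bw d.fst then
    (if A.OutLeft P (A.lev d.fst) then A.lev d.fst else A.lev d.fst + 1)
  else if A.Up d.fst then A.lev d.fst + 1 else A.lev d.fst

open Classical in
theorem height_fw (v : V) :
    A.height P (A.fw v) = if A.OutLeft P (A.lev v) then A.lev v + 1 else A.lev v :=
  if_pos rfl

open Classical in
theorem height_bw (v : V) :
    A.height P (A.bw v) = if A.OutLeft P (A.lev v) then A.lev v else A.lev v + 1 :=
  (if_neg (A.bw_ne_fw v)).trans (if_pos rfl)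

open Classical in
theorem height_rg (v : V) :
    A.height P (A.rg v) = if A.Up v then A.lev v + 1 else A.lev v :=
  (if_neg (A.rg_ne_fw v v)).trans (if_neg (A.rg_ne_bw v v))

/-- Every level separates its rungs to the next level from its rungs to the previous level. -/
def Separated (A : LevelFrame G) (P : PlaneEmbedding G) : Prop :=
  ∀ i, A.OutLeft P i ∨ A.OutRight P i

theorem Separated.flip (h : A.Separated P) : A.flip.Separated P := by
  intro i
  rcases h (A.q - 1 - i) with h1 | h1
  · right
    intro v hv
    rw [flip_up, not_not]
    refine h1 v ?_
    change A.q - 1 - A.lev v = i at hv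
    omega
  · left
    intro v hv
    rw [flip_up]
    refine h1 v ?_
    change A.q - 1 - A.lev v = i at hv
    omega

theorem Separated.outRight (h : A.Separated P) {v : V} (h1 : ¬ A.OutLeft P (A.lev v)) :
    A.Left P v ↔ ¬ A.Up v := ((h (A.lev v)).resolve_left h1) v rfl

theorem Separated.flip_outLeft (h : A.Separated P) (v : V) :
    A.flip.OutLeft P (A.flip.lev v) ↔ ¬ A.OutLeft P (A.lev v) := by
  constructor
  · intro h1 h2
    have h3 := h1 v rfl
    have h4 := h2 v rfl
    rw [flip_up] at h3
    change A.Left P v ↔ _ at h3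
    tauto
  · intro h1 w hw
    rw [flip_up]
    change A.q - 1 - A.lev w = A.q - 1 - A.lev v at hw
    refine h.outRight (v := w) ?_
    rwa [show A.lev w = A.lev v by omega]

/-- By this symmetry the distance from the outermost face needs no separate proof. -/
theorem Separated.height_flip (h : A.Separated P) (d : G.Dart) :
    A.flip.height P d = A.q - A.height P d := by
  have e : ∀ v, A.flip.lev v = A.q - 1 - A.lev v := fun _ => rfl
  rcases A.dart_cases d with h1 | h1 | h1 <;> rw [h1] <;> generalize d.fst = v
  · rw [height_fw, show A.fw v = A.flip.fw v from rfl, height_fw, e]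
    have := h.flip_outLeft v
    rw [e] at this
    by_cases h2 : A.OutLeft P (A.lev v)
    · rw [if_pos h2, if_neg fun h3 => this.1 h3 h2]; ring
    · rw [if_neg h2, if_pos (this.2 h2)]; ring
  · rw [height_bw, show A.bw v = A.flip.bw v from rfl, height_bw, e]
    have := h.flip_outLeft v
    rw [e] at this
    by_cases h2 : A.OutLeft P (A.lev v)
    · rw [if_pos h2, if_neg fun h3 => this.1 h3 h2]; ring
    · rw [if_neg h2, if_pos (this.2 h2)]; ring
  · rw [height_rg, show A.rg v = A.flip.rg v from rfl, height_rg, e]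
    have := A.flip_up (v := v)
    by_cases h2 : A.Up v
    · rw [if_pos h2, if_neg (by tauto)]; ring
    · rw [if_neg h2, if_pos (by tauto)]; ring

/-- On each side of a level there are only rungs of one direction, so a face that leaves the level
by a rung stays in the same gap between two levels. This is where separation makes the height well
defined on faces. -/
theorem Separated.height_face (h : A.Separated P) (d : G.Dart) :
    A.height P (P.map.face d) = A.height P d := by
  have hl : ∀ v, A.OutLeft P (A.lev v) → (A.Left P v ↔ A.Up v) := fun v hv => hv v rfl
  have hr : ∀ v, ¬ A.OutLeft P (A.lev v) → (A.Left P v ↔ ¬ A.Up v) := fun v => h.outRight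
  rcases A.dart_cases d with h1 | h1 | h1 <;> rw [h1] <;> generalize d.fst = v
  · have hl := hl (A.nx v)
    have hr := hr (A.nx v)
    have e := A.lev_nx v
    rw [e] at hl hr
    by_cases h2 : A.Left P (A.nx v)
    · rw [face_fw_of_left h2, height_rg, height_fw, e]
      split_ifs <;> tauto
    · rw [face_fw_of_not_left h2, height_fw, height_fw, e]
  · have hl := hl (A.nx⁻¹ v)
    have hr := hr (A.nx⁻¹ v)
    have e := A.lev_inv v
    rw [e] at hl hr
    by_cases h2 : A.Left P (A.nx⁻¹ v)
    · rw [face_bw_of_left h2, height_bw, height_bw, e]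
    · rw [face_bw_of_not_left h2, height_rg, height_bw, e]
      split_ifs <;> tauto
  · have hl := hl (A.rung v)
    have hr := hr (A.rung v)
    have e := A.up_rung (v := v)
    have e1 := A.not_up (v := v)
    by_cases h2 : A.Left P (A.rung v)
    · rw [face_rg_of_left h2, height_rg, height_fw]
      split_ifs with h3 h4 h4
      · tauto
      · rw [e1] at h4; omega
      · exact h4
      · tauto
    · rw [face_rg_of_not_left h2, height_rg, height_bw]
      split_ifs with h3 h4 h4
      · exact h4
      · tauto
      · tauto
      · rw [e1] at h4; omega

theorem Separated.height_eq_of_sameCycle [Finite V] (h : A.Separated P) {d e : G.Dart}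
    (hde : P.map.face.SameCycle d e) : A.height P d = A.height P e := by
  have := P.finite_dart
  obtain ⟨n, rfl⟩ := hde.exists_nat_pow_eq
  rw [Equiv.Perm.coe_pow]
  induction n with
  | zero => rfl
  | succ n ih =>
    rw [iterate_succ_apply', h.height_face]
    exact ih ⟨n, by rw [zpow_natCast, Equiv.Perm.coe_pow]⟩

theorem height_symm (d : G.Dart) : A.height P d - A.height P d.symm ≤ 1 := by
  rcases A.dart_cases d with h1 | h1 | h1 <;> rw [h1] <;> generalize d.fst = v
  · rw [A.symm_fw, height_fw, height_bw, A.lev_nx]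
    split_ifs <;> omega
  · rw [A.symm_bw, height_fw, height_bw, A.lev_inv]
    split_ifs <;> omega
  · rw [A.symm_rg, height_rg, height_rg]
    have e := A.up_rung (v := v)
    have e1 := A.not_up (v := v)
    have e2 : A.Up v ↔ A.lev (A.rung v) = A.lev v + 1 := Iff.rfl
    by_cases h2 : A.Up v
    · rw [if_pos h2, if_neg fun h3 => e.1 h3 h2]
      have := e2.1 h2
      omega
    · rw [if_neg h2, if_pos (e.2 h2)]
      have := e1.1 h2
      omega

theorem height_nonneg (d : G.Dart) : 0 ≤ A.height P d := by
  have := A.lev_nonneg d.fst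
  unfold height
  split_ifs <;> omega

/-- Height `0` occurs only on the side of level `0` that has no rungs, and the face there runs
around the whole level. -/
theorem Separated.sameCycle_of_height_eq_zero [Finite V] (h : A.Separated P) {d e : G.Dart}
    (hd : A.height P d = 0) (he : A.height P e = 0) : P.map.face.SameCycle d e := by
  have up0 : ∀ w, A.lev w = 0 → A.Up w := fun w => up_of_lev_eq_zero
  have aux : ∀ d, A.height P d = 0 → A.lev d.fst = 0 ∧
      (A.OutLeft P 0 → d = A.bw d.fst) ∧ (¬ A.OutLeft P 0 → d = A.fw d.fst) := by
    intro d hd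
    have h0 := A.lev_nonneg d.fst
    rcases A.dart_cases d with h1 | h1 | h1
    · rw [h1, height_fw] at hd
      split_ifs at hd with h2
      · omega
      · rw [hd] at h2
        exact ⟨hd, fun h3 => absurd h3 h2, fun _ => h1⟩
    · rw [h1, height_bw] at hd
      split_ifs at hd with h2
      · rw [hd] at h2
        exact ⟨hd, fun h3 => h1, fun h3 => absurd h2 h3⟩
      · omega
    · rw [h1, height_rg] at hd
      split_ifs at hd with h2
      · omega
      · exact absurd (up0 _ hd) h2
  obtain ⟨d0, d1, d2⟩ := aux d hd
  obtain ⟨e0, e1, e2⟩ := aux e he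
  by_cases hO : A.OutLeft P 0
  · rw [d1 hO, e1 hO]
    obtain ⟨n, hn⟩ := exists_iterate (A := A.mirror) (u := d.fst) (v := e.fst)
      (d0.trans e0.symm)
    rw [← hn]
    have h3 := iterate_face_bw_eq_bw (A := A) (P := P) (u := d.fst) (s := n) fun j _ => by
      have h4 : A.lev ((⇑A.nx⁻¹)^[j + 1] d.fst) = 0 := (A.mirror.lev_iterate _ _).trans d0
      exact (hO _ h4).2 (up0 _ h4)
    have := sameCycle_iterate P.map.face n (A.bw d.fst)
    rwa [h3] at this
  · rw [d2 hO, e2 hO]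
    obtain ⟨n, hn⟩ := exists_iterate (A := A) (u := d.fst) (v := e.fst) (d0.trans e0.symm)
    rw [← hn]
    have h3 := iterate_face_fw_eq_fw (A := A) (P := P) (u := d.fst) (s := n) fun j _ => by
      have h4 : A.lev (A.nx^[j + 1] d.fst) = 0 := (A.lev_iterate _ _).trans d0
      exact fun h5 => (((h 0).resolve_left hO) _ h4).1 h5 (up0 _ h4)
    have := sameCycle_iterate P.map.face n (A.fw d.fst)
    rwa [h3] at this

theorem exists_height_eq_zero [Nonempty V] : ∃ d, A.height P d = 0 := by
  obtain ⟨v⟩ := ‹Nonempty V›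
  obtain ⟨w, hw⟩ := A.exists_lev 0 le_rfl ((A.lev_nonneg v).trans_lt (A.lev_lt v))
  by_cases h : A.OutLeft P 0
  · exact ⟨A.bw w, by rw [height_bw, hw, if_pos h]⟩
  · exact ⟨A.fw w, by rw [height_fw, hw, if_neg h]⟩

/-- Every face of positive height has an edge on the level below it: a dart along the upper level is
continued to a descending rung, and after a descending rung the face runs along the lower level.
Crossing that edge lowers the height by one. -/
theorem Separated.exists_lower [Finite V] (h : A.Separated P) (hG : G.Connected) {d : G.Dart}
    (hd : 0 < A.height P d) :
    ∃ e, P.map.face.SameCycle d e ∧ A.height P e.symm = A.height P d - 1 := by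
  have e1 := fun d e => h.height_eq_of_sameCycle (d := d) (e := e)
  -- an edge of a level on the far side
  have far : ∀ v e, (e = A.fw v ∨ e = A.bw v) → A.height P e = A.lev v + 1 →
      A.height P e.symm = A.height P e - 1 := by
    rintro v e (rfl | rfl) he
    · rw [he]
      rw [height_fw] at he
      rw [A.symm_fw, height_bw, A.lev_nx]
      split_ifs at he ⊢ <;> omega
    · rw [he]
      rw [height_bw] at he
      rw [A.symm_bw, height_fw, A.lev_inv]
      split_ifs at he ⊢ <;> omega
  -- a descending rung
  have desc : ∀ v, ¬ A.Up v → ∃ e, P.map.face.SameCycle (A.rg v) e ∧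
      A.height P e.symm = A.height P (A.rg v) - 1 := by
    intro v hv
    have h0 : A.height P (A.rg v) = A.lev (A.rung v) + 1 := by
      rw [height_rg, if_neg hv]
      rw [A.not_up] at hv
      omega
    have h1 : P.map.face.SameCycle (A.rg v) (P.map.face (A.rg v)) := ⟨1, rfl⟩
    refine ⟨_, h1, ?_⟩
    rw [e1 _ _ h1]
    refine far (A.rung v) _ ?_ (by rw [← e1 _ _ h1, h0])
    by_cases h2 : A.Left P (A.rung v)
    · exact .inl (face_rg_of_left h2)
    · exact .inr (face_rg_of_not_left h2)
  have viaDesc : ∀ d v, P.map.face.SameCycle d (A.rg v) → ¬ A.Up v →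
      ∃ e, P.map.face.SameCycle d e ∧ A.height P e.symm = A.height P d - 1 := by
    intro d v h1 h2
    obtain ⟨e, h3, h4⟩ := desc v h2
    exact ⟨e, h1.trans h3, by rw [h4, e1 _ _ h1]⟩
  have fwc : ∀ v, 0 < A.height P (A.fw v) →
      ∃ e, P.map.face.SameCycle (A.fw v) e ∧ A.height P e.symm = A.height P (A.fw v) - 1 := by
    intro v hv
    by_cases hO : A.OutLeft P (A.lev v)
    · exact ⟨_, Equiv.Perm.SameCycle.refl _ _, far v _ (.inl rfl) (by rw [height_fw, if_pos hO])⟩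
    · rw [height_fw, if_neg hO] at hv
      have hR := (h (A.lev v)).resolve_left hO
      obtain ⟨s, h1, h2⟩ := exists_first (exists_not_up hG hv)
      refine viaDesc _ (A.nx^[s + 1] v) ?_ h2
      rw [← iterate_face_fw (P := P)
        (fun j hj h4 => h1 j hj fun h5 => (hR _ (A.lev_iterate _ _)).1 h4 h5)
        ((hR _ (A.lev_iterate _ _)).2 h2)]
      exact sameCycle_iterate _ _ _
  have bwc : ∀ v, 0 < A.height P (A.bw v) →
      ∃ e, P.map.face.SameCycle (A.bw v) e ∧ A.height P e.symm = A.height P (A.bw v) - 1 := by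
    intro v hv
    by_cases hO : A.OutLeft P (A.lev v)
    · rw [height_bw, if_pos hO] at hv
      obtain ⟨s, h1, h2⟩ := exists_first (A := A.mirror) (exists_not_up hG hv)
      simp only [not_not] at h1
      refine viaDesc _ ((⇑A.nx⁻¹)^[s + 1] v) ?_ h2
      rw [← iterate_face_bw (P := P)
        (fun j hj => (hO _ (A.mirror.lev_iterate _ _)).2 (h1 j hj))
        (fun h3 => h2 ((hO _ (A.mirror.lev_iterate _ _)).1 h3))]
      exact sameCycle_iterate _ _ _
    · exact ⟨_, Equiv.Perm.SameCycle.refl _ _, far v _ (.inr rfl) (by rw [height_bw, if_neg hO])⟩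
  rcases A.dart_cases d with h1 | h1 | h1 <;> rw [h1] at hd ⊢ <;> generalize d.fst = v at hd
  · exact fwc v hd
  · exact bwc v hd
  · by_cases hv : A.Up v
    · have h1 : P.map.face.SameCycle (A.rg v) (P.map.face (A.rg v)) := ⟨1, rfl⟩
      have h2 := e1 _ _ h1
      rw [h2] at hd ⊢
      obtain ⟨e, h3, h4⟩ : ∃ e, P.map.face.SameCycle (P.map.face (A.rg v)) e ∧
          A.height P e.symm = A.height P (P.map.face (A.rg v)) - 1 := by
        by_cases h3 : A.Left P (A.rung v)
        · rw [face_rg_of_left h3] at hd ⊢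
          exact fwc _ hd
        · rw [face_rg_of_not_left h3] at hd ⊢
          exact bwc _ hd
      exact ⟨e, h1.trans h3, h4⟩
    · exact desc v hv

end LevelFrame

/-- A function on the faces of a drawing, given on the darts by the value at the face on the left,
that has one zero, and at any other face is larger by one than at some adjacent face. -/
structure IsFaceDistance {V : Type*} {G : SimpleGraph V} (P : PlaneEmbedding G)
    (H : G.Dart → ℤ) : Prop where
  face : ∀ d, H (P.map.face d) = H d
  nonneg : ∀ d, 0 ≤ H d
  symm_le : ∀ d, H d - H d.symm ≤ 1
  lower : ∀ d, 0 < H d → ∃ e, P.map.face.SameCycle d e ∧ H e.symm = H d - 1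
  unique : ∀ d e, H d = 0 → H e = 0 → P.map.face.SameCycle d e
  exists_zero : ∃ d, H d = 0

/-- If a cubic graph without short cycles has a drawing with faces of length five and six and a
drawing by concentric circles, then there are two antipodal faces such that every face is on a
shortest path between them. -/
theorem LevelFrame.exists_isFaceDistance {V : Type*} {G : SimpleGraph V} (A : LevelFrame G)
    {P Q : PlaneEmbedding G} (hP : A.ShortFaces P) (hg : LevelFrame.NoShortCycle G)
    (hQ : A.Oriented Q) :
    ∃ (H : G.Dart → ℤ) (N : ℤ), IsFaceDistance P H ∧ IsFaceDistance P fun d => N - H d := by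
  have := P.finite
  have := P.connected.nonempty
  have hS : A.Separated P := fun i => hP.outLeft_or hg hQ i
  have key : ∀ A : LevelFrame G, A.Separated P → IsFaceDistance P (A.height P) := fun A hS =>
    ⟨hS.height_face, LevelFrame.height_nonneg, LevelFrame.height_symm,
      fun d => hS.exists_lower P.connected, fun d e => hS.sameCycle_of_height_eq_zero,
      LevelFrame.exists_height_eq_zero⟩
  refine ⟨A.height P, A.q, key A hS, ?_⟩
  have := key A.flip hS.flip
  rwa [show A.flip.height P = fun d => A.q - A.height P d from funext hS.height_flip] at this


/-! ### From a circle drawing without interior vertices to a level frame -/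

namespace CircleDrawing

variable {V : Type*} {G : SimpleGraph V} {P : PlaneEmbedding G} {m : List ℕ}

/-- The frame of a drawing by concentric circles. -/
theorem exists_frame (C : CircleDrawing P m) (hC : C.interior = ∅) (h3 : P.IsCubic) :
    ∃ A : LevelFrame G, A.Oriented P ∧ A.q = m.length ∧
      ∀ v (i : Fin m.length), A.lev v = (i : ℕ) →
        ∀ n : ℤ, (A.nx ^ n) v = v ↔ (m.get i : ℤ) ∣ n := by
  classical
  have hsurj : ∀ v, ∃ i a, C.circle i a = v := by
    intro v
    have : v ∉ C.interior := by rw [hC]; exact Set.notMem_empty v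
    by_contra! h
    exact this h
  have hinj : ∀ i j a b, C.circle i a = C.circle j b → (⟨i, a⟩ : (i : Fin m.length) ×
      ZMod (m.get i)) = ⟨j, b⟩ := fun i j a b h => C.injective h
  have hinj1 : ∀ i a b, C.circle i a = C.circle i b → a = b := by
    intro i a b h
    have := hinj i i a b h
    rw [Sigma.mk.injEq] at this
    exact eq_of_heq this.2
  let e : ((i : Fin m.length) × ZMod (m.get i)) ≃ V := Equiv.ofBijective _
    ⟨C.injective, fun v => by obtain ⟨i, a, h⟩ := hsurj v; exact ⟨⟨i, a⟩, h⟩⟩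
  have he : ∀ i a, e ⟨i, a⟩ = C.circle i a := fun _ _ => rfl
  have he' : ∀ i a, e.symm (C.circle i a) = ⟨i, a⟩ := fun i a => by
    rw [← he, Equiv.symm_apply_apply]
  let nx : Equiv.Perm V :=
    e.symm.trans ((Equiv.sigmaCongrRight fun i => Equiv.addRight (1 : ZMod (m.get i))).trans e)
  have hnx : ∀ i a, nx (C.circle i a) = C.circle i (a + 1) := by
    intro i a
    simp only [nx, Equiv.trans_apply, he', Equiv.sigmaCongrRight_apply, he,
      Equiv.coe_addRight]
  have hnx' : ∀ i a, nx⁻¹ (C.circle i a) = C.circle i (a - 1) := by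
    intro i a
    rw [Equiv.Perm.inv_eq_iff_eq, hnx, sub_add_cancel]
  have hz : ∀ i a (n : ℤ), (nx ^ n) (C.circle i a) = C.circle i (a + n) := by
    intro i a n
    induction n with
    | zero => simp
    | succ n ih =>
      rw [add_comm, zpow_add, Equiv.Perm.mul_apply, zpow_one, ih, hnx]
      push_cast
      congr 1
      ring
    | pred n ih =>
      rw [sub_eq_add_neg, add_comm, zpow_add, Equiv.Perm.mul_apply, zpow_neg_one, ih, hnx']
      push_cast
      congr 1
      ring
  let lev : V → ℤ := fun v => ((e.symm v).1 : ℕ)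
  have hlev : ∀ i a, lev (C.circle i a) = (i : ℕ) := fun i a => by simp only [lev, he']
  have hadj : ∀ v, G.Adj v (nx v) := by
    intro v
    obtain ⟨i, a, rfl⟩ := hsurj v
    rw [hnx]
    exact C.adj_succ i a
  have hadj' : ∀ v, G.Adj v (nx⁻¹ v) := by
    intro v
    have := (hadj (nx⁻¹ v)).symm
    rwa [perm_apply_inv] at this
  have hne : ∀ v, nx (nx v) ≠ v := by
    intro v h
    obtain ⟨i, a, rfl⟩ := hsurj v
    rw [hnx, hnx] at h
    have h1 := hinj1 i _ _ h
    have h2 : ((2 : ℕ) : ZMod (m.get i)) = 0 := by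
      push_cast
      linear_combination h1
    rw [ZMod.natCast_eq_zero_iff] at h2
    have := Nat.le_of_dvd (by norm_num) h2
    have := C.three_le i
    omega
  have hne' : ∀ v, nx v ≠ nx⁻¹ v := by
    intro v h
    apply hne (nx⁻¹ v)
    rw [perm_apply_inv, h]
  -- Two of the three neighbours are on the circle; the remaining one serves as the rung.
  have hthird : ∀ v, ∃ w, G.Adj v w ∧ w ≠ nx v ∧ w ≠ nx⁻¹ v ∧
      ∀ x, G.Adj v x → x = nx v ∨ x = nx⁻¹ v ∨ x = w := by
    intro v
    obtain ⟨x, y, z, hxy, hxz, hyz, h⟩ := Set.ncard_eq_three.1 (h3 v)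
    have hm : ∀ w, G.Adj v w ↔ w = x ∨ w = y ∨ w = z := by
      intro w
      rw [← SimpleGraph.mem_neighborSet, h]
      simp
    have h1 := (hm _).1 (hadj v)
    have h2 := (hm _).1 (hadj' v)
    have h3 := hne' v
    have hx := (hm x).2 (.inl rfl)
    have hy := (hm y).2 (.inr (.inl rfl))
    have hz := (hm z).2 (.inr (.inr rfl))
    generalize nx v = p at *
    generalize nx⁻¹ v = r at *
    rcases h1 with rfl | rfl | rfl <;> rcases h2 with rfl | rfl | rfl
    · exact absurd rfl h3
    · exact ⟨z, hz, hxz.symm, hyz.symm, fun w hw => by have := (hm w).1 hw; tauto⟩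
    · exact ⟨y, hy, hxy.symm, hyz, fun w hw => by have := (hm w).1 hw; tauto⟩
    · exact ⟨z, hz, hyz.symm, hxz.symm, fun w hw => by have := (hm w).1 hw; tauto⟩
    · exact absurd rfl h3
    · exact ⟨x, hx, hxy, hxz, fun w hw => by have := (hm w).1 hw; tauto⟩
    · exact ⟨y, hy, hyz, hxy.symm, fun w hw => by have := (hm w).1 hw; tauto⟩
    · exact ⟨x, hx, hxz, hxy, fun w hw => by have := (hm w).1 hw; tauto⟩
    · exact absurd rfl h3
  choose rung hr1 hr2 hr3 hr4 using hthird
  let A : LevelFrame G :=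
    { nx := nx
      rung := rung
      lev := lev
      q := m.length
      adj_nx := hadj
      adj_rung := hr1
      nx_nx_ne := hne
      adj_cases := hr4
      lev_nx := by
        intro v
        obtain ⟨i, a, rfl⟩ := hsurj v
        rw [hnx, hlev, hlev]
      lev_rung := by
        intro v
        obtain ⟨i, a, rfl⟩ := hsurj v
        obtain ⟨j, b, h2⟩ := hsurj (rung (C.circle i a))
        have h3 := hr1 (C.circle i a)
        rw [← h2] at h3
        have h4 := C.consecutive i j a b h3
        have h5 : i ≠ j := by
          rintro rfl
          rcases C.induced i a b h3 with h6 | h6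
          · exact hr2 (C.circle i a) (by rw [← h2, h6, hnx])
          · exact hr3 (C.circle i a) (by rw [← h2, h6, hnx', add_sub_cancel_right])
        rw [← h2, hlev, hlev]
        have : (i : ℕ) ≠ j := fun h => h5 (Fin.ext h)
        omega
      sameCycle := by
        intro u v h
        obtain ⟨i, a, rfl⟩ := hsurj u
        obtain ⟨j, b, rfl⟩ := hsurj v
        rw [hlev, hlev] at h
        obtain rfl : i = j := Fin.ext (by exact_mod_cast h)
        obtain ⟨n, hn⟩ := ZMod.intCast_surjective (b - a)
        exact ⟨n, by rw [hz, hn, add_sub_cancel]⟩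
      lev_nonneg := fun v => Int.natCast_nonneg _
      lev_lt := fun v => Int.ofNat_lt.2 (e.symm v).1.2
      exists_lev := by
        intro i h0 h1
        refine ⟨C.circle ⟨i.toNat, by omega⟩ 0, ?_⟩
        rw [hlev]
        simp [h0] }
  refine ⟨A, ?_, rfl, ?_⟩
  · intro v
    obtain ⟨i, a, h1⟩ := hsurj v
    obtain ⟨j, b, h2⟩ := hsurj (A.rung v)
    have l1 : A.lev v = (i : ℕ) := by rw [← h1]; exact hlev i a
    have l2 : A.lev (A.rung v) = (j : ℕ) := by rw [← h2]; exact hlev j b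
    have f1 : (A.fw v).snd = C.circle i (a + 1) := by rw [← hnx, h1]; rfl
    have b1 : (A.bw v).snd = C.circle i (a - 1) := by rw [← hnx', h1]; rfl
    have hcub := A.isCubic P
    have r0 : A.Left P v ∨ ¬ A.Left P v := em _
    constructor
    · intro hl hup
      -- With the rung on the left, one rotation leads from the backward dart directly to the
      -- forward dart, so an outward edge cannot be met in between.
      obtain ⟨n, hn, hn'⟩ := C.outward i a (A.rg v) (A.bw v) (A.fw v) h1.symm h1.symm f1 h1.symm b1
        ⟨j, b, by unfold LevelFrame.Up at hup; omega, h2.symm⟩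
      rcases n with _ | n
      · exact A.rg_ne_bw v v hn.symm
      · exact hn' 1 (by omega) hl.rot_bw
    · intro hup
      by_contra hl
      rw [A.not_up] at hup
      obtain ⟨n, hn, hn'⟩ := C.inward i a (A.rg v) (A.bw v) (A.fw v) h1.symm h1.symm f1 h1.symm b1
        ⟨j, b, by omega, h2.symm⟩
      rcases n with _ | n
      · exact A.rg_ne_fw v v hn.symm
      · exact hn' 1 (by omega) (LevelFrame.rot_fw hl)
  · intro v i hv n
    obtain ⟨j, a, rfl⟩ := hsurj v
    obtain rfl : i = j := Fin.ext (by
      have h := (hlev j a).symm.trans hv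
      exact_mod_cast h.symm)
    change (nx ^ n) _ = _ ↔ _
    rw [hz, ← ZMod.intCast_zmod_eq_zero_iff_dvd n (m.get i)]
    constructor
    · intro h
      have := hinj1 i _ _ h
      linear_combination this
    · intro h
      rw [h, add_zero]

end CircleDrawing


/-- Injectivity is enough here. This matters for `fromCenter`, which embeds the faces of a map as
only some of the rotation cycles of the stellation. -/
theorem sameCycle_semiconj {α β : Type*} [Finite α] {f : Equiv.Perm α} {g : Equiv.Perm β}
    (e : α → β) (he : Injective e) (h : Semiconj e f g) {x y : α} :
    g.SameCycle (e x) (e y) ↔ f.SameCycle x y := by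
  have hn : ∀ n : ℕ, e ((f ^ n) x) = (g ^ n) (e x) := by
    intro n
    rw [Equiv.Perm.coe_pow, Equiv.Perm.coe_pow]
    exact h.iterate_right n x
  constructor
  · rintro ⟨n, hgn⟩
    rcases n with n | n
    · refine ⟨n, he ?_⟩
      rw [zpow_natCast, hn, ← hgn]
      rfl
    · have h1 : ∀ (n : ℕ) z, e z = (g ^ n)⁻¹ (e x) → z = (f ^ n)⁻¹ x := by
        intro n z hz
        rw [Equiv.Perm.eq_inv_iff_eq]
        apply he
        rw [Equiv.Perm.eq_inv_iff_eq] at hz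
        rw [← hz, Equiv.Perm.coe_pow, Equiv.Perm.coe_pow]
        exact h.iterate_right n z
      refine ⟨Int.negSucc n, ?_⟩
      rw [zpow_negSucc] at hgn ⊢
      exact (h1 _ _ hgn.symm).symm
  · intro hxy
    obtain ⟨n, rfl⟩ := hxy.exists_nat_pow_eq
    exact ⟨n, by rw [zpow_natCast, hn]⟩

theorem minimalPeriod_semiconj {α β : Type*} {f : α → α} {g : β → β}
    (e : α → β) (he : Injective e) (h : Semiconj e f g) (x : α) :
    minimalPeriod g (e x) = minimalPeriod f x := by
  rw [minimalPeriod_eq_minimalPeriod_iff]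
  intro n
  unfold IsPeriodicPt IsFixedPt
  rw [← h.iterate_right n x]
  exact he.eq_iff

/-! ### Simple combinatorial maps as drawings of their graphs -/

namespace CombMap

variable {D : Type*} (M : CombMap D)

/-- The underlying graph determines the darts: there are no loops and no multiple edges. -/
structure IsSimple : Prop where
  tail_ne : ∀ d, M.tail d ≠ M.tail (M.rev d)
  eq_of_tail : ∀ d e, M.tail d = M.tail e → M.tail (M.rev d) = M.tail (M.rev e) → d = e

variable {M}

/-- the darts of a simple map are the darts of its graph -/
noncomputable def IsSimple.dartEquiv (h : M.IsSimple) : D ≃ M.graph.Dart :=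
  Equiv.ofBijective (fun d => ⟨(M.tail d, M.tail (M.rev d)), h.tail_ne d, d, rfl, rfl⟩) <| by
    constructor
    · intro d e hde
      have h1 := congrArg (fun x : M.graph.Dart => x.fst) hde
      have h2 := congrArg (fun x : M.graph.Dart => x.snd) hde
      exact h.eq_of_tail d e h1 h2
    · rintro ⟨⟨u, v⟩, hne, d, h1, h2⟩
      exact ⟨d, SimpleGraph.Dart.ext _ _ (Prod.ext h1 h2)⟩

theorem IsSimple.fst_dartEquiv (h : M.IsSimple) (d : D) : (h.dartEquiv d).fst = M.tail d := rfl

theorem IsSimple.snd_dartEquiv (h : M.IsSimple) (d : D) :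
    (h.dartEquiv d).snd = M.tail (M.rev d) := rfl

theorem IsSimple.symm_dartEquiv (h : M.IsSimple) (d : D) :
    (h.dartEquiv d).symm = h.dartEquiv (M.rev d) :=
  SimpleGraph.Dart.ext _ _ (Prod.ext rfl (congrArg M.tail (M.rev_rev d).symm))

/-- the map of a simple map on the darts of its graph -/
noncomputable def IsSimple.transport (h : M.IsSimple) : CombMap M.graph.Dart where
  rot := h.dartEquiv.permCongr M.rot
  rev := h.dartEquiv.permCongr M.rev
  rev_rev d := by simp [Equiv.permCongr_apply, M.rev_rev]
  rev_ne d := by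
    rw [Equiv.permCongr_apply, Ne, ← Equiv.eq_symm_apply]
    exact M.rev_ne _

theorem IsSimple.semiconj_rot (h : M.IsSimple) : Semiconj h.dartEquiv M.rot h.transport.rot :=
  fun d => by simp [transport, Equiv.permCongr_apply]

theorem IsSimple.semiconj_rev (h : M.IsSimple) : Semiconj h.dartEquiv M.rev h.transport.rev :=
  fun d => by simp [transport, Equiv.permCongr_apply]

theorem IsSimple.semiconj_face (h : M.IsSimple) : Semiconj h.dartEquiv M.face h.transport.face := by
  intro d
  rw [face, face, Equiv.trans_apply, Equiv.trans_apply, Equiv.eq_symm_apply, ← h.semiconj_rev d,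
    ← h.semiconj_rot, Equiv.apply_symm_apply]

/-- A simple map on the sphere as a drawing of its graph. -/
noncomputable def IsSimple.planeEmbedding [Finite D] (h : M.IsSimple) (hc : M.graph.Connected)
    (he : 2 * (Nat.card M.Vertex + Nat.card M.Face) = Nat.card D + 4) :
    PlaneEmbedding M.graph where
  map := h.transport
  rev_eq d := by
    obtain ⟨d, rfl⟩ := h.dartEquiv.surjective d
    rw [← h.semiconj_rev d, h.symm_dartEquiv]
  sameCycle_rot_iff d e := by
    obtain ⟨d, rfl⟩ := h.dartEquiv.surjective d
    obtain ⟨e, rfl⟩ := h.dartEquiv.surjective e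
    rw [sameCycle_semiconj _ h.dartEquiv.injective h.semiconj_rot]
    exact ⟨fun h => Quotient.sound h, fun h => Quotient.exact h⟩
  finite := inferInstance
  connected := hc
  euler := by
    classical
    have : Nat.card h.transport.Face = Nat.card M.Face := by
      refine (Nat.card_congr (Quotient.congr h.dartEquiv fun a b => ?_)).symm
      exact (sameCycle_semiconj _ h.dartEquiv.injective h.semiconj_face).symm
    rw [this]
    have := Fintype.ofFinite M.Vertex
    have h1 := M.graph.dart_card_eq_twice_card_edges
    rw [← Nat.card_eq_fintype_card, ← Nat.card_congr h.dartEquiv] at h1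
    rw [Nat.card_eq_fintype_card (α := M.graph.edgeSet), ← SimpleGraph.edgeFinset_card]
    omega

end CombMap

/-! ### Vertices, edges and faces of the leapfrog of a map -/

namespace CombMap

variable {D : Type*} (M : CombMap D)

open StellationDart

/-- the triangle of the stellation, to the left of the dart `d`, as a vertex of the leapfrog -/
def triangle (d : D) : M.leapfrog.Vertex := M.leapfrog.tail (side d)

theorem leapfrog_rot_side (d : D) : M.leapfrog.rot (side d) = toCenter d := (M.stellation_face d).1

theorem leapfrog_rot_toCenter (d : D) : M.leapfrog.rot (toCenter d) = fromCenter d :=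
  (M.stellation_face d).2.1

theorem leapfrog_rot_fromCenter (d : D) : M.leapfrog.rot (fromCenter d) = side d :=
  (M.stellation_face d).2.2

theorem tail_rot (d : D) : M.tail (M.rot d) = M.tail d :=
  Quotient.sound (Equiv.Perm.SameCycle.symm ⟨1, rfl⟩)

theorem tail_side (d : D) : M.leapfrog.tail (side d) = M.triangle d := rfl

theorem tail_toCenter (d : D) : M.leapfrog.tail (toCenter d) = M.triangle d := by
  rw [← leapfrog_rot_side, tail_rot, tail_side]

theorem tail_fromCenter (d : D) : M.leapfrog.tail (fromCenter d) = M.triangle d := by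
  rw [← leapfrog_rot_toCenter, tail_rot, tail_toCenter]

theorem leapfrog_rev_side (d : D) : M.leapfrog.rev (side d) = side (M.rev d) := rfl

theorem leapfrog_rev_toCenter (d : D) : M.leapfrog.rev (toCenter d) = fromCenter (M.face d) := rfl

theorem leapfrog_rev_fromCenter (d : D) :
    M.leapfrog.rev (fromCenter d) = toCenter (M.face.symm d) := rfl

/-- the triangle on whose boundary a dart of the stellation is -/
def StellationDart.base : StellationDart D → D
  | side d => d
  | toCenter d => d
  | fromCenter d => d

theorem base_rot (x : StellationDart D) : (M.leapfrog.rot x).base = x.base := by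
  rcases x with d | d | d
  · rw [leapfrog_rot_side]; rfl
  · rw [leapfrog_rot_toCenter]; rfl
  · rw [leapfrog_rot_fromCenter]; rfl

instance [Finite D] : Finite (StellationDart D) :=
  Finite.of_injective (β := D ⊕ D ⊕ D)
    (fun x => match x with
      | side d => .inl d
      | toCenter d => .inr (.inl d)
      | fromCenter d => .inr (.inr d))
    (by rintro (a | a | a) (b | b | b) h <;> simp_all)

theorem card_stellationDart [Finite D] : Nat.card (StellationDart D) = 3 * Nat.card D := by
  let e : StellationDart D ≃ D ⊕ D ⊕ D :=
    { toFun := fun x => match x with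
        | side d => .inl d
        | toCenter d => .inr (.inl d)
        | fromCenter d => .inr (.inr d)
      invFun := Sum.elim side (Sum.elim toCenter fromCenter)
      left_inv := by rintro (a | a | a) <;> rfl
      right_inv := by rintro (a | a | a) <;> rfl }
  rw [Nat.card_congr e, Nat.card_sum, Nat.card_sum]
  ring

theorem apply_eq_of_sameCycle {α β : Type*} [Finite α] {f : Equiv.Perm α} {g : α → β}
    (h : ∀ x, g (f x) = g x) {x y : α} (hxy : f.SameCycle x y) : g x = g y := by
  obtain ⟨n, rfl⟩ := hxy.exists_nat_pow_eq
  induction n with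
  | zero => rfl
  | succ n ih =>
    rw [pow_succ', Equiv.Perm.mul_apply, h]
    exact ih ⟨n, by rw [zpow_natCast]⟩

theorem triangle_injective [Finite D] : Injective M.triangle := by
  intro d e h
  exact apply_eq_of_sameCycle (f := M.leapfrog.rot) (g := StellationDart.base) M.base_rot
    (Quotient.exact h)

theorem triangle_surjective : Surjective M.triangle := by
  intro x
  induction x using Quotient.inductionOn with | _ x =>
  rcases x with d | d | d
  · exact ⟨d, rfl⟩
  · exact ⟨d, (M.tail_toCenter d).symm⟩
  · exact ⟨d, (M.tail_fromCenter d).symm⟩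

theorem leapfrog_adj [Finite D] {d e : D} :
    M.leapfrog.graph.Adj (M.triangle d) (M.triangle e) ↔
      d ≠ e ∧ (e = M.rev d ∨ e = M.face d ∨ d = M.face e) := by
  have hi := M.triangle_injective
  constructor
  · rintro ⟨hne, x, h1, h2⟩
    refine ⟨fun h => hne (by rw [h]), ?_⟩
    rcases x with x | x | x
    · rw [tail_side] at h1
      rw [leapfrog_rev_side, tail_side] at h2
      rw [← hi h1, ← hi h2]
      exact .inl rfl
    · rw [tail_toCenter] at h1
      rw [leapfrog_rev_toCenter, tail_fromCenter] at h2
      rw [← hi h1, ← hi h2]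
      exact .inr (.inl rfl)
    · rw [tail_fromCenter] at h1
      rw [leapfrog_rev_fromCenter, tail_toCenter] at h2
      rw [← hi h1, ← hi h2]
      exact .inr (.inr (Equiv.apply_symm_apply _ _).symm)
  · rintro ⟨hne, h⟩
    refine ⟨fun h => hne (hi h), ?_⟩
    rcases h with rfl | rfl | rfl
    · exact ⟨side d, rfl, rfl⟩
    · exact ⟨toCenter d, M.tail_toCenter d, M.tail_fromCenter _⟩
    · exact ⟨fromCenter (M.face e), M.tail_fromCenter _, by
        rw [leapfrog_rev_fromCenter, tail_toCenter, Equiv.symm_apply_apply]⟩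

theorem leapfrog_face (x : StellationDart D) :
    M.leapfrog.face x = M.stellation.rev (M.stellation.rot (M.stellation.rev x)) := by
  change M.stellation.face.symm (M.stellation.rev x) = _
  rw [Equiv.symm_apply_eq, face, Equiv.trans_apply, M.stellation.rev_rev, Equiv.symm_apply_apply]

/-- Dualizing twice returns the stellation only up to reversal of the darts, hence the conjugation
by `rev`. It identifies the faces of the leapfrog with the vertices of the stellation. -/
theorem semiconj_stellation_rev : Semiconj M.stellation.rev M.stellation.rot M.leapfrog.face := by
  intro x
  rw [leapfrog_face, M.stellation.rev_rev]

theorem stellation_rot_side (d : D) :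
    M.stellation.rot (side d) = toCenter (M.face.symm d) := rfl

theorem stellation_rot_toCenter (d : D) : M.stellation.rot (toCenter d) = side (M.rev d) := rfl

theorem stellation_rot_fromCenter (d : D) :
    M.stellation.rot (fromCenter d) = fromCenter (M.face d) := rfl

theorem stellation_rot_rot_side (d : D) :
    M.stellation.rot (M.stellation.rot (side d)) = side (M.rot d) := by
  rw [stellation_rot_side, stellation_rot_toCenter]
  congr 1
  have : M.face.symm d = M.rev (M.rot d) := by
    rw [Equiv.symm_apply_eq, face, Equiv.trans_apply, M.rev_rev, Equiv.symm_apply_apply]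
  rw [this, M.rev_rev]

/-- The faces of the leapfrog are the vertices and the faces of the map. -/
theorem card_leapfrog_face [Finite D] {V : Type*} [Finite V] (t : D → V) (ht : Surjective t)
    (h : ∀ d e, M.rot.SameCycle d e ↔ t d = t e) :
    Nat.card M.leapfrog.Face = Nat.card V + Nat.card M.Face := by
  -- The tail of a dart of the stellation: an old vertex, or the new vertex of a face. What has to
  -- be shown is that its fibres are the rotation cycles.
  let c : StellationDart D → V ⊕ M.Face
    | side d => .inl (t d)
    | toCenter d => .inl (t (M.rev d))
    | fromCenter d => .inr (Quotient.mk _ d)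
  have hc : ∀ x, c (M.stellation.rot x) = c x := by
    rintro (d | d | d)
    · have := M.stellation_rot_rot_side d
      rw [stellation_rot_side, stellation_rot_toCenter, StellationDart.side.injEq] at this
      exact congrArg Sum.inl (by rw [this]; exact ((h d _).1 ⟨1, rfl⟩).symm)
    · rfl
    · exact congrArg Sum.inr (Quotient.sound (Equiv.Perm.SameCycle.symm ⟨1, rfl⟩))
  have hside : ∀ d e, t d = t e → M.stellation.rot.SameCycle (side d) (side e) := by
    intro d e hde
    obtain ⟨n, rfl⟩ := ((h d e).2 hde).exists_nat_pow_eq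
    clear hde
    refine ⟨((2 * n : ℕ) : ℤ), ?_⟩
    rw [zpow_natCast]
    induction n with
    | zero => rfl
    | succ n ih =>
      rw [show 2 * (n + 1) = 1 + 1 + 2 * n by ring, pow_add, Equiv.Perm.mul_apply, ih, pow_succ,
        pow_one, Equiv.Perm.mul_apply, stellation_rot_rot_side, pow_succ', Equiv.Perm.mul_apply]
  have hto : ∀ d, M.stellation.rot.SameCycle (toCenter d) (side (M.rev d)) := fun d => ⟨1, rfl⟩
  have hcc : ∀ x y, c x = c y → M.stellation.rot.SameCycle x y := by
    rintro (d | d | d) (e | e | e) hxy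
    · exact hside d e (Sum.inl.inj hxy)
    · exact (hside _ _ (Sum.inl.inj hxy)).trans (hto e).symm
    · cases hxy
    · exact (hto d).trans (hside _ _ (Sum.inl.inj hxy))
    · exact ((hto d).trans (hside _ _ (Sum.inl.inj hxy))).trans (hto e).symm
    · cases hxy
    · cases hxy
    · cases hxy
    · exact (sameCycle_semiconj fromCenter (fun a b h => by injection h) (fun d => rfl)).2
        (Quotient.exact (Sum.inr.inj hxy))
  rw [← Nat.card_sum]
  have e1 : Nat.card (Quotient (Equiv.Perm.SameCycle.setoid M.stellation.rot)) =
      Nat.card M.leapfrog.Face := by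
    refine Nat.card_congr (Quotient.congr M.stellation.rev fun a b => ?_)
    exact (sameCycle_semiconj _ M.stellation.rev.injective M.semiconj_stellation_rev).symm
  rw [← e1]
  refine Nat.card_eq_of_bijective
    (Quotient.lift c fun a b hab => apply_eq_of_sameCycle hc hab) ⟨?_, ?_⟩
  · intro x y
    induction x using Quotient.inductionOn with | _ x =>
    induction y using Quotient.inductionOn with | _ y =>
    exact fun hxy => Quotient.sound (hcc x y hxy)
  · rintro (v | f)
    · obtain ⟨d, rfl⟩ := ht v
      exact ⟨Quotient.mk _ (side d), rfl⟩
    · induction f using Quotient.inductionOn with | _ d =>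
      exact ⟨Quotient.mk _ (fromCenter d), rfl⟩

end CombMap


/-! ### The leapfrog of a fullerene is a fullerene without short cycles -/

namespace PlaneEmbedding

variable {V : Type*} {F : SimpleGraph V} {P : PlaneEmbedding F}

open CombMap CombMap.StellationDart

theorem rot_symm_ne (h : P.IsCubic) (d : F.Dart) : P.map.rot.symm d ≠ d := by
  rw [Ne, Equiv.symm_apply_eq]
  exact (h.rot_ne d).symm

theorem face_rev (d : F.Dart) : P.map.face (P.map.rev d) = P.map.rot.symm d := by
  rw [CombMap.face, Equiv.trans_apply, P.map.rev_rev]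

theorem face_eq (d : F.Dart) : P.map.face d = P.map.rot.symm (P.map.rev d) := rfl

theorem fst_rev (d : F.Dart) : (P.map.rev d).fst = d.snd := by rw [P.rev_eq]; rfl

theorem snd_rev (d : F.Dart) : (P.map.rev d).snd = d.fst := by rw [P.rev_eq]; rfl

theorem eq_rev {d e : F.Dart} (h1 : e.fst = d.snd) (h2 : e.snd = d.fst) : e = P.map.rev d := by
  rw [P.rev_eq]
  exact SimpleGraph.Dart.ext _ _ (Prod.ext h1 h2)

theorem face_ne_rev (h : P.IsCubic) (d : F.Dart) : P.map.face d ≠ P.map.rev d :=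
  rot_symm_ne h _

theorem face_ne (d : F.Dart) : P.map.face d ≠ d := by
  intro h
  have := fst_face (P := P) d
  rw [h] at this
  exact d.adj.ne this

theorem IsFullerene.iterate_face_ne (hP : P.IsFullerene) {n : ℕ} (hn : n < 4) (d : F.Dart) :
    P.map.face^[n + 1] d ≠ d := by
  intro h
  have := IsPeriodicPt.minimalPeriod_le (Nat.succ_pos n) h
  have := hP.2 d
  omega

theorem IsFullerene.exists_fst (hP : P.IsFullerene) (v : V) : ∃ d : F.Dart, d.fst = v := by
  have h := hP.1 v
  obtain ⟨w, hw⟩ := (Set.ncard_pos (Set.finite_of_ncard_pos (by omega))).1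
    (show 0 < (F.neighborSet v).ncard by omega)
  exact ⟨⟨(v, w), hw⟩, rfl⟩

/-- The triangles of `d`, `rev d`, `face d` and `face.symm d` are distinct, because rotations have
order three and no face has length at most two. -/
theorem IsFullerene.isSimple (hP : P.IsFullerene) : P.map.leapfrog.IsSimple := by
  have := P.finite_dart
  have hi := P.map.triangle_injective
  have hne : ∀ d, P.map.face.symm d ≠ d := fun d h => face_ne (P := P) d (by
    rw [Equiv.symm_apply_eq] at h
    exact h.symm)
  have h1 := face_ne_rev (P := P) hP.1
  have h2 : ∀ d, P.map.face.symm d ≠ P.map.rev d := fun d h => by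
    rw [Equiv.symm_apply_eq, face_rev] at h
    exact rot_symm_ne hP.1 d h.symm
  have h3 : ∀ d, P.map.face.symm d ≠ P.map.face d := fun d h => by
    rw [Equiv.symm_apply_eq] at h
    exact hP.iterate_face_ne (n := 1) (by norm_num) d h.symm
  constructor
  · rintro (d | d | d)
    · rw [leapfrog_rev_side, tail_side, tail_side]
      exact fun h => P.map.rev_ne d (hi h).symm
    · rw [leapfrog_rev_toCenter, tail_toCenter, tail_fromCenter]
      exact fun h => face_ne d (hi h).symm
    · rw [leapfrog_rev_fromCenter, tail_toCenter, tail_fromCenter]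
      exact fun h => hne d (hi h).symm
  · rintro (d | d | d) (e | e | e) h h' <;>
      simp only [leapfrog_rev_side, leapfrog_rev_toCenter, leapfrog_rev_fromCenter, tail_side,
        tail_toCenter, tail_fromCenter] at h h' <;>
      have h := hi h <;> subst h <;> have h' := hi h'
    · rfl
    · exact absurd h'.symm (h1 d)
    · exact absurd h'.symm (h2 d)
    · exact absurd h' (h1 d)
    · rfl
    · exact absurd h'.symm (h3 d)
    · exact absurd h' (h2 d)
    · exact absurd h' (h3 d)
    · rfl

/-- The triangles of darts with the same tail are joined by going around the tail, and `rev` crosses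
an edge; so a walk in `F` can be followed in the leapfrog. -/
theorem IsFullerene.connected_leapfrog (hP : P.IsFullerene) : P.map.leapfrog.graph.Connected := by
  have := P.finite_dart
  have := P.connected.nonempty
  have hrev : ∀ d, P.map.leapfrog.graph.Reachable (P.map.triangle d)
      (P.map.triangle (P.map.rev d)) := fun d =>
    (SimpleGraph.Adj.reachable (P.map.leapfrog_adj.2 ⟨(P.map.rev_ne d).symm, .inl rfl⟩))
  have hrot : ∀ d, P.map.leapfrog.graph.Reachable (P.map.triangle d)
      (P.map.triangle (P.map.rot d)) := by
    intro d
    refine SimpleGraph.Reachable.symm ?_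
    have h1 : P.map.face (P.map.rev (P.map.rot d)) = d := by
      rw [face_rev, Equiv.symm_apply_apply]
    have h2 := P.map.leapfrog_adj.2 ⟨(face_ne (P.map.rev (P.map.rot d))).symm, .inr (.inl rfl)⟩
    rw [h1] at h2
    exact (hrev _).trans h2.reachable
  have hfst : ∀ d e : F.Dart, e.fst = d.fst → P.map.leapfrog.graph.Reachable (P.map.triangle d)
      (P.map.triangle e) := by
    intro d e he
    rcases IsCubic.eq_or (P := P) hP.1 he with rfl | rfl | rfl
    · rfl
    · exact hrot d
    · exact (hrot d).trans (hrot _)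
  have hwalk : ∀ u v (p : F.Walk u v) (d e : F.Dart), d.fst = u → e.fst = v →
      P.map.leapfrog.graph.Reachable (P.map.triangle d) (P.map.triangle e) := by
    intro u v p
    induction p with
    | nil => exact fun d e hd he => hfst d e (he.trans hd.symm)
    | @cons u w v huw p ih =>
      intro d e hd he
      let x : F.Dart := ⟨(u, w), huw⟩
      exact ((hfst d x hd.symm).trans (hrev x)).trans (ih _ _ (fst_rev x) he)
  obtain ⟨v⟩ := ‹Nonempty V›
  obtain ⟨d, -⟩ := hP.exists_fst v
  have : Nonempty P.map.leapfrog.Vertex := ⟨P.map.triangle d⟩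
  refine ⟨fun x y => ?_⟩
  obtain ⟨d, rfl⟩ := P.map.triangle_surjective x
  obtain ⟨e, rfl⟩ := P.map.triangle_surjective y
  obtain ⟨p⟩ := P.connected.preconnected d.fst e.fst
  exact hwalk _ _ p d e rfl rfl

theorem card_dart (P : PlaneEmbedding F) : Nat.card F.Dart = 2 * Nat.card F.edgeSet := by
  classical
  have := P.finite
  have := Fintype.ofFinite V
  have h1 := F.dart_card_eq_twice_card_edges
  rw [Nat.card_eq_fintype_card, Nat.card_eq_fintype_card, ← SimpleGraph.edgeFinset_card, h1]

/-- If `F` has `n` vertices and `f` faces, the leapfrog has `3n` vertices, `n + f` faces and `9n`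
darts, and `n + f = 3n/2 + 2`. -/
theorem IsFullerene.euler_leapfrog (hP : P.IsFullerene) :
    2 * (Nat.card P.map.leapfrog.Vertex + Nat.card P.map.leapfrog.Face) =
      Nat.card (StellationDart F.Dart) + 4 := by
  have := P.finite_dart
  have := P.finite
  have h1 : Nat.card P.map.leapfrog.Vertex = Nat.card F.Dart :=
    (Nat.card_eq_of_bijective _ ⟨P.map.triangle_injective, P.map.triangle_surjective⟩).symm
  have h2 := P.map.card_leapfrog_face (fun d : F.Dart => d.fst)
    (fun v => hP.exists_fst v) P.sameCycle_rot_iff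
  have h3 := P.euler
  have h4 := P.card_dart
  have h5 := card_stellationDart (D := F.Dart)
  have h6 : Nat.card F.Dart = 3 * Nat.card V := by
    classical
    have := Fintype.ofFinite V
    have h := F.dart_card_eq_sum_degrees
    have hd : ∀ v, F.degree v = 3 := fun v => by
      rw [← hP.1 v, Set.ncard_eq_toFinset_card', SimpleGraph.degree, SimpleGraph.neighborFinset]
    simp only [hd, Finset.sum_const, Finset.card_univ, smul_eq_mul] at h
    rw [Nat.card_eq_fintype_card, h, Nat.card_eq_fintype_card, mul_comm]
  omega

/-- The leapfrog of a fullerene, as a drawing of its graph. -/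
noncomputable def IsFullerene.leapfrogEmbedding (hP : P.IsFullerene) :
    PlaneEmbedding P.map.leapfrog.graph :=
  have := P.finite_dart
  hP.isSimple.planeEmbedding hP.connected_leapfrog hP.euler_leapfrog

theorem IsFullerene.leapfrogEmbedding_map (hP : P.IsFullerene) :
    hP.leapfrogEmbedding.map = hP.isSimple.transport := rfl

theorem iterate_rot_fromCenter (d : F.Dart) (n : ℕ) :
    P.map.stellation.rot^[n] (fromCenter d) = fromCenter (P.map.face^[n] d) := by
  induction n with
  | zero => rfl
  | succ n ih => rw [iterate_succ_apply', ih, stellation_rot_fromCenter, iterate_succ_apply']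

theorem minimalPeriod_fromCenter (d : F.Dart) :
    minimalPeriod P.map.stellation.rot (fromCenter d) = minimalPeriod P.map.face d :=
  minimalPeriod_semiconj fromCenter (fun a b h => by injection h) (fun d => rfl) d

/-- Around an old vertex the stellation has edges to three neighbours and, alternating with them, to
the centres of three faces. The period divides `6`, and periods `2` and `3` are excluded. -/
theorem minimalPeriod_side (hP : P.IsCubic) (d : F.Dart) :
    minimalPeriod P.map.stellation.rot (side d) = 6 := by
  have e2 := P.map.stellation_rot_rot_side
  have h6 : IsPeriodicPt P.map.stellation.rot 6 (side d) := by
    change P.map.stellation.rot (P.map.stellation.rot (P.map.stellation.rot (P.map.stellation.rot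
      (P.map.stellation.rot (P.map.stellation.rot (side d)))))) = side d
    rw [e2, e2, e2, hP.rot_rot_rot]
  have h2 : ¬ IsPeriodicPt P.map.stellation.rot 2 (side d) := by
    intro h
    change P.map.stellation.rot (P.map.stellation.rot (side d)) = side d at h
    rw [e2, side.injEq] at h
    exact hP.rot_ne d h
  have h3 : ¬ IsPeriodicPt P.map.stellation.rot 3 (side d) := by
    intro h
    change P.map.stellation.rot (P.map.stellation.rot (P.map.stellation.rot (side d))) = side d at h
    rw [e2, stellation_rot_side] at h
    cases h
  have hd := h6.minimalPeriod_dvd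
  rw [isPeriodicPt_iff_minimalPeriod_dvd] at h2 h3
  have hle := Nat.le_of_dvd (by norm_num) hd
  generalize minimalPeriod P.map.stellation.rot (side d) = n at *
  interval_cases n <;> omega

theorem IsFullerene.minimalPeriod_stellation_rot (hP : P.IsFullerene) (x : StellationDart F.Dart) :
    minimalPeriod P.map.stellation.rot x = 5 ∨ minimalPeriod P.map.stellation.rot x = 6 := by
  rcases x with d | d | d
  · exact .inr (minimalPeriod_side hP.1 d)
  · right
    have h1 : toCenter d = P.map.stellation.rot (side (P.map.face d)) := by
      rw [stellation_rot_side, Equiv.symm_apply_apply]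
    rw [h1, minimalPeriod_apply, minimalPeriod_side hP.1]
    refine minimalPeriod_pos_iff_mem_periodicPts.1 ?_
    rw [minimalPeriod_side hP.1]
    norm_num
  · rw [minimalPeriod_fromCenter]
    exact hP.2 d

theorem IsFullerene.isFullerene_leapfrogEmbedding (hP : P.IsFullerene) :
    hP.leapfrogEmbedding.IsFullerene := by
  constructor
  · intro v
    obtain ⟨d, rfl⟩ := P.map.triangle_surjective v
    have h1 := hP.leapfrogEmbedding.minimalPeriod_rot (hP.isSimple.dartEquiv (side d))
    rw [IsSimple.fst_dartEquiv, tail_side] at h1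
    rw [← h1, leapfrogEmbedding_map,
      minimalPeriod_semiconj _ hP.isSimple.dartEquiv.injective hP.isSimple.semiconj_rot]
    have h3 : IsPeriodicPt P.map.leapfrog.rot 3 (side d) := by
      change P.map.leapfrog.rot (P.map.leapfrog.rot (P.map.leapfrog.rot (side d))) = side d
      rw [leapfrog_rot_side, leapfrog_rot_toCenter, leapfrog_rot_fromCenter]
    have h1 : ¬ IsPeriodicPt P.map.leapfrog.rot 1 (side d) := by
      intro h
      change P.map.leapfrog.rot (side d) = side d at h
      rw [leapfrog_rot_side] at h
      cases h
    have hd := h3.minimalPeriod_dvd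
    rw [isPeriodicPt_iff_minimalPeriod_dvd] at h1
    have hle := Nat.le_of_dvd (by norm_num) hd
    generalize minimalPeriod P.map.leapfrog.rot (side d) = n at *
    interval_cases n <;> omega
  · intro x
    obtain ⟨x, rfl⟩ := hP.isSimple.dartEquiv.surjective x
    obtain ⟨x, rfl⟩ := P.map.stellation.rev.surjective x
    rw [leapfrogEmbedding_map,
      minimalPeriod_semiconj _ hP.isSimple.dartEquiv.injective hP.isSimple.semiconj_face,
      minimalPeriod_semiconj _ P.map.stellation.rev.injective P.map.semiconj_stellation_rev]
    exact hP.minimalPeriod_stellation_rot x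

/-- The leapfrog of a fullerene has no triangles and no quadrangles. -/
theorem IsFullerene.noShortCycle (hP : P.IsFullerene) :
    LevelFrame.NoShortCycle P.map.leapfrog.graph := by
  have := P.finite_dart
  have adj : ∀ d e, P.map.leapfrog.graph.Adj (P.map.triangle d) (P.map.triangle e) →
      d ≠ e ∧ (e = P.map.rev d ∨ e = P.map.face d ∨ d = P.map.face e) :=
    fun d e => P.map.leapfrog_adj.1
  have rr := P.map.rev_rev
  have f3 : ∀ d, P.map.face (P.map.face (P.map.face d)) ≠ d :=
    fun d => hP.iterate_face_ne (n := 2) (by norm_num) d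
  have f4 : ∀ d, P.map.face (P.map.face (P.map.face (P.map.face d))) ≠ d :=
    fun d => hP.iterate_face_ne (n := 3) (by norm_num) d
  have fi : ∀ d e, P.map.face d = P.map.face e → d = e := fun d e h => P.map.face.injective h
  have r1 := face_ne_rev (P := P) hP.1
  have r2 : ∀ d, P.map.face (P.map.face d) ≠ P.map.rev d := by
    intro d h
    have h1 := congrArg (fun x : F.Dart => x.snd) h
    simp only [snd_rev] at h1
    have h2 := congrArg (fun x : F.Dart => x.fst) h
    simp only [fst_face, fst_rev] at h2
    have h3 := (P.map.face d).adj.ne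
    rw [fst_face] at h3
    exact h3 h2.symm
  have r3 : ∀ d, P.map.face (P.map.face (P.map.face d)) ≠ P.map.rev d := by
    intro d h
    have h2 := congrArg (fun x : F.Dart => x.fst) h
    simp only [fst_face, fst_rev] at h2
    exact r1 (P.map.face d) (eq_rev (fst_face _) (by rw [h2, fst_face]))
  have q1 : ∀ d, P.map.face (P.map.rev (P.map.face d)) ≠ P.map.rev d := by
    intro d h
    rw [face_rev, Equiv.symm_apply_eq, face_eq, Equiv.symm_apply_eq] at h
    exact IsCubic.rot_rot_ne hP.1 _ h.symm
  have q2 : ∀ d, P.map.face (P.map.rev d) ≠ P.map.rev (P.map.face d) := by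
    intro d h
    have h2 := congrArg (fun x : F.Dart => x.fst) h
    simp only [fst_face, fst_rev, snd_rev] at h2
    exact r1 d (eq_rev (fst_face _) h2.symm)
  constructor
  · intro a b c hab hbc hca
    obtain ⟨a, rfl⟩ := P.map.triangle_surjective a
    obtain ⟨b, rfl⟩ := P.map.triangle_surjective b
    obtain ⟨c, rfl⟩ := P.map.triangle_surjective c
    obtain ⟨n1, hab⟩ := adj _ _ hab
    obtain ⟨n2, hbc⟩ := adj _ _ hbc
    obtain ⟨n3, hca⟩ := adj _ _ hca
    clear adj
    -- Each side of the cycle is a step `rev`, `face` or inverse `face`. The identities excluded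
    -- above, with `rev` an involution and `face` injective, rule out all combinations.
    rcases hab with h1 | h1 | h1 <;> rcases hbc with h2 | h2 | h2 <;>
      rcases hca with h3 | h3 | h3 <;> grind
  · intro a b c d hab hbc hcd hda hac hbd
    obtain ⟨a, rfl⟩ := P.map.triangle_surjective a
    obtain ⟨b, rfl⟩ := P.map.triangle_surjective b
    obtain ⟨c, rfl⟩ := P.map.triangle_surjective c
    obtain ⟨d, rfl⟩ := P.map.triangle_surjective d
    obtain ⟨n1, hab⟩ := adj _ _ hab
    obtain ⟨n2, hbc⟩ := adj _ _ hbc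
    obtain ⟨n3, hcd⟩ := adj _ _ hcd
    obtain ⟨n4, hda⟩ := adj _ _ hda
    have hac : a ≠ c := fun h => hac (by rw [h])
    have hbd : b ≠ d := fun h => hbd (by rw [h])
    clear adj
    rcases hab with h1 | h1 | h1 <;> rcases hbc with h2 | h2 | h2 <;>
      rcases hcd with h3 | h3 | h3 <;> rcases hda with h4 | h4 | h4 <;> grind

end PlaneEmbedding


/-! ### Pentacaps and hexacaps in coordinates -/

namespace LevelFrame

variable {V : Type*} {F : SimpleGraph V} {A : LevelFrame F} {P : PlaneEmbedding F} {k ℓ : ℕ}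

/-- The circles of a pentacap or hexacap `P` are the levels of the frame `A`. -/
structure IsCapFrame (A : LevelFrame F) (P : PlaneEmbedding F) (k ℓ : ℕ) : Prop where
  two_le_k : 2 ≤ k
  one_le : 1 ≤ ℓ
  oriented : A.Oriented P
  shortFaces : A.ShortFaces P
  q_eq : A.q = ℓ + 2
  cap_period : ∀ v, A.lev v = 0 ∨ A.lev v = ℓ + 1 → ∀ n : ℤ, (A.nx ^ n) v = v ↔ (k : ℤ) ∣ n
  mid_period : ∀ v, 0 < A.lev v → A.lev v < ℓ + 1 → ∀ n : ℤ, (A.nx ^ n) v = v ↔ (2 * k : ℤ) ∣ n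

theorem iterate_eq_zpow (n : ℕ) (v : V) : A.nx^[n] v = (A.nx ^ (n : ℤ)) v := by
  rw [zpow_natCast, Equiv.Perm.coe_pow]

theorem zpow_zpow (m n : ℤ) (v : V) : (A.nx ^ m) ((A.nx ^ n) v) = (A.nx ^ (m + n)) v := by
  rw [zpow_add, Equiv.Perm.mul_apply]

theorem nx_zpow (n : ℤ) (v : V) : A.nx ((A.nx ^ n) v) = (A.nx ^ (n + 1)) v := by
  rw [add_comm, ← zpow_zpow, zpow_one]

/-- This adds up successive gaps between rungs. After one turn around the lower level, the total
displacement on the upper level is a multiple of its length, and the bounds on the single gaps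
decide which multiple. -/
theorem exists_sum_gaps {C : V → Prop} {p lo hi : ℕ} (hC : ∀ u, C u → C (A.nx^[p] u))
    (h : ∀ u, C u → ∃ s, lo ≤ s ∧ s ≤ hi ∧ A.rung (A.nx^[p] u) = A.nx^[s] (A.rung u)) (n : ℕ) :
    ∀ u, C u → ∃ s, n * lo ≤ s ∧ s ≤ n * hi ∧ A.rung (A.nx^[p * n] u) = A.nx^[s] (A.rung u) := by
  induction n with
  | zero => exact fun u _ => ⟨0, by omega, by omega, rfl⟩
  | succ n ih =>
    intro u hu
    obtain ⟨s, h1, h2, h3⟩ := h u hu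
    obtain ⟨t, h4, h5, h6⟩ := ih _ (hC u hu)
    refine ⟨t + s, by rw [add_mul]; omega, by rw [add_mul]; omega, ?_⟩
    rw [mul_add, mul_one, iterate_add_apply, h6, h3, iterate_add_apply]

namespace IsCapFrame

theorem gaps (h : A.IsCapFrame P k ℓ) {u : V} (hu : A.Up u) :
    ∃ s t, (∀ j, j < s → A.Up (A.nx^[j + 1] (A.rung u))) ∧ ¬ A.Up (A.nx^[s + 1] (A.rung u)) ∧
      (∀ j, j < t → ¬ A.Up (A.nx^[j + 1] u)) ∧ A.Up (A.nx^[t + 1] u) ∧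
      A.rung (A.nx^[t + 1] u) = A.nx^[s + 1] (A.rung u) ∧ (s + t = 1 ∨ s + t = 2) := by
  obtain ⟨s, t, h1, h2, h3, h4, h5, h6⟩ := h.oriented.exists_gaps h.shortFaces.uniqueAscent hu
  refine ⟨s, t, h1, h2, h3, h4, h5, ?_⟩
  have := h.shortFaces (A.rg u)
  omega

/-- All rungs of level `0` go outwards, so a face next to it advances by `2` or `3` on level `1`.
The `k` advances close up on a circle of length `2k`, so none of them can be `3`. -/
theorem gap_zero (h : A.IsCapFrame P k ℓ) {u : V} (hu : A.lev u = 0) :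
    A.rung (A.nx u) = A.nx (A.nx (A.rung u)) ∧ A.Up (A.nx (A.rung u)) := by
  have hk := h.two_le_k
  have up0 : ∀ w, A.lev w = 0 → A.Up w := fun w => up_of_lev_eq_zero
  have key : ∀ u, A.lev u = 0 → ∃ s, 1 ≤ s ∧ s ≤ 2 ∧
      (∀ j, j < s → A.Up (A.nx^[j + 1] (A.rung u))) ∧
      A.rung (A.nx u) = A.nx^[s + 1] (A.rung u) := by
    intro u hu
    obtain ⟨s, t, h1, h2, h3, h4, h5, h6⟩ := h.gaps (up0 u hu)
    rcases t with _ | t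
    · exact ⟨s, by omega, by omega, h1, h5⟩
    · exact absurd (up0 _ (by rw [A.lev_iterate, hu])) (h3 0 (by omega))
  obtain ⟨s, h1, h2, h3, h4⟩ := key u hu
  obtain rfl | rfl : s = 1 ∨ s = 2 := by omega
  · exact ⟨h4, h3 0 (by omega)⟩
  exfalso
  have hn : A.lev (A.nx u) = 0 := by rw [A.lev_nx, hu]
  obtain ⟨t, h5, h6, h7⟩ := exists_sum_gaps (A := A) (C := fun u => A.lev u = 0) (p := 1)
    (lo := 2) (hi := 3) (fun u hu => by rw [A.lev_iterate, hu])
    (fun u hu => by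
      obtain ⟨s, h1, h2, -, h4⟩ := key u hu
      exact ⟨s + 1, by omega, by omega, h4⟩) (k - 1) _ hn
  have h8 : A.nx^[1 * (k - 1)] (A.nx u) = u := by
    rw [← iterate_succ_apply, show (1 * (k - 1)).succ = k by omega, iterate_eq_zpow,
      h.cap_period u (.inl hu)]
  rw [h8, h4, ← iterate_add_apply] at h7
  have hr : A.lev (A.rung u) = 1 := by rw [up0 u hu, hu]; rfl
  have h9 := h7.symm
  have := h.one_le
  rw [iterate_eq_zpow, h.mid_period _ (by omega) (by omega)] at h9
  obtain ⟨c, hc⟩ := h9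
  push_cast at hc
  -- One advance of `3` makes the total lie between `2k + 1` and `3k`, where there is no multiple of
  -- `2k`.
  rcases lt_trichotomy c 1 with h10 | rfl | h10
  · have : (k : ℤ) * c ≤ 0 := mul_nonpos_of_nonneg_of_nonpos (by omega) (by omega)
    rw [mul_assoc] at hc
    omega
  · omega
  · have : (k : ℤ) * 2 ≤ k * c := mul_le_mul_of_nonneg_left (by omega) (by omega)
    rw [mul_assoc] at hc
    omega

/-- With alternating rungs on level `i`, each face above it uses two edges of that level, and so
advances by `1` or `2` on the next one. The total of `k` advances is a multiple of `2k`, so every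
advance is `2`. This hands the alternation on to the next level. -/
theorem gap_mid (h : A.IsCapFrame P k ℓ) {i : ℤ} (hi : 0 < i) (hi' : i < ℓ)
    (halt : ∀ v, A.lev v = i → (A.Up (A.nx v) ↔ ¬ A.Up v)) {u : V} (hu : A.lev u = i)
    (hup : A.Up u) :
    A.rung (A.nx (A.nx u)) = A.nx (A.nx (A.rung u)) ∧ A.Up (A.nx (A.rung u)) := by
  have hk := h.two_le_k
  have up2 : ∀ u, A.lev u = i → A.Up u → ¬ A.Up (A.nx u) ∧ A.Up (A.nx (A.nx u)) := by
    intro u hu hup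
    have h1 := halt u hu
    have h2 := halt (A.nx u) (by rw [A.lev_nx, hu])
    tauto
  have key : ∀ u, A.lev u = i ∧ A.Up u → ∃ s, s ≤ 1 ∧
      (∀ j, j < s → A.Up (A.nx^[j + 1] (A.rung u))) ∧
      A.rung (A.nx^[2] u) = A.nx^[s + 1] (A.rung u) := by
    rintro u ⟨hu, hup⟩
    obtain ⟨s, t, h1, h2, h3, h4, h5, h6⟩ := h.gaps hup
    have h7 := up2 u hu hup
    rcases t with _ | _ | t
    · exact absurd h4 h7.1
    · exact ⟨s, by omega, h1, h5⟩
    · exact absurd h7.2 (h3 1 (by omega))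
  obtain ⟨s, h2, h3, h4⟩ := key u ⟨hu, hup⟩
  obtain rfl | rfl : s = 1 ∨ s = 0 := by omega
  · exact ⟨h4, h3 0 (by omega)⟩
  exfalso
  have hC : ∀ u, A.lev u = i ∧ A.Up u → A.lev (A.nx^[2] u) = i ∧ A.Up (A.nx^[2] u) :=
    fun u hu => ⟨by rw [A.lev_iterate, hu.1], (up2 u hu.1 hu.2).2⟩
  obtain ⟨t, h5, h6, h7⟩ := exists_sum_gaps (A := A) (C := fun u => A.lev u = i ∧ A.Up u) (p := 2)
    (lo := 1) (hi := 2) hC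
    (fun u hu => by
      obtain ⟨s, h2, -, h4⟩ := key u hu
      exact ⟨s + 1, by omega, by omega, h4⟩) (k - 1) _ (hC u ⟨hu, hup⟩)
  have h8 : A.nx^[2 * (k - 1)] (A.nx^[2] u) = u := by
    rw [← iterate_add_apply, iterate_eq_zpow, h.mid_period u (by omega) (by omega)]
    exact ⟨1, by push_cast [Nat.cast_sub (show 1 ≤ k by omega)]; ring⟩
  rw [h8, h4, ← iterate_add_apply] at h7
  have hr : A.lev (A.rung u) = i + 1 := by rw [hup, hu]
  have h9 := h7.symm
  rw [iterate_eq_zpow, h.mid_period _ (by omega) (by omega)] at h9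
  obtain ⟨c, hc⟩ := h9
  push_cast at hc
  rw [mul_assoc] at hc
  -- One advance of `1` makes the total lie between `k` and `2k - 1`.
  rcases le_or_gt c 0 with h10 | h10
  · have : (k : ℤ) * c ≤ 0 := mul_nonpos_of_nonneg_of_nonpos (by omega) (by omega)
    omega
  · have : (k : ℤ) * 1 ≤ k * c := mul_le_mul_of_nonneg_left (by omega) (by omega)
    omega

theorem gap_last (h : A.IsCapFrame P k ℓ)
    (halt : ∀ v, A.lev v = ℓ → (A.Up (A.nx v) ↔ ¬ A.Up v)) {u : V} (hu : A.lev u = ℓ)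
    (hup : A.Up u) : A.rung (A.nx (A.nx u)) = A.nx (A.rung u) := by
  obtain ⟨s, t, h1, h2, h3, h4, h5, h6⟩ := h.gaps hup
  have e1 := halt u hu
  have e2 := halt (A.nx u) (by rw [A.lev_nx, hu])
  rcases s with _ | s
  · rcases t with _ | _ | t
    · exact absurd h4 (by simpa using (not_congr e1).2 (by tauto))
    · exact h5
    · exact absurd (by tauto) (h3 1 (by omega))
  · exfalso
    refine not_up_of_lev_eq ?_ (h1 0 (by omega))
    rw [A.lev_iterate, hup, hu, h.q_eq]
    ring

end IsCapFrame

/-- The vertices of a pentacap or hexacap in coordinates: the level `i`, and the angle `a` in units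
of `π / k`. -/
def vt (A : LevelFrame F) (ℓ : ℕ) (v₀ : V) : ℕ → ℤ → V
  | 0, a => (A.nx ^ (a / 2)) v₀
  | i + 1, a => if i = ℓ then (A.nx ^ ((a - i) / 2)) (A.rung (vt A ℓ v₀ i i))
      else (A.nx ^ (a - i)) (A.rung (vt A ℓ v₀ i i))

variable {v₀ : V}

theorem vt_zero (a : ℤ) : A.vt ℓ v₀ 0 a = (A.nx ^ (a / 2)) v₀ := by rw [vt]

theorem vt_succ {i : ℕ} (hi : i < ℓ) (a : ℤ) :
    A.vt ℓ v₀ (i + 1) a = (A.nx ^ (a - i)) (A.rung (A.vt ℓ v₀ i i)) := by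
  rw [vt, if_neg hi.ne]

theorem vt_last (a : ℤ) :
    A.vt ℓ v₀ (ℓ + 1) a = (A.nx ^ ((a - ℓ) / 2)) (A.rung (A.vt ℓ v₀ ℓ ℓ)) := by
  rw [vt, if_pos rfl]

theorem zpow_vt {i : ℕ} (h0 : 0 < i) (hi : i ≤ ℓ) (n a : ℤ) :
    (A.nx ^ n) (A.vt ℓ v₀ i a) = A.vt ℓ v₀ i (a + n) := by
  obtain ⟨i, rfl⟩ := Nat.exists_eq_succ_of_ne_zero h0.ne'
  rw [Nat.succ_eq_add_one, vt_succ (by omega), vt_succ (by omega), zpow_zpow]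
  congr 2
  ring

/-- the coordinates that belong to vertices -/
def Valid (ℓ : ℕ) (i : ℕ) (a : ℤ) : Prop :=
  i ≤ ℓ + 1 ∧ (i = 0 → a % 2 = 0) ∧ (i = ℓ + 1 → (a - ℓ) % 2 = 0)

/-- the distance between the coordinates of neighbours on level `i` -/
def step (ℓ : ℕ) (i : ℕ) : ℤ := if i = 0 ∨ i = ℓ + 1 then 2 else 1

theorem step_cap {i : ℕ} (h : i = 0 ∨ i = ℓ + 1) : step ℓ i = 2 := if_pos h

theorem step_mid {i : ℕ} (h0 : 0 < i) (h : i ≤ ℓ) : step ℓ i = 1 := if_neg (by omega)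

theorem Valid.add_step {i : ℕ} {a : ℤ} (h : Valid ℓ i a) : Valid ℓ i (a + step ℓ i) := by
  unfold Valid step at *
  split_ifs <;> omega

theorem Valid.sub_step {i : ℕ} {a : ℤ} (h : Valid ℓ i a) : Valid ℓ i (a - step ℓ i) := by
  unfold Valid step at *
  split_ifs <;> omega

namespace IsCapFrame

/-- Induction on the level, started by `gap_zero` and continued by `gap_mid`. The origin of the
angle on level `i + 1` is chosen so that the rung at angle `i` is radial. Hence the outward rungs of
level `i` sit at the angles congruent to `i` modulo `2`. -/
theorem up_vt_mid (h : A.IsCapFrame P k ℓ) (h0 : A.lev v₀ = 0) {i : ℕ} (hi : 0 < i) (hi' : i ≤ ℓ) :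
    (∀ a, A.lev (A.vt ℓ v₀ i a) = i) ∧ ∀ a, A.Up (A.vt ℓ v₀ i a) ↔ (a - i) % 2 = 0 := by
  -- a level is described by its rungs
  have gen : ∀ (i : ℕ) (w : ℤ → V), i < ℓ → (∀ b, ¬ A.Up (w b)) → (∀ b, A.Up (A.nx (w b))) →
      (∀ b : ℤ, w b = (A.nx ^ (2 * b)) (A.rung (A.vt ℓ v₀ i i))) →
      ∀ a, A.Up (A.vt ℓ v₀ (i + 1) a) ↔ (a - (i + 1 : ℕ)) % 2 = 0 := by
    intro i w hi h1 h2 h3 a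
    rw [vt_succ hi]
    obtain ⟨b, hb | hb⟩ := (a - i).even_or_odd'
    · rw [hb, ← h3]
      have := h1 b
      simp only [this, false_iff]
      push_cast
      omega
    · rw [hb, ← nx_zpow, ← h3]
      have := h2 b
      simp only [this, true_iff]
      push_cast
      omega
  induction i with
  | zero => omega
  | succ i ih =>
    rcases i.eq_zero_or_pos with rfl | hpos
    · have e0 : A.vt ℓ v₀ 0 (0 : ℕ) = v₀ := by rw [vt_zero]; simp
      have up0 := up_of_lev_eq_zero h0
      refine ⟨fun a => by rw [vt_succ hi', A.lev_zpow, e0, up0, h0]; simp, ?_⟩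
      have hl : ∀ b : ℤ, A.lev ((A.nx ^ b) v₀) = 0 := fun b => by rw [A.lev_zpow, h0]
      refine gen 0 (fun b => A.rung ((A.nx ^ b) v₀)) hi'
        (fun b hb => A.up_rung.1 hb (up_of_lev_eq_zero (hl b)))
        (fun b => (h.gap_zero (hl b)).2) ?_
      rw [e0]
      intro b
      induction b with
      | zero => simp
      | succ b ih =>
        have := (h.gap_zero (hl b)).1
        rw [ih, nx_zpow, nx_zpow, nx_zpow] at this
        rw [this]
        congr 2
      | pred b ih =>
        have := (h.gap_zero (hl (-b - 1))).1
        rw [nx_zpow, show -(b : ℤ) - 1 + 1 = -b by ring, ih] at this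
        apply A.nx.injective
        apply A.nx.injective
        rw [← this, nx_zpow, nx_zpow]
        congr 2
        ring
    · obtain ⟨hlev, hup⟩ := ih hpos (by omega)
      have hu : A.Up (A.vt ℓ v₀ i i) := by rw [hup]; simp
      refine ⟨fun a => by rw [vt_succ hi', A.lev_zpow, hu, hlev]; push_cast; ring, ?_⟩
      have hle : ∀ v, A.lev v = i → ∃ a, A.vt ℓ v₀ i a = v := by
        intro v hv
        obtain ⟨n, hn⟩ := A.sameCycle (A.vt ℓ v₀ i 0) v (by rw [hlev, hv])
        exact ⟨0 + n, by rw [← hn, zpow_vt hpos (by omega)]⟩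
      have hnx : ∀ a, A.nx (A.vt ℓ v₀ i a) = A.vt ℓ v₀ i (a + 1) := fun a => by
        rw [← zpow_vt hpos (by omega), zpow_one]
      have halt : ∀ v, A.lev v = i → (A.Up (A.nx v) ↔ ¬ A.Up v) := by
        intro v hv
        obtain ⟨a, rfl⟩ := hle v hv
        rw [hnx, hup, hup]
        omega
      have hg : ∀ b : ℤ, _ := fun b => h.gap_mid (by exact_mod_cast hpos) (by exact_mod_cast hi')
        halt (hlev (i + 2 * b)) ((hup _).2 (by omega))
      refine gen i (fun b => A.rung (A.vt ℓ v₀ i (i + 2 * b))) hi'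
        (fun b hb => A.up_rung.1 hb ((hup _).2 (by omega))) (fun b => (hg b).2) ?_
      intro b
      induction b with
      | zero => simp
      | succ b ih =>
        have := (hg b).1
        rw [ih, hnx, hnx, nx_zpow, nx_zpow] at this
        convert this using 3 <;> ring
      | pred b ih =>
        have := (hg (-b - 1)).1
        rw [hnx, hnx, show (i : ℤ) + 2 * (-(b : ℤ) - 1) + 1 + 1 = i + 2 * -b by ring, ih] at this
        apply A.nx.injective
        apply A.nx.injective
        rw [← this, nx_zpow, nx_zpow]
        congr 2
        ring

theorem lev_vt (h : A.IsCapFrame P k ℓ) (h0 : A.lev v₀ = 0) {i : ℕ} (hi : i ≤ ℓ + 1) (a : ℤ) :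
    A.lev (A.vt ℓ v₀ i a) = i := by
  rcases i.eq_zero_or_pos with rfl | hpos
  · rw [vt_zero, A.lev_zpow, h0]; rfl
  rcases hi.lt_or_eq with hi' | rfl
  · exact (h.up_vt_mid h0 hpos (by omega)).1 a
  · obtain ⟨h1, h2⟩ := h.up_vt_mid h0 h.one_le le_rfl
    rw [vt_last, A.lev_zpow, (h2 _).2 (by simp), h1]
    push_cast
    ring

theorem up_vt (h : A.IsCapFrame P k ℓ) (h0 : A.lev v₀ = 0) {i : ℕ} {a : ℤ} (hv : Valid ℓ i a) :
    A.Up (A.vt ℓ v₀ i a) ↔ (a - i) % 2 = 0 := by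
  obtain ⟨hi, h1, h2⟩ := hv
  rcases i.eq_zero_or_pos with rfl | hpos
  · have := up_of_lev_eq_zero (h.lev_vt h0 hi a)
    simp only [this, true_iff]
    have := h1 rfl
    push_cast
    omega
  rcases hi.lt_or_eq with hi' | rfl
  · exact (h.up_vt_mid h0 hpos (by omega)).2 a
  · have := not_up_of_lev_eq (A := A) (v := A.vt ℓ v₀ (ℓ + 1) a)
      (by rw [h.lev_vt h0 le_rfl, h.q_eq]; push_cast; ring)
    simp only [this, false_iff]
    have := h2 rfl
    push_cast
    omega

theorem nx_vt (_h : A.IsCapFrame P k ℓ) (i : ℕ) (hi : i ≤ ℓ + 1) (a : ℤ) :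
    A.nx (A.vt ℓ v₀ i a) = A.vt ℓ v₀ i (a + step ℓ i) := by
  rcases i.eq_zero_or_pos with rfl | hpos
  · rw [vt_zero, vt_zero, step_cap (.inl rfl), nx_zpow]
    congr 2
    omega
  rcases hi.lt_or_eq with hi' | rfl
  · rw [step_mid hpos (by omega), ← zpow_vt hpos (by omega), zpow_one]
  · rw [vt_last, vt_last, step_cap (.inr rfl), nx_zpow]
    congr 2
    omega

theorem inv_vt (h : A.IsCapFrame P k ℓ) (i : ℕ) (hi : i ≤ ℓ + 1) (a : ℤ) :
    A.nx⁻¹ (A.vt ℓ v₀ i a) = A.vt ℓ v₀ i (a - step ℓ i) := by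
  rw [Equiv.Perm.inv_eq_iff_eq, h.nx_vt i hi, sub_add_cancel]

/-- One rung is radial by the definition of `vt`. The advance from one outward rung to the next is
the same angle on both levels, so all of them are. -/
theorem rung_vt (h : A.IsCapFrame P k ℓ) (h0 : A.lev v₀ = 0) {i : ℕ} (hi : i ≤ ℓ) {a : ℤ}
    (ha : (a - i) % 2 = 0) : A.rung (A.vt ℓ v₀ i a) = A.vt ℓ v₀ (i + 1) a := by
  have hone := h.one_le
  obtain ⟨b, hb⟩ : ∃ b : ℤ, a = i + 2 * b := ⟨(a - i) / 2, by omega⟩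
  subst hb
  clear ha
  have hl : ∀ a, A.lev (A.vt ℓ v₀ i a) = i := h.lev_vt h0 (by omega)
  have hv : ∀ b : ℤ, Valid ℓ i (i + 2 * b) := fun b => ⟨by omega, by omega, by omega⟩
  have hup : ∀ b : ℤ, A.Up (A.vt ℓ v₀ i (i + 2 * b)) := fun b =>
    (h.up_vt h0 (hv b)).2 (by omega)
  have halt : 0 < i → ∀ v, A.lev v = i → (A.Up (A.nx v) ↔ ¬ A.Up v) := by
    intro hpos v hv
    obtain ⟨n, hn⟩ := A.sameCycle (A.vt ℓ v₀ i 0) v (by rw [hl, hv])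
    rw [zpow_vt hpos hi] at hn
    rw [← hn, h.nx_vt i (by omega), step_mid hpos hi, (h.up_vt_mid h0 hpos hi).2,
      (h.up_vt_mid h0 hpos hi).2]
    omega
  have key : ∀ b : ℤ, A.rung (A.vt ℓ v₀ i (i + 2 * (b + 1))) =
      A.nx^[if i = ℓ then 1 else 2] (A.rung (A.vt ℓ v₀ i (i + 2 * b))) := by
    intro b
    rcases i.eq_zero_or_pos with rfl | hpos
    · rw [if_neg (by omega)]
      have h1 := (h.gap_zero (hl ((0 : ℕ) + 2 * b))).1
      rw [h.nx_vt 0 (by omega), step_cap (.inl rfl)] at h1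
      rw [mul_add, mul_one, ← add_assoc]
      exact h1
    · have e : A.nx (A.nx (A.vt ℓ v₀ i (i + 2 * b))) = A.vt ℓ v₀ i (i + 2 * (b + 1)) := by
        rw [h.nx_vt i (by omega), h.nx_vt i (by omega), step_mid hpos hi]
        congr 1
        ring
      rw [← e]
      rcases hi.lt_or_eq with hi' | rfl
      · rw [if_neg (by omega)]
        exact (h.gap_mid (by omega) (by omega) (halt hpos) (hl _) (hup b)).1
      · rw [if_pos rfl]
        exact h.gap_last (halt hpos) (hl _) (hup b)
  have e1 : ∀ b : ℤ, A.vt ℓ v₀ (i + 1) (i + 2 * (b + 1)) =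
      A.nx^[if i = ℓ then 1 else 2] (A.vt ℓ v₀ (i + 1) (i + 2 * b)) := by
    intro b
    split_ifs with hil
    · subst hil
      rw [iterate_one, h.nx_vt _ le_rfl, step_cap (.inr rfl)]
      congr 1
      ring
    · change _ = A.nx (A.nx _)
      rw [h.nx_vt _ (by omega), h.nx_vt _ (by omega), step_mid (by omega) (by omega)]
      congr 1
      ring
  have e0 : A.rung (A.vt ℓ v₀ i i) = A.vt ℓ v₀ (i + 1) i := by
    rcases hi.lt_or_eq with hi' | rfl
    · rw [vt_succ hi', sub_self, zpow_zero]; rfl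
    · rw [vt_last, sub_self]; simp
  induction b with
  | zero => simpa using e0
  | succ b ih => rw [key, ih, e1]
  | pred b ih =>
    apply (A.nx.injective.iterate (if i = ℓ then 1 else 2))
    rw [← key, ← e1, sub_add_cancel, ih]

theorem rung_vt' (h : A.IsCapFrame P k ℓ) (h0 : A.lev v₀ = 0) {i : ℕ} (hi : i ≤ ℓ) {a : ℤ}
    (ha : (a - i) % 2 = 0) : A.rung (A.vt ℓ v₀ (i + 1) a) = A.vt ℓ v₀ i a := by
  rw [← h.rung_vt h0 hi ha, A.rung_rung]

/-- The angle runs in steps of two on the caps, which makes the period `2k` on every level. -/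
theorem vt_eq_vt (h : A.IsCapFrame P k ℓ) (h0 : A.lev v₀ = 0) {i : ℕ} {a b : ℤ}
    (ha : Valid ℓ i a) (hb : Valid ℓ i b) :
    A.vt ℓ v₀ i a = A.vt ℓ v₀ i b ↔ (2 * k : ℤ) ∣ a - b := by
  obtain ⟨hi, a1, a2⟩ := ha
  obtain ⟨-, b1, b2⟩ := hb
  have hl := h.lev_vt h0 hi b
  have cap : ∀ n : ℤ, ((k : ℤ) ∣ n) ↔ (2 * k : ℤ) ∣ 2 * n := fun n =>
    (mul_dvd_mul_iff_left (by norm_num)).symm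
  rcases i.eq_zero_or_pos with rfl | hpos
  · have e : A.vt ℓ v₀ 0 a = (A.nx ^ (a / 2 - b / 2)) (A.vt ℓ v₀ 0 b) := by
      rw [vt_zero, vt_zero, zpow_zpow, sub_add_cancel]
    rw [e, h.cap_period _ (.inl hl), cap]
    have := a1 rfl
    have := b1 rfl
    rw [show 2 * (a / 2 - b / 2) = a - b by omega]
  rcases hi.lt_or_eq with hi' | rfl
  · have e : A.vt ℓ v₀ i a = (A.nx ^ (a - b)) (A.vt ℓ v₀ i b) := by
      rw [zpow_vt hpos (by omega), add_sub_cancel]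
    rw [e, h.mid_period _ (by omega) (by omega)]
  · have e : A.vt ℓ v₀ (ℓ + 1) a = (A.nx ^ ((a - ℓ) / 2 - (b - ℓ) / 2)) (A.vt ℓ v₀ (ℓ + 1) b) := by
      rw [vt_last, vt_last, zpow_zpow, sub_add_cancel]
    rw [e, h.cap_period _ (.inr (by rw [hl]; push_cast; ring)), cap]
    have := a2 rfl
    have := b2 rfl
    rw [show 2 * ((a - ℓ) / 2 - (b - ℓ) / 2) = a - b by omega]

theorem exists_vt (h : A.IsCapFrame P k ℓ) (h0 : A.lev v₀ = 0) (v : V) :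
    ∃ i a, Valid ℓ i a ∧ A.vt ℓ v₀ i a = v := by
  have l0 := A.lev_nonneg v
  have l1 := A.lev_lt v
  rw [h.q_eq] at l1
  obtain ⟨i, hi⟩ := Int.eq_ofNat_of_zero_le l0
  have hi' : i ≤ ℓ + 1 := by omega
  have hcl : ∀ n : ℤ, (A.nx ^ n) (A.vt ℓ v₀ i i) = A.vt ℓ v₀ i (i + n * step ℓ i) := by
    intro n
    induction n with
    | zero => simp
    | succ n ih => rw [← nx_zpow, ih, h.nx_vt i hi']; congr 1; ring
    | pred n ih =>
      apply A.nx.injective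
      rw [nx_zpow, sub_add_cancel, ih, h.nx_vt i hi']
      congr 1; ring
  rcases hi'.lt_or_eq with hlt | rfl
  · obtain ⟨n, hn⟩ := A.sameCycle (A.vt ℓ v₀ i i) v (by rw [h.lev_vt h0 hi', hi])
    rw [hcl] at hn
    refine ⟨i, _, ⟨hi', ?_, ?_⟩, hn⟩
    · rintro rfl
      rw [step_cap (.inl rfl)]
      push_cast
      omega
    · omega
  · obtain ⟨n, hn⟩ := A.sameCycle (A.vt ℓ v₀ (ℓ + 1) ℓ) v (by rw [h.lev_vt h0 hi', hi])
    rw [vt_last, zpow_zpow, sub_self] at hn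
    refine ⟨ℓ + 1, ℓ + 2 * n, ⟨hi', by omega, by omega⟩, ?_⟩
    rw [vt_last, ← hn]
    congr 2
    omega

end IsCapFrame

end LevelFrame


/-! ### Circle drawings from circles parametrized by the integers -/

namespace PlaneEmbedding

variable {V : Type*} {G : SimpleGraph V}

/-- At the vertex `u`, the neighbours are, counterclockwise, `x`, `y` and `z`. -/
def Turn (Q : PlaneEmbedding G) (u x y z : V) : Prop :=
  ∃ d e f : G.Dart, d.fst = u ∧ e.fst = u ∧ f.fst = u ∧ d.snd = x ∧ e.snd = y ∧ f.snd = z ∧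
    Q.map.rot d = e ∧ Q.map.rot e = f ∧ Q.map.rot f = d

variable {Q : PlaneEmbedding G} {u x y z w : V}

theorem Turn.rotate (h : Q.Turn u x y z) : Q.Turn u y z x := by
  obtain ⟨d, e, f, h1, h2, h3, h4, h5, h6, h7, h8, h9⟩ := h
  exact ⟨e, f, d, h2, h3, h1, h5, h6, h4, h8, h9, h7⟩

theorem Turn.rotate' (h : Q.Turn u x y z) : Q.Turn u z x y := h.rotate.rotate

theorem Turn.adj_iff (h : Q.Turn u x y z) : G.Adj u w ↔ w = x ∨ w = y ∨ w = z := by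
  obtain ⟨d, e, f, h1, h2, h3, h4, h5, h6, h7, h8, h9⟩ := h
  have := Q.finite_dart
  constructor
  · intro hw
    obtain ⟨n, hn⟩ := ((Q.sameCycle_rot_iff d ⟨(u, w), hw⟩).2 h1).exists_nat_pow_eq
    rw [Equiv.Perm.coe_pow] at hn
    have key : ∀ n, Q.map.rot^[n] d = d ∨ Q.map.rot^[n] d = e ∨ Q.map.rot^[n] d = f := by
      intro n
      induction n with
      | zero => exact .inl rfl
      | succ n ih =>
        rw [iterate_succ_apply']
        rcases ih with ih | ih | ih <;> rw [ih]
        exacts [.inr (.inl h7), .inr (.inr h8), .inl h9]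
    have := key n
    rw [hn] at this
    rcases this with h | h | h
    · left; rw [← h4, ← h]
    · right; left; rw [← h5, ← h]
    · right; right; rw [← h6, ← h]
  · rintro (rfl | rfl | rfl)
    · have := d.adj; rwa [h1, h4] at this
    · have := e.adj; rwa [h2, h5] at this
    · have := f.adj; rwa [h3, h6] at this

theorem dart_eq {d e : G.Dart} (h1 : d.fst = e.fst) (h2 : d.snd = e.snd) : d = e :=
  SimpleGraph.Dart.ext _ _ (Prod.ext h1 h2)

theorem Turn.meetsBefore (h : Q.Turn u x y z) (hxz : x ≠ z) (hyz : y ≠ z) {d e f : G.Dart}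
    (d1 : d.fst = u) (d2 : d.snd = x) (e1 : e.fst = u) (e2 : e.snd = y) (f2 : f.snd = z) :
    Q.MeetsBefore d e f := by
  obtain ⟨d', e', f', h1, h2, h3, h4, h5, h6, h7, h8, h9⟩ := h
  obtain rfl : d = d' := dart_eq (d1.trans h1.symm) (d2.trans h4.symm)
  obtain rfl : e = e' := dart_eq (e1.trans h2.symm) (e2.trans h5.symm)
  refine ⟨1, h7, fun j hj hf => ?_⟩
  obtain rfl | rfl : j = 0 ∨ j = 1 := by omega
  · exact hxz (by rw [← d2, ← f2, ← hf]; rfl)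
  · rw [iterate_one, h7] at hf
    exact hyz (by rw [← e2, ← f2, ← hf])

end PlaneEmbedding

/-- Circles in a drawing that are parametrized by the integers. -/
structure IntCircles {V : Type*} {G : SimpleGraph V} (Q : PlaneEmbedding G) (m : List ℕ)
    (c : ℕ → ℤ → V) : Prop where
  three_le : ∀ i (h : i < m.length), 3 ≤ m[i]
  eq_iff : ∀ i j (h : i < m.length), j < m.length → ∀ a b,
    c i a = c j b ↔ i = j ∧ (m[i] : ℤ) ∣ a - b
  turn : ∀ i, i < m.length → ∀ a, ∃ o,
    (Q.Turn (c i a) (c i (a + 1)) o (c i (a - 1)) ∧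
      ((∃ j b, j + 1 = i ∧ o = c j b) ∨ i = 0 ∧ ∀ j < m.length, ∀ b, c j b ≠ o)) ∨
    (Q.Turn (c i a) (c i (a + 1)) (c i (a - 1)) o ∧ ∃ b, i + 1 < m.length ∧ o = c (i + 1) b)

/-- The parametrizations descend to the residues modulo the lengths of the circles. In a cubic graph
the cyclic order of the three neighbours decides all conditions on adjacency and on sides, so it is
enough to know one `Turn` at each vertex. -/
theorem IntCircles.exists_circleDrawing {V : Type*} {G : SimpleGraph V} {Q : PlaneEmbedding G}
    {m : List ℕ} {c : ℕ → ℤ → V} (h : IntCircles Q m c) (hm : m ≠ []) :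
    ∃ C : CircleDrawing Q m, C.interior = {v | ∀ i < m.length, ∀ a, c i a ≠ v} := by
  let circ : (i : Fin m.length) → ZMod (m.get i) → V := fun i a => c i (a.cast : ℤ)
  have hci : ∀ (i : Fin m.length) (z : ℤ), circ i (z : ZMod (m.get i)) = c i z := by
    intro i z
    refine (h.eq_iff i i i.2 i.2 _ _).2 ⟨rfl, ?_⟩
    have := (ZMod.intCast_eq_intCast_iff_dvd_sub z ((z : ZMod (m.get i)).cast : ℤ) (m.get i)).1
      (by rw [ZMod.intCast_zmod_cast])
    exact this
  have hs : ∀ (i : Fin m.length) (a : ZMod (m.get i)), ∃ z : ℤ, (z : ZMod (m.get i)) = a :=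
    fun i a => ZMod.intCast_surjective a
  have hadd : ∀ (i : Fin m.length) (z : ℤ), circ i ((z : ZMod (m.get i)) + 1) = c i (z + 1) := by
    intro i z
    rw [← hci]
    push_cast
    rfl
  have hsub : ∀ (i : Fin m.length) (z : ℤ), circ i ((z : ZMod (m.get i)) - 1) = c i (z - 1) := by
    intro i z
    rw [← hci]
    push_cast
    rfl
  have hij : ∀ (i j : Fin m.length) a b, c i a = c j b → i = j := fun i j a b he =>
    Fin.ext ((h.eq_iff i j i.2 j.2 a b).1 he).1
  have hpm : ∀ (i : Fin m.length) a, c i (a + 1) ≠ c i (a - 1) := by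
    intro i a he
    have h1 := ((h.eq_iff i i i.2 i.2 _ _).1 he).2
    have h2 := Int.le_of_dvd (by omega) h1
    have := h.three_le i i.2
    omega
  have hon : ∀ (i : Fin m.length) a b, G.Adj (c i a) (c i b) →
      c i b = c i (a + 1) ∨ c i b = c i (a - 1) := by
    intro i a b hab
    obtain ⟨o, ⟨ht, ho⟩ | ⟨ht, b', hi, ho⟩⟩ := h.turn i i.2 a
    · rcases ht.adj_iff.1 hab with h1 | h1 | h1
      · exact .inl h1
      · rcases ho with ⟨j, b', hj, ho⟩ | ⟨-, ho⟩
        · rw [ho] at h1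
          have := ((h.eq_iff i j i.2 (by omega) _ _).1 h1).1
          omega
        · exact absurd h1 (ho i i.2 b)
      · exact .inr h1
    · rcases ht.adj_iff.1 hab with h1 | h1 | h1
      · exact .inl h1
      · exact .inr h1
      · rw [ho] at h1
        have := ((h.eq_iff i _ i.2 hi _ _).1 h1).1
        omega
  have dvdz : ∀ (i : Fin m.length) (a b : ℤ), c i a = c i b →
      (a : ZMod (m.get i)) = (b : ZMod (m.get i)) := by
    intro i a b he
    have h1 := ((h.eq_iff i i i.2 i.2 _ _).1 he).2
    exact ((ZMod.intCast_eq_intCast_iff_dvd_sub b a (m.get i)).2 h1).symm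
  refine ⟨
    { ne_nil := hm
      three_le := fun i => h.three_le i i.2
      circle := circ
      injective := ?_
      adj_succ := ?_
      induced := ?_
      consecutive := ?_
      interior_adj := ?_
      inward := ?_
      inward_interior := ?_
      outward := ?_ }, ?_⟩
  · rintro ⟨i, a⟩ ⟨j, b⟩ hab
    obtain ⟨a, rfl⟩ := hs i a
    obtain ⟨b, rfl⟩ := hs j b
    simp only [hci] at hab
    obtain rfl := hij _ _ _ _ hab
    rw [dvdz i a b hab]
  · intro i a
    obtain ⟨a, rfl⟩ := hs i a
    rw [hadd, hci]
    obtain ⟨o, ⟨ht, -⟩ | ⟨ht, -⟩⟩ := h.turn i i.2 a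
    · exact ht.adj_iff.2 (.inl rfl)
    · exact ht.adj_iff.2 (.inl rfl)
  · intro i a b hab
    obtain ⟨a, rfl⟩ := hs i a
    obtain ⟨b, rfl⟩ := hs i b
    rw [hci, hci] at hab
    rcases hon i a b hab with h1 | h1
    · left
      rw [dvdz _ _ _ h1]
      push_cast
      rfl
    · right
      rw [dvdz _ _ _ h1]
      push_cast
      ring
  · intro i j a b hab
    obtain ⟨a, rfl⟩ := hs i a
    obtain ⟨b, rfl⟩ := hs j b
    rw [hci, hci] at hab
    have key : ∀ x y, c j x = c i y → j.val = i.val := fun x y he =>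
      congrArg Fin.val (hij _ _ _ _ he)
    obtain ⟨o, ⟨ht, ho⟩ | ⟨ht, b', hi, ho⟩⟩ := h.turn i i.2 a
    · rcases ht.adj_iff.1 hab with h1 | h1 | h1
      · have := key _ _ h1
        omega
      · rcases ho with ⟨j', b', hj, ho⟩ | ⟨-, ho⟩
        · rw [ho] at h1
          have := ((h.eq_iff j j' j.2 (by omega) _ _).1 h1).1
          omega
        · exact absurd h1 (ho j j.2 b)
      · have := key _ _ h1
        omega
    · rcases ht.adj_iff.1 hab with h1 | h1 | h1
      · have := key _ _ h1
        omega
      · have := key _ _ h1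
        omega
      · rw [ho] at h1
        have := ((h.eq_iff j _ j.2 hi _ _).1 h1).1
        omega
  · intro v hv i a hav
    obtain ⟨a, rfl⟩ := hs i a
    rw [hci] at hav
    have hv' : ∀ j < m.length, ∀ b, c j b ≠ v := fun j hj b => by
      have := hv ⟨j, hj⟩ (b : ZMod _)
      rwa [hci] at this
    obtain ⟨o, ⟨ht, ho⟩ | ⟨ht, b', hi, ho⟩⟩ := h.turn i i.2 a
    · rcases ht.adj_iff.1 hav with h1 | h1 | h1
      · exact absurd h1.symm (hv' i i.2 _)
      · rcases ho with ⟨j', b', hj, ho⟩ | ⟨h0, -⟩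
        · exact absurd (h1.trans ho).symm (hv' j' (by omega) _)
        · exact h0
      · exact absurd h1.symm (hv' i i.2 _)
    · rcases ht.adj_iff.1 hav with h1 | h1 | h1
      · exact absurd h1.symm (hv' i i.2 _)
      · exact absurd h1.symm (hv' i i.2 _)
      · exact absurd (h1.trans ho).symm (hv' _ hi _)
  · rintro i a d bwd fwd hd hf hf' hb hb' ⟨j, b, hj, hdj⟩
    obtain ⟨a, rfl⟩ := hs i a
    obtain ⟨b, rfl⟩ := hs j b
    rw [hci] at hd hf hb hdj
    rw [hadd] at hf'
    rw [hsub] at hb'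
    have hne : ∀ x, d.snd ≠ c i x := fun x he => by
      have := congrArg Fin.val (hij _ _ _ _ (hdj.symm.trans he))
      omega
    have hadj := d.adj
    rw [hd] at hadj
    obtain ⟨o, ⟨ht, ho⟩ | ⟨ht, b', hi, ho⟩⟩ := h.turn i i.2 a
    · have h1 := (ht.adj_iff.1 hadj).resolve_left (hne _) |>.resolve_right (hne _)
      exact ht.meetsBefore (hpm i a) (by rw [← h1]; exact hne _) hf hf' hd h1 hb'
    · have h1 := ((ht.adj_iff.1 hadj).resolve_left (hne _)).resolve_left (hne _)
      have := ((h.eq_iff j _ j.2 hi _ _).1 (hdj.symm.trans (h1.trans ho))).1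
      omega
  · rintro i a d bwd fwd hd hf hf' hb hb' hv
    obtain ⟨a, rfl⟩ := hs i a
    rw [hci] at hd hf hb
    rw [hadd] at hf'
    rw [hsub] at hb'
    have hne : ∀ j < m.length, ∀ x, d.snd ≠ c j x := fun j hj x he => by
      have := hv ⟨j, hj⟩ (x : ZMod _)
      rw [hci] at this
      exact this he.symm
    have hadj := d.adj
    rw [hd] at hadj
    obtain ⟨o, ⟨ht, ho⟩ | ⟨ht, b', hi, ho⟩⟩ := h.turn i i.2 a
    · have h1 := (ht.adj_iff.1 hadj).resolve_left (hne i i.2 _) |>.resolve_right (hne i i.2 _)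
      exact ht.meetsBefore (hpm i a) (by rw [← h1]; exact hne i i.2 _) hf hf' hd h1 hb'
    · have h1 := ((ht.adj_iff.1 hadj).resolve_left (hne i i.2 _)).resolve_left (hne i i.2 _)
      exact absurd (h1.trans ho) (hne _ hi _)
  · rintro i a d bwd fwd hd hf hf' hb hb' ⟨j, b, hj, hdj⟩
    obtain ⟨a, rfl⟩ := hs i a
    obtain ⟨b, rfl⟩ := hs j b
    rw [hci] at hd hf hb hdj
    rw [hadd] at hf'
    rw [hsub] at hb'
    have hne : ∀ x, d.snd ≠ c i x := fun x he => by
      have := congrArg Fin.val (hij _ _ _ _ (hdj.symm.trans he))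
      omega
    have hadj := d.adj
    rw [hd] at hadj
    obtain ⟨o, ⟨ht, ho⟩ | ⟨ht, b', hi, ho⟩⟩ := h.turn i i.2 a
    · have h1 := (ht.adj_iff.1 hadj).resolve_left (hne _) |>.resolve_right (hne _)
      rcases ho with ⟨j', b', hj', ho⟩ | ⟨-, ho⟩
      · have := ((h.eq_iff j _ j.2 (by omega) _ _).1 (hdj.symm.trans (h1.trans ho))).1
        omega
      · exact absurd (hdj.symm.trans h1) (ho j j.2 _)
    · have h1 := ((ht.adj_iff.1 hadj).resolve_left (hne _)).resolve_left (hne _)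
      exact ht.rotate.meetsBefore (hpm i a).symm (by rw [← h1]; exact hne _) hb hb' hd h1 hf'
  · ext v
    constructor
    · intro hv i hi a
      have := hv ⟨i, hi⟩ (a : ZMod _)
      change circ _ _ ≠ _ at this
      rwa [hci] at this
    · intro hv i a
      obtain ⟨a, rfl⟩ := hs i a
      change circ _ _ ≠ _
      rw [hci]
      exact hv i i.2 a


/-! ### The neighbours of a triangle, and the darts of a cap in coordinates -/

namespace PlaneEmbedding

variable {V : Type*} {F : SimpleGraph V} {P : PlaneEmbedding F}

-- The rotation of the leapfrog runs through the three sides of a triangle: its old edge, the edge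
-- to the centre, and the edge from the centre. Beyond them are the triangles of `rev d`, `face d`
-- and the preimage of `d` under `face`.
open CombMap.StellationDart in
theorem IsFullerene.turn_triangle (hP : P.IsFullerene) {d e f g : F.Dart} (he : P.map.rev d = e)
    (hf : P.map.face d = f) (hg : P.map.face g = d) :
    hP.leapfrogEmbedding.Turn (P.map.triangle d) (P.map.triangle e) (P.map.triangle f)
      (P.map.triangle g) := by
  have hr : ∀ x, hP.leapfrogEmbedding.map.rot (hP.isSimple.dartEquiv x) =
      hP.isSimple.dartEquiv (P.map.leapfrog.rot x) := fun x => (hP.isSimple.semiconj_rot x).symm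
  refine ⟨hP.isSimple.dartEquiv (side d), hP.isSimple.dartEquiv (toCenter d),
    hP.isSimple.dartEquiv (fromCenter d), rfl, ?_, ?_, ?_, ?_, ?_, ?_, ?_, ?_⟩
  · rw [CombMap.IsSimple.fst_dartEquiv, CombMap.tail_toCenter]
  · rw [CombMap.IsSimple.fst_dartEquiv, CombMap.tail_fromCenter]
  · rw [CombMap.IsSimple.snd_dartEquiv, CombMap.leapfrog_rev_side, CombMap.tail_side, he]
  · rw [CombMap.IsSimple.snd_dartEquiv, CombMap.leapfrog_rev_toCenter, CombMap.tail_fromCenter, hf]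
  · rw [CombMap.IsSimple.snd_dartEquiv, CombMap.leapfrog_rev_fromCenter, CombMap.tail_toCenter,
      ← hg, Equiv.symm_apply_apply]
  · rw [hr, CombMap.leapfrog_rot_side]
  · rw [hr, CombMap.leapfrog_rot_toCenter]
  · rw [hr, CombMap.leapfrog_rot_fromCenter]

end PlaneEmbedding

namespace LevelFrame

variable {V : Type*} {F : SimpleGraph V} {A : LevelFrame F} {P : PlaneEmbedding F} {k ℓ : ℕ}
  {v₀ : V}

/-- the directions of the darts of a level frame -/
inductive DartKind where
  | fwd : DartKind
  | bwd : DartKind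
  | rung : DartKind

/-- the darts of a pentacap or hexacap in coordinates -/
def dt (A : LevelFrame F) (ℓ : ℕ) (v₀ : V) : DartKind → ℕ → ℤ → F.Dart
  | .fwd, i, a => A.fw (A.vt ℓ v₀ i a)
  | .bwd, i, a => A.bw (A.vt ℓ v₀ i a)
  | .rung, i, a => A.rg (A.vt ℓ v₀ i a)

theorem exists_dt_kind (d : F.Dart) (i : ℕ) (a : ℤ) (h : A.vt ℓ v₀ i a = d.fst) :
    ∃ t, A.dt ℓ v₀ t i a = d := by
  rcases A.dart_cases d with h' | h' | h'
  · exact ⟨.fwd, by rw [h', dt, h]⟩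
  · exact ⟨.bwd, by rw [h', dt, h]⟩
  · exact ⟨.rung, by rw [h', dt, h]⟩

theorem fst_dt (t : DartKind) (i : ℕ) (a : ℤ) : (A.dt ℓ v₀ t i a).fst = A.vt ℓ v₀ i a := by
  cases t <;> rfl

namespace IsCapFrame

theorem exists_dt (h : A.IsCapFrame P k ℓ) (h0 : A.lev v₀ = 0) (d : F.Dart) :
    ∃ t i a, Valid ℓ i a ∧ A.dt ℓ v₀ t i a = d := by
  obtain ⟨i, a, hv, hd⟩ := h.exists_vt h0 d.fst
  obtain ⟨t, ht⟩ := exists_dt_kind d i a hd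
  exact ⟨t, i, a, hv, ht⟩

theorem dt_eq_dt (h : A.IsCapFrame P k ℓ) (h0 : A.lev v₀ = 0) {t t' : DartKind} {i i' : ℕ}
    {a a' : ℤ} (ha : Valid ℓ i a) (ha' : Valid ℓ i' a') :
    A.dt ℓ v₀ t i a = A.dt ℓ v₀ t' i' a' ↔ t = t' ∧ i = i' ∧ (2 * k : ℤ) ∣ a - a' := by
  constructor
  · intro he
    have hv := congrArg (fun d => d.fst) he
    simp only [fst_dt] at hv
    have hi : i = i' := by
      have h1 := h.lev_vt h0 ha.1 a
      rw [hv, h.lev_vt h0 ha'.1] at h1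
      exact_mod_cast h1.symm
    subst hi
    refine ⟨?_, rfl, (h.vt_eq_vt h0 ha ha').1 hv⟩
    have hs := congrArg (fun d => d.snd) he
    have e1 := A.inv_ne_nx (A.vt ℓ v₀ i a')
    have e2 := A.rung_ne_nx (A.vt ℓ v₀ i a')
    have e3 := A.rung_ne_inv (A.vt ℓ v₀ i a')
    rcases t with _ | _ | _ <;> rcases t' with _ | _ | _ <;>
      simp only [dt, fw, bw, rg, hv] at hs ⊢
    all_goals
      have := (Prod.ext_iff.1 (congrArg (fun d => d.toProd) he)).2
      simp only [dt, fw, bw, rg, hv] at this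
      tauto
  · rintro ⟨rfl, rfl, hd⟩
    have := (h.vt_eq_vt h0 ha ha').2 hd
    cases t <;> simp only [dt, this]

theorem left_iff (h : A.IsCapFrame P k ℓ) (h0 : A.lev v₀ = 0) {i : ℕ} {a : ℤ} (hv : Valid ℓ i a) :
    A.Left P (A.vt ℓ v₀ i a) ↔ (a - i) % 2 = 1 := by
  rw [h.oriented, h.up_vt h0 hv]
  omega

variable {i j : ℕ} {a b : ℤ}

theorem rev_fwd (h : A.IsCapFrame P k ℓ) (hi : i ≤ ℓ + 1) (hb : b = a + step ℓ i) :
    P.map.rev (A.dt ℓ v₀ .fwd i a) = A.dt ℓ v₀ .bwd i b := by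
  simp only [dt]
  rw [P.rev_eq, A.symm_fw, h.nx_vt i hi, hb]

theorem rev_bwd (h : A.IsCapFrame P k ℓ) (hi : i ≤ ℓ + 1) (hb : b = a - step ℓ i) :
    P.map.rev (A.dt ℓ v₀ .bwd i a) = A.dt ℓ v₀ .fwd i b := by
  simp only [dt]
  rw [P.rev_eq, A.symm_bw, h.inv_vt i hi, hb]

theorem rev_rung (h : A.IsCapFrame P k ℓ) (h0 : A.lev v₀ = 0) (hi : i ≤ ℓ) (hj : j = i + 1)
    (hb : b = a) (ha : (a - i) % 2 = 0) :
    P.map.rev (A.dt ℓ v₀ .rung i a) = A.dt ℓ v₀ .rung j b := by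
  subst hj hb
  simp only [dt]
  rw [P.rev_eq, A.symm_rg, h.rung_vt h0 hi ha]

theorem rev_rung_succ (h : A.IsCapFrame P k ℓ) (h0 : A.lev v₀ = 0) (hi : i ≤ ℓ) (hj : j = i + 1)
    (hb : b = a) (ha : (a - i) % 2 = 0) :
    P.map.rev (A.dt ℓ v₀ .rung j a) = A.dt ℓ v₀ .rung i b := by
  subst hj hb
  simp only [dt]
  rw [P.rev_eq, A.symm_rg, h.rung_vt' h0 hi ha]

theorem face_fwd (h : A.IsCapFrame P k ℓ) (h0 : A.lev v₀ = 0) (hv : Valid ℓ i a)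
    (hb : b = a + step ℓ i) (hu : (b - i) % 2 = 0) :
    P.map.face (A.dt ℓ v₀ .fwd i a) = A.dt ℓ v₀ .fwd i b := by
  simp only [dt]
  rw [face_fw_of_not_left, h.nx_vt i hv.1, hb]
  rw [h.nx_vt i hv.1, h.left_iff h0 hv.add_step]
  omega

theorem face_fwd_rung (h : A.IsCapFrame P k ℓ) (h0 : A.lev v₀ = 0) (hv : Valid ℓ i a)
    (hb : b = a + step ℓ i) (hu : (b - i) % 2 = 1) :
    P.map.face (A.dt ℓ v₀ .fwd i a) = A.dt ℓ v₀ .rung i b := by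
  simp only [dt]
  rw [face_fw_of_left, h.nx_vt i hv.1, hb]
  rw [h.nx_vt i hv.1, h.left_iff h0 hv.add_step]
  omega

theorem face_bwd_rung (h : A.IsCapFrame P k ℓ) (h0 : A.lev v₀ = 0) (hv : Valid ℓ i a)
    (hb : b = a - step ℓ i) (hu : (b - i) % 2 = 0) :
    P.map.face (A.dt ℓ v₀ .bwd i a) = A.dt ℓ v₀ .rung i b := by
  simp only [dt]
  rw [face_bw_of_not_left, h.inv_vt i hv.1, hb]
  rw [h.inv_vt i hv.1, h.left_iff h0 hv.sub_step]
  omega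

theorem face_bwd (h : A.IsCapFrame P k ℓ) (h0 : A.lev v₀ = 0) (hv : Valid ℓ i a)
    (hb : b = a - step ℓ i) (hu : (b - i) % 2 = 1) :
    P.map.face (A.dt ℓ v₀ .bwd i a) = A.dt ℓ v₀ .bwd i b := by
  simp only [dt]
  rw [face_bw_of_left, h.inv_vt i hv.1, hb]
  rw [h.inv_vt i hv.1, h.left_iff h0 hv.sub_step]
  omega

theorem face_rung (h : A.IsCapFrame P k ℓ) (h0 : A.lev v₀ = 0) (hi : i ≤ ℓ) (hj : j = i + 1)
    (hb : b = a) (ha : (a - i) % 2 = 0) :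
    P.map.face (A.dt ℓ v₀ .rung i a) = A.dt ℓ v₀ .fwd j b := by
  subst hj hb
  simp only [dt]
  rw [face_rg_of_left, h.rung_vt h0 hi ha]
  rw [h.rung_vt h0 hi ha, h.left_iff h0 ⟨by omega, by omega, by omega⟩]
  push_cast
  omega

theorem face_rung_succ (h : A.IsCapFrame P k ℓ) (h0 : A.lev v₀ = 0) (hi : i ≤ ℓ) (hj : j = i + 1)
    (hb : b = a) (ha : (a - i) % 2 = 0) :
    P.map.face (A.dt ℓ v₀ .rung j a) = A.dt ℓ v₀ .bwd i b := by
  subst hj hb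
  simp only [dt]
  rw [face_rg_of_not_left, h.rung_vt' h0 hi ha]
  rw [h.rung_vt' h0 hi ha, h.left_iff h0 ⟨by omega, by omega, by omega⟩]
  omega

end IsCapFrame

end LevelFrame


/-! ### Rows and columns for the vertices of the leapfrog -/

namespace LevelFrame

variable {V : Type*} {F : SimpleGraph V} {A : LevelFrame F} {P : PlaneEmbedding F} {k ℓ : ℕ}
  {v₀ : V}

/-- the circle of the leapfrog, counted outwards, on which the triangle of a dart lies -/
def row : DartKind → ℕ → ℤ → ℕ
  | .fwd, i, _ => (3 * i + 1) / 2
  | .bwd, i, _ => (3 * i + 2) / 2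
  | .rung, i, a => if (a - i) % 2 = 0 then (3 * i + 3) / 2 else 3 * i / 2

/-- the angle, in units of `π / (2 * k)`, of the triangle of a dart -/
def col : DartKind → ℕ → ℤ → ℤ
  | .fwd, i, a => if (a - i) % 2 = 0 then 2 * a else 2 * a + 1
  | .bwd, i, a => if (a - i) % 2 = 0 then 2 * a - 2 else 2 * a - 1
  | .rung, i, a => if (a - i) % 2 = 0 then 2 * a else 2 * a - 1

/-- the dart whose triangle is on circle `r` at the angle `x` -/
def node (A : LevelFrame F) (ℓ : ℕ) (v₀ : V) : ℕ → ℤ → F.Dart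
  | 0, x => A.dt ℓ v₀ .fwd 0 (2 * (x / 4))
  | r + 1, x =>
    if r % 3 = 0 then
      if x % 4 = 0 then A.dt ℓ v₀ .rung (2 * (r / 3)) (2 * (x / 4))
      else if x % 4 = 1 then A.dt ℓ v₀ .bwd (2 * (r / 3)) (2 * (x / 4) + 1)
      else if x % 4 = 2 then A.dt ℓ v₀ .bwd (2 * (r / 3)) (2 * (x / 4) + 2)
      else A.dt ℓ v₀ .rung (2 * (r / 3) + 1) (2 * (x / 4) + 2)
    else if r % 3 = 1 then
      if x % 4 = 0 then A.dt ℓ v₀ .bwd (2 * (r / 3) + 1) (2 * (x / 4) + 1)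
      else if x % 4 = 1 then A.dt ℓ v₀ .fwd (2 * (r / 3) + 1) (2 * (x / 4))
      else if x % 4 = 2 then A.dt ℓ v₀ .fwd (2 * (r / 3) + 1) (2 * (x / 4) + 1)
      else A.dt ℓ v₀ .bwd (2 * (r / 3) + 1) (2 * (x / 4) + 2)
    else
      if x % 4 = 0 then A.dt ℓ v₀ .fwd (2 * (r / 3) + 2) (2 * (x / 4))
      else if x % 4 = 1 then A.dt ℓ v₀ .rung (2 * (r / 3) + 2) (2 * (x / 4) + 1)
      else if x % 4 = 2 then A.dt ℓ v₀ .rung (2 * (r / 3) + 1) (2 * (x / 4) + 1)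
      else A.dt ℓ v₀ .fwd (2 * (r / 3) + 2) (2 * (x / 4) + 1)

variable {r s : ℕ} {x m : ℤ}

theorem node_zero (hx : x = 4 * m) : A.node ℓ v₀ 0 x = A.dt ℓ v₀ .fwd 0 (2 * m) := by
  rw [node, show x / 4 = m by omega]

theorem node_one_zero (hr : r = 3 * s + 1) (hx : x = 4 * m) :
    A.node ℓ v₀ r x = A.dt ℓ v₀ .rung (2 * s) (2 * m) := by
  subst hr
  have h1 : (3 * s) % 3 = 0 := by omega
  have h2 : (3 * s) / 3 = s := by omega
  have h3 : x % 4 = 0 := by omega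
  have h4 : x / 4 = m := by omega
  simp only [node, h1, h2, h3, h4]
  norm_num

theorem node_one_one (hr : r = 3 * s + 1) (hx : x = 4 * m + 1) :
    A.node ℓ v₀ r x = A.dt ℓ v₀ .bwd (2 * s) (2 * m + 1) := by
  subst hr
  have h1 : (3 * s) % 3 = 0 := by omega
  have h2 : (3 * s) / 3 = s := by omega
  have h3 : x % 4 = 1 := by omega
  have h4 : x / 4 = m := by omega
  simp only [node, h1, h2, h3, h4]
  norm_num

theorem node_one_two (hr : r = 3 * s + 1) (hx : x = 4 * m + 2) :
    A.node ℓ v₀ r x = A.dt ℓ v₀ .bwd (2 * s) (2 * m + 2) := by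
  subst hr
  have h1 : (3 * s) % 3 = 0 := by omega
  have h2 : (3 * s) / 3 = s := by omega
  have h3 : x % 4 = 2 := by omega
  have h4 : x / 4 = m := by omega
  simp only [node, h1, h2, h3, h4]
  norm_num

theorem node_one_three (hr : r = 3 * s + 1) (hx : x = 4 * m + 3) :
    A.node ℓ v₀ r x = A.dt ℓ v₀ .rung (2 * s + 1) (2 * m + 2) := by
  subst hr
  have h1 : (3 * s) % 3 = 0 := by omega
  have h2 : (3 * s) / 3 = s := by omega
  have h3 : x % 4 = 3 := by omega
  have h4 : x / 4 = m := by omega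
  simp only [node, h1, h2, h3, h4]
  norm_num

theorem node_two_zero (hr : r = 3 * s + 2) (hx : x = 4 * m) :
    A.node ℓ v₀ r x = A.dt ℓ v₀ .bwd (2 * s + 1) (2 * m + 1) := by
  subst hr
  have h1 : (3 * s + 1) % 3 = 1 := by omega
  have h2 : (3 * s + 1) / 3 = s := by omega
  have h3 : x % 4 = 0 := by omega
  have h4 : x / 4 = m := by omega
  simp only [node, h1, h2, h3, h4]
  norm_num

theorem node_two_one (hr : r = 3 * s + 2) (hx : x = 4 * m + 1) :
    A.node ℓ v₀ r x = A.dt ℓ v₀ .fwd (2 * s + 1) (2 * m) := by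
  subst hr
  have h1 : (3 * s + 1) % 3 = 1 := by omega
  have h2 : (3 * s + 1) / 3 = s := by omega
  have h3 : x % 4 = 1 := by omega
  have h4 : x / 4 = m := by omega
  simp only [node, h1, h2, h3, h4]
  norm_num

theorem node_two_two (hr : r = 3 * s + 2) (hx : x = 4 * m + 2) :
    A.node ℓ v₀ r x = A.dt ℓ v₀ .fwd (2 * s + 1) (2 * m + 1) := by
  subst hr
  have h1 : (3 * s + 1) % 3 = 1 := by omega
  have h2 : (3 * s + 1) / 3 = s := by omega
  have h3 : x % 4 = 2 := by omega
  have h4 : x / 4 = m := by omega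
  simp only [node, h1, h2, h3, h4]
  norm_num

theorem node_two_three (hr : r = 3 * s + 2) (hx : x = 4 * m + 3) :
    A.node ℓ v₀ r x = A.dt ℓ v₀ .bwd (2 * s + 1) (2 * m + 2) := by
  subst hr
  have h1 : (3 * s + 1) % 3 = 1 := by omega
  have h2 : (3 * s + 1) / 3 = s := by omega
  have h3 : x % 4 = 3 := by omega
  have h4 : x / 4 = m := by omega
  simp only [node, h1, h2, h3, h4]
  norm_num

theorem node_three_zero (hr : r = 3 * s + 3) (hx : x = 4 * m) :
    A.node ℓ v₀ r x = A.dt ℓ v₀ .fwd (2 * s + 2) (2 * m) := by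
  subst hr
  have h1 : (3 * s + 2) % 3 = 2 := by omega
  have h2 : (3 * s + 2) / 3 = s := by omega
  have h3 : x % 4 = 0 := by omega
  have h4 : x / 4 = m := by omega
  simp only [node, h1, h2, h3, h4]
  norm_num

theorem node_three_one (hr : r = 3 * s + 3) (hx : x = 4 * m + 1) :
    A.node ℓ v₀ r x = A.dt ℓ v₀ .rung (2 * s + 2) (2 * m + 1) := by
  subst hr
  have h1 : (3 * s + 2) % 3 = 2 := by omega
  have h2 : (3 * s + 2) / 3 = s := by omega
  have h3 : x % 4 = 1 := by omega
  have h4 : x / 4 = m := by omega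
  simp only [node, h1, h2, h3, h4]
  norm_num

theorem node_three_two (hr : r = 3 * s + 3) (hx : x = 4 * m + 2) :
    A.node ℓ v₀ r x = A.dt ℓ v₀ .rung (2 * s + 1) (2 * m + 1) := by
  subst hr
  have h1 : (3 * s + 2) % 3 = 2 := by omega
  have h2 : (3 * s + 2) / 3 = s := by omega
  have h3 : x % 4 = 2 := by omega
  have h4 : x / 4 = m := by omega
  simp only [node, h1, h2, h3, h4]
  norm_num

theorem node_three_three (hr : r = 3 * s + 3) (hx : x = 4 * m + 3) :
    A.node ℓ v₀ r x = A.dt ℓ v₀ .fwd (2 * s + 2) (2 * m + 1) := by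
  subst hr
  have h1 : (3 * s + 2) % 3 = 2 := by omega
  have h2 : (3 * s + 2) / 3 = s := by omega
  have h3 : x % 4 = 3 := by omega
  have h4 : x / 4 = m := by omega
  simp only [node, h1, h2, h3, h4]
  norm_num

/-- The pattern repeats after two levels, three rows and four columns, so there are twelve cases:
the kind of the dart and the parities of `i` and `a`. Row `0` is the exception, holding only the
forward darts of level `0`. -/
theorem node_row_col {t : DartKind} {i : ℕ} {a : ℤ} (hv : Valid ℓ i a) :
    A.node ℓ v₀ (row t i a) (col t i a) = A.dt ℓ v₀ t i a := by
  obtain ⟨h1, h2, h3⟩ := hv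
  have dc : ∀ {t : DartKind} {i j : ℕ} {a b : ℤ}, i = j → a = b →
      A.dt ℓ v₀ t i a = A.dt ℓ v₀ t j b := by rintro t i _ a _ rfl rfl; rfl
  obtain ⟨s, hs | hs⟩ := i.even_or_odd' <;> obtain ⟨m, hm | hm⟩ := a.even_or_odd' <;>
    rcases t with _ | _ | _ <;> simp only [row, col]
  · rcases s.eq_zero_or_pos with rfl | hpos
    · subst hs
      exact (node_zero (m := m) (by split_ifs <;> omega)).trans (dc (by omega) (by omega))
    · exact (node_three_zero (s := s - 1) (m := m) (by omega) (by split_ifs <;> omega)).trans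
        (dc (by omega) (by omega))
  · exact (node_one_two (s := s) (m := m - 1) (by omega) (by split_ifs <;> omega)).trans
      (dc (by omega) (by omega))
  · exact (node_one_zero (s := s) (m := m) (by split_ifs <;> omega) (by split_ifs <;> omega)).trans
      (dc (by omega) (by omega))
  · exact (node_three_three (s := s - 1) (m := m) (by omega) (by split_ifs <;> omega)).trans
      (dc (by omega) (by omega))
  · exact (node_one_one (s := s) (m := m) (by omega) (by split_ifs <;> omega)).trans
      (dc (by omega) (by omega))
  · exact (node_three_one (s := s - 1) (m := m) (by split_ifs <;> omega)
        (by split_ifs <;> omega)).trans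
      (dc (by omega) (by omega))
  · exact (node_two_one (s := s) (m := m) (by omega) (by split_ifs <;> omega)).trans
      (dc (by omega) (by omega))
  · exact (node_two_three (s := s) (m := m - 1) (by omega) (by split_ifs <;> omega)).trans
      (dc (by omega) (by omega))
  · exact (node_one_three (s := s) (m := m - 1) (by split_ifs <;> omega)
        (by split_ifs <;> omega)).trans
      (dc (by omega) (by omega))
  · exact (node_two_two (s := s) (m := m) (by omega) (by split_ifs <;> omega)).trans
      (dc (by omega) (by omega))
  · exact (node_two_zero (s := s) (m := m) (by omega) (by split_ifs <;> omega)).trans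
      (dc (by omega) (by omega))
  · exact (node_three_two (s := s) (m := m) (by split_ifs <;> omega) (by split_ifs <;> omega)).trans
      (dc (by omega) (by omega))

/-- the positions of the vertices of the leapfrog that are on the circles -/
def OnCircle (ℓ : ℕ) (r : ℕ) (x : ℤ) : Prop :=
  r ≤ 3 * ((ℓ + 1) / 2) + 1 ∧ (r = 0 → x % 4 = 0) ∧ (r = 1 → x % 4 ≠ 1) ∧
    (ℓ % 2 = 1 → r = 3 * ((ℓ + 1) / 2) → x % 4 ≠ 0) ∧
    (ℓ % 2 = 1 → r = 3 * ((ℓ + 1) / 2) + 1 → x % 4 = 1)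

theorem Valid.onCircle {t : DartKind} {i : ℕ} {a : ℤ} (hv : Valid ℓ i a)
    (hr : row t i a ≤ 3 * ((ℓ + 1) / 2) + 1) : OnCircle ℓ (row t i a) (col t i a) := by
  obtain ⟨h1, h2, h3⟩ := hv
  rcases t with _ | _ | _ <;> simp only [row, col] at hr ⊢ <;> split_ifs at hr ⊢ <;>
    refine ⟨?_, ?_, ?_, ?_, ?_⟩ <;> omega

theorem OnCircle.exists_dt (hx : OnCircle ℓ r x) : ∃ t i a, Valid ℓ i a ∧ row t i a = r ∧
    col t i a = x ∧ A.node ℓ v₀ r x = A.dt ℓ v₀ t i a := by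
  suffices ∃ t i a, Valid ℓ i a ∧ row t i a = r ∧ col t i a = x by
    obtain ⟨t, i, a, hv, h1, h2⟩ := this
    refine ⟨t, i, a, hv, h1, h2, ?_⟩
    rw [← node_row_col hv, h1, h2]
  obtain ⟨h1, h2, h3, h4, h5⟩ := hx
  obtain ⟨m, hm⟩ : ∃ m, m = x / 4 := ⟨_, rfl⟩
  rcases r.eq_zero_or_pos with rfl | hpos
  · refine ⟨.fwd, 0, 2 * m, ⟨by omega, by omega, by omega⟩, by simp only [row], ?_⟩
    simp only [col]
    split_ifs <;> omega
  have hu : x % 4 = 0 ∨ x % 4 = 1 ∨ x % 4 = 2 ∨ x % 4 = 3 := by omega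
  obtain ⟨s, hs | hs | hs⟩ : ∃ s, r = 3 * s + 1 ∨ r = 3 * s + 2 ∨ r = 3 * s + 3 :=
    ⟨(r - 1) / 3, by omega⟩ <;> rcases hu with hu | hu | hu | hu
  · refine ⟨.rung, 2 * s, 2 * m,
        ⟨by omega, by omega, by omega⟩, ?_, ?_⟩ <;> simp only [row, col] <;>
      (try split_ifs) <;> omega
  · refine ⟨.bwd, 2 * s, 2 * m + 1,
        ⟨by omega, by omega, by omega⟩, ?_, ?_⟩ <;> simp only [row, col] <;>
      (try split_ifs) <;> omega
  · refine ⟨.bwd, 2 * s, 2 * m + 2,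
        ⟨by omega, by omega, by omega⟩, ?_, ?_⟩ <;> simp only [row, col] <;>
      (try split_ifs) <;> omega
  · refine ⟨.rung, 2 * s + 1, 2 * m + 2,
        ⟨by omega, by omega, by omega⟩, ?_, ?_⟩ <;> simp only [row, col] <;>
      (try split_ifs) <;> omega
  · refine ⟨.bwd, 2 * s + 1, 2 * m + 1,
        ⟨by omega, by omega, by omega⟩, ?_, ?_⟩ <;> simp only [row, col] <;>
      (try split_ifs) <;> omega
  · refine ⟨.fwd, 2 * s + 1, 2 * m,
        ⟨by omega, by omega, by omega⟩, ?_, ?_⟩ <;> simp only [row, col] <;>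
      (try split_ifs) <;> omega
  · refine ⟨.fwd, 2 * s + 1, 2 * m + 1,
        ⟨by omega, by omega, by omega⟩, ?_, ?_⟩ <;> simp only [row, col] <;>
      (try split_ifs) <;> omega
  · refine ⟨.bwd, 2 * s + 1, 2 * m + 2,
        ⟨by omega, by omega, by omega⟩, ?_, ?_⟩ <;> simp only [row, col] <;>
      (try split_ifs) <;> omega
  · refine ⟨.fwd, 2 * s + 2, 2 * m,
        ⟨by omega, by omega, by omega⟩, ?_, ?_⟩ <;> simp only [row, col] <;>
      (try split_ifs) <;> omega
  · refine ⟨.rung, 2 * s + 2, 2 * m + 1,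
        ⟨by omega, by omega, by omega⟩, ?_, ?_⟩ <;> simp only [row, col] <;>
      (try split_ifs) <;> omega
  · refine ⟨.rung, 2 * s + 1, 2 * m + 1,
        ⟨by omega, by omega, by omega⟩, ?_, ?_⟩ <;> simp only [row, col] <;>
      (try split_ifs) <;> omega
  · refine ⟨.fwd, 2 * s + 2, 2 * m + 1,
        ⟨by omega, by omega, by omega⟩, ?_, ?_⟩ <;> simp only [row, col] <;>
      (try split_ifs) <;> omega

/-- The row depends on the angle only through a parity, and the column is twice the angle plus a
term that depends on this parity. So the period `2k` of the angle becomes `4k`. -/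
theorem IsCapFrame.row_col_of_dt_eq (h : A.IsCapFrame P k ℓ) (h0 : A.lev v₀ = 0) {t t' : DartKind}
    {i i' : ℕ} {a a' : ℤ} (ha : Valid ℓ i a) (ha' : Valid ℓ i' a')
    (he : A.dt ℓ v₀ t i a = A.dt ℓ v₀ t' i' a') :
    row t i a = row t' i' a' ∧ (4 * k : ℤ) ∣ col t i a - col t' i' a' := by
  obtain ⟨rfl, rfl, c, hc⟩ := (h.dt_eq_dt h0 ha ha').1 he
  have h1 : a - a' = 2 * (k * c) := by rw [hc]; ring
  have h2 : (a - i) % 2 = (a' - i) % 2 := by omega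
  have h3 : (4 * k : ℤ) ∣ 2 * (a - a') := ⟨c, by rw [hc]; ring⟩
  rcases t with _ | _ | _ <;> simp only [row, col, h2, true_and]
  all_goals
    split_ifs
    all_goals convert h3 using 1; ring

theorem IsCapFrame.node_eq_node (h : A.IsCapFrame P k ℓ) (h0 : A.lev v₀ = 0) {r r' : ℕ}
    {x x' : ℤ} (hx : OnCircle ℓ r x) (hx' : OnCircle ℓ r' x') :
    A.node ℓ v₀ r x = A.node ℓ v₀ r' x' ↔ r = r' ∧ (4 * k : ℤ) ∣ x - x' := by
  obtain ⟨t, i, a, hv, h1, h2, h3⟩ := hx.exists_dt (A := A) (v₀ := v₀)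
  obtain ⟨t', i', a', hv', h1', h2', h3'⟩ := hx'.exists_dt (A := A) (v₀ := v₀)
  constructor
  · intro he
    rw [h3, h3'] at he
    have := h.row_col_of_dt_eq h0 hv hv' he
    rwa [h1, h2, h1', h2'] at this
  · rintro ⟨rfl, c, hc⟩
    have hc' : x = x' + 4 * (k * c) := by linarith
    have hcol : A.node ℓ v₀ r x = A.dt ℓ v₀ t' i' (a' + 2 * (k * c)) := by
      have e1 : row t' i' (a' + 2 * (k * c)) = r := by
        rw [← h1']
        rcases t' with _ | _ | _ <;> simp only [row]
        split_ifs <;> omega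
      have e2 : col t' i' (a' + 2 * (k * c)) = x := by
        rw [hc', ← h2']
        rcases t' with _ | _ | _ <;> simp only [col] <;> split_ifs <;> omega
      obtain ⟨w1, w2, w3⟩ := hv'
      rw [← e1, ← e2, node_row_col ⟨w1, by omega, by omega⟩]
    rw [hcol, h3', h.dt_eq_dt h0 _ hv']
    · exact ⟨rfl, rfl, c, by ring⟩
    · obtain ⟨w1, w2, w3⟩ := hv'
      exact ⟨w1, by omega, by omega⟩

end LevelFrame


/-! ### The local structure of each row -/

namespace LevelFrame

variable {V : Type*} {F : SimpleGraph V} {A : LevelFrame F} {P : PlaneEmbedding F} {k ℓ : ℕ}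
  {v₀ : V}

/-- the next angle on a circle of the leapfrog -/
def next (ℓ : ℕ) (r : ℕ) (x : ℤ) : ℤ :=
  if r = 0 ∨ ℓ % 2 = 1 ∧ r = 3 * ((ℓ + 1) / 2) + 1 then x + 4
  else if r = 1 ∧ x % 4 = 0 ∨ ℓ % 2 = 1 ∧ r = 3 * ((ℓ + 1) / 2) ∧ x % 4 = 3 then x + 2 else x + 1

/-- the previous angle on a circle of the leapfrog -/
def prev (ℓ : ℕ) (r : ℕ) (x : ℤ) : ℤ :=
  if r = 0 ∨ ℓ % 2 = 1 ∧ r = 3 * ((ℓ + 1) / 2) + 1 then x - 4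
  else if r = 1 ∧ x % 4 = 2 ∨ ℓ % 2 = 1 ∧ r = 3 * ((ℓ + 1) / 2) ∧ x % 4 = 1 then x - 2 else x - 1

/-- The next neighbours of a vertex on its circle, and the third neighbour, which is outside or
inside the circle. -/
def HasTurn (A : LevelFrame F) (hP : P.IsFullerene) (ℓ : ℕ) (v₀ : V) (r : ℕ) (x : ℤ) : Prop :=
  ∃ t i a, Valid ℓ i a ∧
    (row t i a = r + 1 ∧ hP.leapfrogEmbedding.Turn (P.map.triangle (A.node ℓ v₀ r x))
        (P.map.triangle (A.node ℓ v₀ r (next ℓ r x)))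
        (P.map.triangle (A.node ℓ v₀ r (prev ℓ r x))) (P.map.triangle (A.dt ℓ v₀ t i a)) ∨
      row t i a + 1 = r ∧ hP.leapfrogEmbedding.Turn (P.map.triangle (A.node ℓ v₀ r x))
        (P.map.triangle (A.node ℓ v₀ r (next ℓ r x))) (P.map.triangle (A.dt ℓ v₀ t i a))
        (P.map.triangle (A.node ℓ v₀ r (prev ℓ r x))))

-- Here and in the next three lemmas the neighbours are read off from `turn_triangle` by the rules
-- for `rev` and `face`, for each residue of the row modulo `3` and of the column modulo `4`. Cases
-- split further where a cap is involved, since there the angle moves by two.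
set_option maxHeartbeats 1000000 in
theorem OnCircle.hasTurn_zero (h : A.IsCapFrame P k ℓ) (h0 : A.lev v₀ = 0) (hP : P.IsFullerene)
    {r : ℕ} {x : ℤ} (hx : OnCircle ℓ r x) (hs : r = 0) :
    A.HasTurn hP ℓ v₀ r x := by
  have hone := h.one_le
  obtain ⟨h1, h2, h3, h4, h5⟩ := hx
  have hnext : next ℓ r x = next ℓ r x := rfl
  have hprev : prev ℓ r x = prev ℓ r x := rfl
  conv_rhs at hnext => unfold next
  conv_rhs at hprev => unfold prev
  obtain ⟨m, hm⟩ : ∃ m, m = x / 4 := ⟨_, rfl⟩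
  have hs0 : step ℓ 0 = 2 := step_cap (.inl rfl)
  have hsl : step ℓ (ℓ + 1) = 2 := step_cap (.inr rfl)
  have hs1 : ∀ i, 0 < i → i ≤ ℓ → step ℓ i = 1 := fun i => step_mid
  subst hs
  have e0 := h2 rfl
  have en : next ℓ 0 x = x + 4 := by rw [hnext, if_pos (.inl rfl)]
  have ep : prev ℓ 0 x = x - 4 := by rw [hprev, if_pos (.inl rfl)]
  refine ⟨.bwd, 0, 2 * m + 2, ⟨by omega, by omega, by omega⟩, .inl ⟨by simp only [row], ?_⟩⟩
  rw [en, ep, node_zero (m := m) (by omega), node_zero (m := m + 1) (by omega), node_zero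
      (m := m - 1) (by omega)]
  exact PlaneEmbedding.Turn.rotate (hP.turn_triangle (h.rev_fwd (by omega) (by omega))
      (h.face_fwd h0 ⟨by omega, by omega, by omega⟩ (by omega) (by omega))
    (h.face_fwd h0 ⟨by omega, by omega, by omega⟩ (by omega) (by omega)))

set_option maxHeartbeats 1000000 in
theorem OnCircle.hasTurn_one (h : A.IsCapFrame P k ℓ) (h0 : A.lev v₀ = 0) (hP : P.IsFullerene)
    {r s : ℕ} {x : ℤ} (hx : OnCircle ℓ r x) (hs : r = 3 * s + 1) :
    A.HasTurn hP ℓ v₀ r x := by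
  have hone := h.one_le
  obtain ⟨h1, h2, h3, h4, h5⟩ := hx
  have hnext : next ℓ r x = next ℓ r x := rfl
  have hprev : prev ℓ r x = prev ℓ r x := rfl
  conv_rhs at hnext => unfold next
  conv_rhs at hprev => unfold prev
  obtain ⟨m, hm⟩ : ∃ m, m = x / 4 := ⟨_, rfl⟩
  have hs0 : step ℓ 0 = 2 := step_cap (.inl rfl)
  have hsl : step ℓ (ℓ + 1) = 2 := step_cap (.inr rfl)
  have hs1 : ∀ i, 0 < i → i ≤ ℓ → step ℓ i = 1 := fun i => step_mid
  rcases (show x % 4 = 0 ∨ x % 4 = 1 ∨ x % 4 = 2 ∨ x % 4 = 3 by omega) with hu | hu | hu | hu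
  · rcases s.eq_zero_or_pos.symm with hpos | rfl
    · have hst := hs1 (2 * s) (by omega) (by omega)
      have en : next ℓ r x = x + 1 := by rw [hnext]; split_ifs <;> omega
      have ep : prev ℓ r x = x - 1 := by rw [hprev]; split_ifs <;> omega
      refine ⟨.fwd, 2 * s + 1, 2 * m, ⟨by omega, by omega, by omega⟩, .inl ⟨?_, ?_⟩⟩
      · simp only [row]
        omega
      · rw [en, ep, node_one_zero (s := s) (m := m) (by omega) (by omega),
          node_one_one (s := s) (m := m) (by omega) (by omega),
          node_one_three (s := s) (m := m - 1) (by omega) (by omega)]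
        exact PlaneEmbedding.Turn.rotate' (hP.turn_triangle (h.rev_rung h0 (by omega) (by omega)
            (by omega) (by omega)) (h.face_rung h0 (by omega) (by omega) (by omega) (by omega))
          (h.face_bwd_rung h0 ⟨by omega, by omega, by omega⟩ (by omega) (by omega)))
    · have hst : step ℓ (2 * 0) = 2 := hs0
      have en : next ℓ r x = x + 2 := by rw [hnext]; split_ifs <;> omega
      have ep : prev ℓ r x = x - 1 := by rw [hprev]; split_ifs <;> omega
      refine ⟨.fwd, 1, 2 * m, ⟨by omega, by omega, by omega⟩, .inl ⟨?_, ?_⟩⟩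
      · simp only [row]
        omega
      · rw [en, ep, node_one_zero (s := 0) (m := m) (by omega) (by omega),
          node_one_two (s := 0) (m := m) (by omega) (by omega),
          node_one_three (s := 0) (m := m - 1) (by omega) (by omega)]
        exact PlaneEmbedding.Turn.rotate' (hP.turn_triangle (h.rev_rung h0 (by omega) (by omega)
            (by omega) (by omega)) (h.face_rung h0 (by omega) (by omega) (by omega) (by omega))
          (h.face_bwd_rung h0 ⟨by omega, by omega, by omega⟩ (by omega) (by omega)))
  -- The second alternative is the outermost circle for odd `ℓ`, with one vertex in every four
  -- columns.
  · rcases (show 2 * s ≤ ℓ ∨ 2 * s = ℓ + 1 by omega) with hle | hle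
    · have hst := hs1 (2 * s) (by omega) (by omega)
      have en : next ℓ r x = x + 1 := by rw [hnext]; split_ifs <;> omega
      have ep : prev ℓ r x = x - 1 := by rw [hprev]; split_ifs <;> omega
      refine ⟨.fwd, 2 * s, 2 * m, ⟨by omega, by omega, by omega⟩, .inr ⟨?_, ?_⟩⟩
      · simp only [row]
        omega
      · rw [en, ep, node_one_one (s := s) (m := m) (by omega) (by omega),
          node_one_two (s := s) (m := m) (by omega) (by omega),
          node_one_zero (s := s) (m := m) (by omega) (by omega)]
        exact PlaneEmbedding.Turn.rotate' (hP.turn_triangle (h.rev_bwd (by omega) (by omega))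
            (h.face_bwd_rung h0 ⟨by omega, by omega, by omega⟩ (by omega) (by omega))
          (h.face_bwd h0 ⟨by omega, by omega, by omega⟩ (by omega) (by omega)))
    · have hst : step ℓ (2 * s) = 2 := hle ▸ hsl
      have en : next ℓ r x = x + 4 := by rw [hnext]; split_ifs <;> omega
      have ep : prev ℓ r x = x - 4 := by rw [hprev]; split_ifs <;> omega
      refine ⟨.fwd, 2 * s, 2 * m - 1, ⟨by omega, by omega, by omega⟩, .inr ⟨?_, ?_⟩⟩
      · simp only [row]
        omega
      · rw [en, ep, node_one_one (s := s) (m := m) (by omega) (by omega),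
          node_one_one (s := s) (m := m + 1) (by omega) (by omega),
          node_one_one (s := s) (m := m - 1) (by omega) (by omega)]
        exact PlaneEmbedding.Turn.rotate' (hP.turn_triangle (h.rev_bwd (by omega) (by omega))
            (h.face_bwd h0 ⟨by omega, by omega, by omega⟩ (by omega) (by omega))
          (h.face_bwd h0 ⟨by omega, by omega, by omega⟩ (by omega) (by omega)))
  · rcases s.eq_zero_or_pos.symm with hpos | rfl
    · have hst := hs1 (2 * s) (by omega) (by omega)
      have en : next ℓ r x = x + 1 := by rw [hnext]; split_ifs <;> omega
      have ep : prev ℓ r x = x - 1 := by rw [hprev]; split_ifs <;> omega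
      refine ⟨.fwd, 2 * s, 2 * m + 1, ⟨by omega, by omega, by omega⟩, .inr ⟨?_, ?_⟩⟩
      · simp only [row]
        omega
      · rw [en, ep, node_one_two (s := s) (m := m) (by omega) (by omega),
          node_one_three (s := s) (m := m) (by omega) (by omega),
          node_one_one (s := s) (m := m) (by omega) (by omega)]
        exact PlaneEmbedding.Turn.rotate' (hP.turn_triangle (h.rev_bwd (by omega) (by omega))
            (h.face_bwd h0 ⟨by omega, by omega, by omega⟩ (by omega) (by omega))
          (h.face_rung_succ h0 (by omega) (by omega) (by omega) (by omega)))
    · have hst : step ℓ (2 * 0) = 2 := hs0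
      have en : next ℓ r x = x + 1 := by rw [hnext]; split_ifs <;> omega
      have ep : prev ℓ r x = x - 2 := by rw [hprev]; split_ifs <;> omega
      refine ⟨.fwd, 0, 2 * m, ⟨by omega, by omega, by omega⟩, .inr ⟨?_, ?_⟩⟩
      · simp only [row]
        omega
      · rw [en, ep, node_one_two (s := 0) (m := m) (by omega) (by omega),
          node_one_three (s := 0) (m := m) (by omega) (by omega),
          node_one_zero (s := 0) (m := m) (by omega) (by omega)]
        exact PlaneEmbedding.Turn.rotate' (hP.turn_triangle (h.rev_bwd (by omega) (by omega))
            (h.face_bwd_rung h0 ⟨by omega, by omega, by omega⟩ (by omega) (by omega))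
          (h.face_rung_succ h0 (by omega) (by omega) (by omega) (by omega)))
  -- The second alternative occurs for `ℓ = 2 * s` on the last row that is a circle; the third
  -- neighbour is then in the row beyond all circles.
  · rcases (show 2 * s + 1 ≤ ℓ ∨ 2 * s + 1 = ℓ + 1 by omega) with hle | hle
    · have hst := hs1 (2 * s + 1) (by omega) (by omega)
      have en : next ℓ r x = x + 1 := by rw [hnext]; split_ifs <;> omega
      have ep : prev ℓ r x = x - 1 := by rw [hprev]; split_ifs <;> omega
      refine ⟨.fwd, 2 * s + 1, 2 * m + 1, ⟨by omega, by omega, by omega⟩, .inl ⟨?_, ?_⟩⟩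
      · simp only [row]
        omega
      · rw [en, ep, node_one_three (s := s) (m := m) (by omega) (by omega),
          node_one_zero (s := s) (m := m + 1) (by omega) (by omega),
          node_one_two (s := s) (m := m) (by omega) (by omega)]
        exact hP.turn_triangle (h.rev_rung_succ h0 (by omega) (by omega) (by omega) (by omega))
            (h.face_rung_succ h0 (by omega) (by omega) (by omega) (by omega))
          (h.face_fwd_rung h0 ⟨by omega, by omega, by omega⟩ (by omega) (by omega))
    · have hst : step ℓ (2 * s + 1) = 2 := hle ▸ hsl
      have en : next ℓ r x = x + 1 := by rw [hnext]; split_ifs <;> omega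
      have ep : prev ℓ r x = x - 1 := by rw [hprev]; split_ifs <;> omega
      refine ⟨.fwd, 2 * s + 1, 2 * m, ⟨by omega, by omega, by omega⟩, .inl ⟨?_, ?_⟩⟩
      · simp only [row]
        omega
      · rw [en, ep, node_one_three (s := s) (m := m) (by omega) (by omega),
          node_one_zero (s := s) (m := m + 1) (by omega) (by omega),
          node_one_two (s := s) (m := m) (by omega) (by omega)]
        exact hP.turn_triangle (h.rev_rung_succ h0 (by omega) (by omega) (by omega) (by omega))
            (h.face_rung_succ h0 (by omega) (by omega) (by omega) (by omega))
          (h.face_fwd_rung h0 ⟨by omega, by omega, by omega⟩ (by omega) (by omega))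

set_option maxHeartbeats 1000000 in
theorem OnCircle.hasTurn_two (h : A.IsCapFrame P k ℓ) (h0 : A.lev v₀ = 0) (hP : P.IsFullerene)
    {r s : ℕ} {x : ℤ} (hx : OnCircle ℓ r x) (hs : r = 3 * s + 2) :
    A.HasTurn hP ℓ v₀ r x := by
  have hone := h.one_le
  obtain ⟨h1, h2, h3, h4, h5⟩ := hx
  have hnext : next ℓ r x = next ℓ r x := rfl
  have hprev : prev ℓ r x = prev ℓ r x := rfl
  conv_rhs at hnext => unfold next
  conv_rhs at hprev => unfold prev
  obtain ⟨m, hm⟩ : ∃ m, m = x / 4 := ⟨_, rfl⟩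
  have hs0 : step ℓ 0 = 2 := step_cap (.inl rfl)
  have hsl : step ℓ (ℓ + 1) = 2 := step_cap (.inr rfl)
  have hs1 : ∀ i, 0 < i → i ≤ ℓ → step ℓ i = 1 := fun i => step_mid
  rcases (show x % 4 = 0 ∨ x % 4 = 1 ∨ x % 4 = 2 ∨ x % 4 = 3 by omega) with hu | hu | hu | hu
  · have hst := hs1 (2 * s + 1) (by omega) (by omega)
    have en : next ℓ r x = x + 1 := by rw [hnext]; split_ifs <;> omega
    have ep : prev ℓ r x = x - 1 := by rw [hprev]; split_ifs <;> omega
    refine ⟨.rung, 2 * s + 2, 2 * m + 1, ⟨by omega, by omega, by omega⟩, .inl ⟨?_, ?_⟩⟩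
    · simp only [row]
      split_ifs <;> omega
    · rw [en, ep, node_two_zero (s := s) (m := m) (by omega) (by omega),
        node_two_one (s := s) (m := m) (by omega) (by omega),
        node_two_three (s := s) (m := m - 1) (by omega) (by omega)]
      exact hP.turn_triangle (h.rev_bwd (by omega) (by omega)) (h.face_bwd h0
          ⟨by omega, by omega, by omega⟩ (by omega) (by omega))
        (h.face_rung_succ h0 (by omega) (by omega) (by omega) (by omega))
  · have hst := hs1 (2 * s + 1) (by omega) (by omega)
    have en : next ℓ r x = x + 1 := by rw [hnext]; split_ifs <;> omega
    have ep : prev ℓ r x = x - 1 := by rw [hprev]; split_ifs <;> omega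
    refine ⟨.rung, 2 * s, 2 * m, ⟨by omega, by omega, by omega⟩, .inr ⟨?_, ?_⟩⟩
    · simp only [row]
      split_ifs <;> omega
    · rw [en, ep, node_two_one (s := s) (m := m) (by omega) (by omega),
        node_two_two (s := s) (m := m) (by omega) (by omega),
        node_two_zero (s := s) (m := m) (by omega) (by omega)]
      exact PlaneEmbedding.Turn.rotate (hP.turn_triangle (h.rev_fwd (by omega) (by omega))
          (h.face_fwd h0 ⟨by omega, by omega, by omega⟩ (by omega) (by omega))
        (h.face_rung h0 (by omega) (by omega) (by omega) (by omega)))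
  · have hst := hs1 (2 * s + 1) (by omega) (by omega)
    have en : next ℓ r x = x + 1 := by rw [hnext]; split_ifs <;> omega
    have ep : prev ℓ r x = x - 1 := by rw [hprev]; split_ifs <;> omega
    refine ⟨.rung, 2 * s + 1, 2 * m + 2, ⟨by omega, by omega, by omega⟩, .inr ⟨?_, ?_⟩⟩
    · simp only [row]
      split_ifs <;> omega
    · rw [en, ep, node_two_two (s := s) (m := m) (by omega) (by omega),
        node_two_three (s := s) (m := m) (by omega) (by omega),
        node_two_one (s := s) (m := m) (by omega) (by omega)]
      exact hP.turn_triangle (h.rev_fwd (by omega) (by omega)) (h.face_fwd_rung h0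
          ⟨by omega, by omega, by omega⟩ (by omega) (by omega))
        (h.face_fwd h0 ⟨by omega, by omega, by omega⟩ (by omega) (by omega))
  · have hst := hs1 (2 * s + 1) (by omega) (by omega)
    have en : next ℓ r x = x + 1 := by rw [hnext]; split_ifs <;> omega
    have ep : prev ℓ r x = x - 1 := by rw [hprev]; split_ifs <;> omega
    refine ⟨.rung, 2 * s + 1, 2 * m + 1, ⟨by omega, by omega, by omega⟩, .inl ⟨?_, ?_⟩⟩
    · simp only [row]
      split_ifs <;> omega
    · rw [en, ep, node_two_three (s := s) (m := m) (by omega) (by omega),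
        node_two_zero (s := s) (m := m + 1) (by omega) (by omega),
        node_two_two (s := s) (m := m) (by omega) (by omega)]
      exact PlaneEmbedding.Turn.rotate' (hP.turn_triangle (h.rev_bwd (by omega) (by omega))
          (h.face_bwd_rung h0 ⟨by omega, by omega, by omega⟩ (by omega) (by omega))
        (h.face_bwd h0 ⟨by omega, by omega, by omega⟩ (by omega) (by omega)))

set_option maxHeartbeats 1000000 in
theorem OnCircle.hasTurn_three (h : A.IsCapFrame P k ℓ) (h0 : A.lev v₀ = 0) (hP : P.IsFullerene)
    {r s : ℕ} {x : ℤ} (hx : OnCircle ℓ r x) (hs : r = 3 * s + 3) :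
    A.HasTurn hP ℓ v₀ r x := by
  have hone := h.one_le
  obtain ⟨h1, h2, h3, h4, h5⟩ := hx
  have hnext : next ℓ r x = next ℓ r x := rfl
  have hprev : prev ℓ r x = prev ℓ r x := rfl
  conv_rhs at hnext => unfold next
  conv_rhs at hprev => unfold prev
  obtain ⟨m, hm⟩ : ∃ m, m = x / 4 := ⟨_, rfl⟩
  have hs0 : step ℓ 0 = 2 := step_cap (.inl rfl)
  have hsl : step ℓ (ℓ + 1) = 2 := step_cap (.inr rfl)
  have hs1 : ∀ i, 0 < i → i ≤ ℓ → step ℓ i = 1 := fun i => step_mid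
  rcases (show x % 4 = 0 ∨ x % 4 = 1 ∨ x % 4 = 2 ∨ x % 4 = 3 by omega) with hu | hu | hu | hu
  · have hst := hs1 (2 * s + 2) (by omega) (by omega)
    have en : next ℓ r x = x + 1 := by rw [hnext]; split_ifs <;> omega
    have ep : prev ℓ r x = x - 1 := by rw [hprev]; split_ifs <;> omega
    refine ⟨.bwd, 2 * s + 2, 2 * m + 1, ⟨by omega, by omega, by omega⟩, .inl ⟨?_, ?_⟩⟩
    · simp only [row]
      omega
    · rw [en, ep, node_three_zero (s := s) (m := m) (by omega) (by omega),
        node_three_one (s := s) (m := m) (by omega) (by omega),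
        node_three_three (s := s) (m := m - 1) (by omega) (by omega)]
      exact PlaneEmbedding.Turn.rotate (hP.turn_triangle (h.rev_fwd (by omega) (by omega))
          (h.face_fwd_rung h0 ⟨by omega, by omega, by omega⟩ (by omega) (by omega))
        (h.face_fwd h0 ⟨by omega, by omega, by omega⟩ (by omega) (by omega)))
  · rcases (show 2 * s + 2 ≤ ℓ ∨ 2 * s + 2 = ℓ + 1 by omega) with hle | hle
    · have hst := hs1 (2 * s + 2) (by omega) (by omega)
      have en : next ℓ r x = x + 1 := by rw [hnext]; split_ifs <;> omega
      have ep : prev ℓ r x = x - 1 := by rw [hprev]; split_ifs <;> omega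
      refine ⟨.bwd, 2 * s + 1, 2 * m + 1, ⟨by omega, by omega, by omega⟩, .inr ⟨?_, ?_⟩⟩
      · simp only [row]
        omega
      · rw [en, ep, node_three_one (s := s) (m := m) (by omega) (by omega),
          node_three_two (s := s) (m := m) (by omega) (by omega),
          node_three_zero (s := s) (m := m) (by omega) (by omega)]
        exact hP.turn_triangle (h.rev_rung_succ h0 (by omega) (by omega) (by omega) (by omega))
            (h.face_rung_succ h0 (by omega) (by omega) (by omega) (by omega))
          (h.face_fwd_rung h0 ⟨by omega, by omega, by omega⟩ (by omega) (by omega))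
    · have hst : step ℓ (2 * s + 2) = 2 := hle ▸ hsl
      have en : next ℓ r x = x + 1 := by rw [hnext]; split_ifs <;> omega
      have ep : prev ℓ r x = x - 2 := by rw [hprev]; split_ifs <;> omega
      refine ⟨.bwd, 2 * s + 1, 2 * m + 1, ⟨by omega, by omega, by omega⟩, .inr ⟨?_, ?_⟩⟩
      · simp only [row]
        omega
      · rw [en, ep, node_three_one (s := s) (m := m) (by omega) (by omega),
          node_three_two (s := s) (m := m) (by omega) (by omega),
          node_three_three (s := s) (m := m - 1) (by omega) (by omega)]
        exact hP.turn_triangle (h.rev_rung_succ h0 (by omega) (by omega) (by omega) (by omega))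
            (h.face_rung_succ h0 (by omega) (by omega) (by omega) (by omega))
          (h.face_fwd_rung h0 ⟨by omega, by omega, by omega⟩ (by omega) (by omega))
  · have hst := hs1 (2 * s + 1) (by omega) (by omega)
    have en : next ℓ r x = x + 1 := by rw [hnext]; split_ifs <;> omega
    have ep : prev ℓ r x = x - 1 := by rw [hprev]; split_ifs <;> omega
    refine ⟨.bwd, 2 * s + 1, 2 * m + 2, ⟨by omega, by omega, by omega⟩, .inr ⟨?_, ?_⟩⟩
    · simp only [row]
      omega
    · rw [en, ep, node_three_two (s := s) (m := m) (by omega) (by omega),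
        node_three_three (s := s) (m := m) (by omega) (by omega),
        node_three_one (s := s) (m := m) (by omega) (by omega)]
      exact PlaneEmbedding.Turn.rotate (hP.turn_triangle (h.rev_rung h0 (by omega) (by omega)
          (by omega) (by omega)) (h.face_rung h0 (by omega) (by omega) (by omega) (by omega))
        (h.face_bwd_rung h0 ⟨by omega, by omega, by omega⟩ (by omega) (by omega)))
  · rcases (show 2 * s + 2 ≤ ℓ ∨ 2 * s + 2 = ℓ + 1 by omega) with hle | hle
    · have hst := hs1 (2 * s + 2) (by omega) (by omega)
      have en : next ℓ r x = x + 1 := by rw [hnext]; split_ifs <;> omega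
      have ep : prev ℓ r x = x - 1 := by rw [hprev]; split_ifs <;> omega
      refine ⟨.bwd, 2 * s + 2, 2 * m + 2, ⟨by omega, by omega, by omega⟩, .inl ⟨?_, ?_⟩⟩
      · simp only [row]
        omega
      · rw [en, ep, node_three_three (s := s) (m := m) (by omega) (by omega),
          node_three_zero (s := s) (m := m + 1) (by omega) (by omega),
          node_three_two (s := s) (m := m) (by omega) (by omega)]
        exact PlaneEmbedding.Turn.rotate (hP.turn_triangle (h.rev_fwd (by omega) (by omega))
            (h.face_fwd h0 ⟨by omega, by omega, by omega⟩ (by omega) (by omega))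
          (h.face_rung h0 (by omega) (by omega) (by omega) (by omega)))
    · have hst : step ℓ (2 * s + 2) = 2 := hle ▸ hsl
      have en : next ℓ r x = x + 2 := by rw [hnext]; split_ifs <;> omega
      have ep : prev ℓ r x = x - 1 := by rw [hprev]; split_ifs <;> omega
      refine ⟨.bwd, 2 * s + 2, 2 * m + 3, ⟨by omega, by omega, by omega⟩, .inl ⟨?_, ?_⟩⟩
      · simp only [row]
        omega
      · rw [en, ep, node_three_three (s := s) (m := m) (by omega) (by omega),
          node_three_one (s := s) (m := m + 1) (by omega) (by omega),
          node_three_two (s := s) (m := m) (by omega) (by omega)]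
        exact PlaneEmbedding.Turn.rotate (hP.turn_triangle (h.rev_fwd (by omega) (by omega))
            (h.face_fwd_rung h0 ⟨by omega, by omega, by omega⟩ (by omega) (by omega))
          (h.face_rung h0 (by omega) (by omega) (by omega) (by omega)))

theorem OnCircle.hasTurn (h : A.IsCapFrame P k ℓ) (h0 : A.lev v₀ = 0) (hP : P.IsFullerene)
    {r : ℕ} {x : ℤ} (hx : OnCircle ℓ r x) : A.HasTurn hP ℓ v₀ r x := by
  obtain hs | ⟨s, hs | hs | hs⟩ : r = 0 ∨ ∃ s, r = 3 * s + 1 ∨ r = 3 * s + 2 ∨ r = 3 * s + 3 := by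
    by_cases hr : r = 0
    · exact .inl hr
    · exact .inr ⟨(r - 1) / 3, by omega⟩
  exacts [hx.hasTurn_zero h h0 hP hs, hx.hasTurn_one h h0 hP hs, hx.hasTurn_two h h0 hP hs,
    hx.hasTurn_three h h0 hP hs]

end LevelFrame


/-! ### The circles of the leapfrog, numbered without gaps -/

namespace LevelFrame

variable {V : Type*} {F : SimpleGraph V} {A : LevelFrame F} {P : PlaneEmbedding F} {k ℓ : ℕ}
  {v₀ : V}

/-- the angle of vertex number `a` of circle `r` of the leapfrog -/
def pos (ℓ : ℕ) (r : ℕ) (a : ℤ) : ℤ :=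
  if r = 0 then 4 * a
  else if r = 1 then 4 * (a / 3) + (if a % 3 = 0 then 0 else a % 3 + 1)
  else if ℓ % 2 = 1 ∧ r = 3 * ((ℓ + 1) / 2) then 4 * (a / 3) + (a % 3 + 1)
  else if ℓ % 2 = 1 ∧ r = 3 * ((ℓ + 1) / 2) + 1 then 4 * a + 1
  else a

/-- circle `r` of the leapfrog has `k * mult ℓ r` vertices -/
def mult (ℓ : ℕ) (r : ℕ) : ℕ :=
  if r = 0 then 1
  else if r = 1 then 3
  else if ℓ % 2 = 1 ∧ r = 3 * ((ℓ + 1) / 2) then 3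
  else if ℓ % 2 = 1 ∧ r = 3 * ((ℓ + 1) / 2) + 1 then 1
  else 4

theorem onCircle_pos (hl : 1 ≤ ℓ) {r : ℕ} (hr : r ≤ 3 * ((ℓ + 1) / 2) + 1) (a : ℤ) :
    OnCircle ℓ r (pos ℓ r a) := by
  unfold pos
  refine ⟨hr, ?_, ?_, ?_, ?_⟩ <;> intros <;> split_ifs <;> omega

theorem OnCircle.exists_pos (hl : 1 ≤ ℓ) {r : ℕ} {x : ℤ} (hx : OnCircle ℓ r x) :
    ∃ a, pos ℓ r a = x := by
  obtain ⟨h1, h2, h3, h4, h5⟩ := hx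
  unfold pos
  split_ifs with c1 c2 c3 c4
  · exact ⟨x / 4, by omega⟩
  · refine ⟨3 * (x / 4) + (if x % 4 = 0 then 0 else x % 4 - 1), ?_⟩
    split_ifs <;> omega
  · exact ⟨3 * (x / 4) + (x % 4 - 1), by omega⟩
  · exact ⟨x / 4, by omega⟩
  · exact ⟨x, rfl⟩

theorem next_pos (hl : 1 ≤ ℓ) (r : ℕ) (a : ℤ) : next ℓ r (pos ℓ r a) = pos ℓ r (a + 1) := by
  by_cases c1 : r = 0
  · have e : ∀ a, pos ℓ r a = 4 * a := fun a => if_pos c1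
    rw [e, e, next, if_pos (.inl c1)]
    ring
  by_cases c2 : r = 1
  · have e : ∀ a, pos ℓ r a = 4 * (a / 3) + (if a % 3 = 0 then 0 else a % 3 + 1) := fun a => by
      rw [pos, if_neg c1, if_pos c2]
    rw [e, e, next]
    obtain h3 | h3 | h3 : a % 3 = 0 ∨ a % 3 = 1 ∨ a % 3 = 2 := by omega
    · have h3' : (a + 1) % 3 = 1 := by omega
      rw [h3, h3']
      norm_num
      split_ifs <;> omega
    · have h3' : (a + 1) % 3 = 2 := by omega
      rw [h3, h3']
      norm_num
      split_ifs <;> omega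
    · have h3' : (a + 1) % 3 = 0 := by omega
      rw [h3, h3']
      norm_num
      split_ifs <;> omega
  by_cases c3 : ℓ % 2 = 1 ∧ r = 3 * ((ℓ + 1) / 2)
  · have e : ∀ a, pos ℓ r a = 4 * (a / 3) + (a % 3 + 1) := fun a => by
      rw [pos, if_neg c1, if_neg c2, if_pos c3]
    rw [e, e, next]
    split_ifs <;> omega
  by_cases c4 : ℓ % 2 = 1 ∧ r = 3 * ((ℓ + 1) / 2) + 1
  · have e : ∀ a, pos ℓ r a = 4 * a + 1 := fun a => by
      rw [pos, if_neg c1, if_neg c2, if_neg c3, if_pos c4]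
    rw [e, e, next, if_pos (.inr c4)]
    ring
  · have e : ∀ a, pos ℓ r a = a := fun a => by
      rw [pos, if_neg c1, if_neg c2, if_neg c3, if_neg c4]
    rw [e, e, next]
    split_ifs <;> omega

theorem prev_pos (hl : 1 ≤ ℓ) (r : ℕ) (a : ℤ) : prev ℓ r (pos ℓ r a) = pos ℓ r (a - 1) := by
  by_cases c1 : r = 0
  · have e : ∀ a, pos ℓ r a = 4 * a := fun a => if_pos c1
    rw [e, e, prev, if_pos (.inl c1)]
    ring
  by_cases c2 : r = 1
  · have e : ∀ a, pos ℓ r a = 4 * (a / 3) + (if a % 3 = 0 then 0 else a % 3 + 1) := fun a => by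
      rw [pos, if_neg c1, if_pos c2]
    rw [e, e, prev]
    obtain h3 | h3 | h3 : a % 3 = 0 ∨ a % 3 = 1 ∨ a % 3 = 2 := by omega
    · have h3' : (a - 1) % 3 = 2 := by omega
      rw [h3, h3']
      norm_num
      split_ifs <;> omega
    · have h3' : (a - 1) % 3 = 0 := by omega
      rw [h3, h3']
      norm_num
      split_ifs <;> omega
    · have h3' : (a - 1) % 3 = 1 := by omega
      rw [h3, h3']
      norm_num
      split_ifs <;> omega
  by_cases c3 : ℓ % 2 = 1 ∧ r = 3 * ((ℓ + 1) / 2)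
  · have e : ∀ a, pos ℓ r a = 4 * (a / 3) + (a % 3 + 1) := fun a => by
      rw [pos, if_neg c1, if_neg c2, if_pos c3]
    rw [e, e, prev]
    split_ifs <;> omega
  by_cases c4 : ℓ % 2 = 1 ∧ r = 3 * ((ℓ + 1) / 2) + 1
  · have e : ∀ a, pos ℓ r a = 4 * a + 1 := fun a => by
      rw [pos, if_neg c1, if_neg c2, if_neg c3, if_pos c4]
    rw [e, e, prev, if_pos (.inr c4)]
    ring
  · have e : ∀ a, pos ℓ r a = a := fun a => by
      rw [pos, if_neg c1, if_neg c2, if_neg c3, if_neg c4]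
    rw [e, e, prev]
    split_ifs <;> omega

theorem mul_dvd_sub_iff {n : ℤ} (hn : 0 < n) (k x y : ℤ) :
    n * k ∣ x - y ↔ x % n = y % n ∧ k ∣ x / n - y / n := by
  constructor
  · rintro ⟨c, hc⟩
    have : x = y + n * (k * c) := by linarith
    rw [this, Int.add_mul_emod_self_left, Int.add_mul_ediv_left _ _ hn.ne']
    exact ⟨rfl, c, by ring⟩
  · rintro ⟨h1, c, hc⟩
    refine ⟨c, ?_⟩
    linear_combination (-1 : ℤ) * Int.emod_add_mul_ediv x n + Int.emod_add_mul_ediv y n +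
      n * hc + h1

/-- Each block of four columns contains `mult ℓ r` occupied positions, which `pos` numbers
consecutively. So a shift by `k` blocks is a shift by `mult ℓ r * k` in the numbering. -/
theorem dvd_pos_sub_pos (r : ℕ) (k a b : ℤ) :
    4 * k ∣ pos ℓ r a - pos ℓ r b ↔ (mult ℓ r : ℤ) * k ∣ a - b := by
  have h4 := mul_dvd_sub_iff (show (0 : ℤ) < 4 by norm_num) k (pos ℓ r a) (pos ℓ r b)
  have h3 := mul_dvd_sub_iff (show (0 : ℤ) < 3 by norm_num) k a b
  rw [h4]
  clear h4
  unfold pos mult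
  split_ifs with c1 c2 c3 c4 c5 c6 c7
  · rw [Nat.cast_one, one_mul, show 4 * a / 4 - 4 * b / 4 = a - b by omega]
    simp
  all_goals first
    | rw [Nat.cast_ofNat, h3]
      refine and_congr (by omega) ?_
      congr! 1
      omega
    | skip
  · rw [Nat.cast_one, one_mul, show (4 * a + 1) / 4 - (4 * b + 1) / 4 = a - b by omega]
    refine and_iff_right (by omega)
  · rw [Nat.cast_ofNat, mul_dvd_sub_iff (by norm_num)]

/-- The circles of the leapfrog, run through clockwise and listed from the outside to the inside. -/
def circle (A : LevelFrame F) (P : PlaneEmbedding F) (ℓ : ℕ) (v₀ : V) (i : ℕ) (a : ℤ) :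
    P.map.leapfrog.Vertex :=
  P.map.triangle (A.node ℓ v₀ (3 * ((ℓ + 1) / 2) + 1 - i)
    (pos ℓ (3 * ((ℓ + 1) / 2) + 1 - i) (-a)))

theorem IsCapFrame.exists_circle (h : A.IsCapFrame P k ℓ) {t : DartKind} {i : ℕ}
    {a : ℤ} (hv : Valid ℓ i a) (hr : row t i a ≤ 3 * ((ℓ + 1) / 2) + 1) :
    ∃ b, A.circle P ℓ v₀ (3 * ((ℓ + 1) / 2) + 1 - row t i a) b =
      P.map.triangle (A.dt ℓ v₀ t i a) := by
  obtain ⟨b, hb⟩ := (hv.onCircle hr).exists_pos h.one_le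
  refine ⟨-b, ?_⟩
  rw [circle, Nat.sub_sub_self hr, neg_neg, hb, node_row_col hv]

theorem IsCapFrame.circle_ne (h : A.IsCapFrame P k ℓ) (h0 : A.lev v₀ = 0) {t : DartKind} {i : ℕ}
    {a : ℤ} (hv : Valid ℓ i a) (hr : 3 * ((ℓ + 1) / 2) + 1 < row t i a) (j : ℕ) (b : ℤ) :
    A.circle P ℓ v₀ j b ≠ P.map.triangle (A.dt ℓ v₀ t i a) := by
  intro he
  have := P.finite_dart
  have he := P.map.triangle_injective he
  obtain ⟨t', i', a', hv', h1, h2, h3⟩ := (onCircle_pos h.one_le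
    (show 3 * ((ℓ + 1) / 2) + 1 - j ≤ 3 * ((ℓ + 1) / 2) + 1 by omega) (-b)).exists_dt (A := A)
    (v₀ := v₀)
  rw [h3] at he
  have := (h.row_col_of_dt_eq h0 hv' hv he).1
  omega

/-- Listing the rows from the outside and running through them clockwise turns the drawing inside
out. The directions forward and backward are exchanged, and so are interior and exterior, so
counterclockwise orders stay valid up to a cyclic rotation. A neighbour beyond the last row becomes
an interior vertex. -/
theorem IsCapFrame.intCircles (h : A.IsCapFrame P k ℓ) (h0 : A.lev v₀ = 0) (hP : P.IsFullerene)
    (hk : 3 ≤ k) {m : List ℕ} (hl : m.length = 3 * ((ℓ + 1) / 2) + 2)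
    (hm : ∀ i (hi : i < m.length), m[i] = mult ℓ (3 * ((ℓ + 1) / 2) + 1 - i) * k) :
    IntCircles hP.leapfrogEmbedding m (A.circle P ℓ v₀) where
  three_le i hi := by
    rw [hm i hi]
    have : 1 ≤ mult ℓ (3 * ((ℓ + 1) / 2) + 1 - i) := by unfold mult; split_ifs <;> omega
    calc 3 ≤ 1 * k := by omega
      _ ≤ _ := Nat.mul_le_mul_right _ this
  eq_iff i j hi hj a b := by
    have := P.finite_dart
    have hneg : ∀ n : ℤ, n ∣ -a - -b ↔ n ∣ a - b := fun n => by
      rw [show -a - -b = -(a - b) by ring, dvd_neg]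
    rw [circle, circle, (P.map.triangle_injective).eq_iff,
      h.node_eq_node h0 (onCircle_pos h.one_le (by omega) _) (onCircle_pos h.one_le (by omega) _)]
    have hi' : 3 * ((ℓ + 1) / 2) + 1 - i = 3 * ((ℓ + 1) / 2) + 1 - j ↔ i = j := by omega
    rw [hi']
    refine and_congr_right ?_
    rintro rfl
    rw [dvd_pos_sub_pos, hneg, hm i hi]
    push_cast
    rfl
  turn i hi a := by
    obtain ⟨t, j, b, hv, ht⟩ := (onCircle_pos h.one_le
      (show 3 * ((ℓ + 1) / 2) + 1 - i ≤ 3 * ((ℓ + 1) / 2) + 1 by omega) (-a)).hasTurn h h0 hP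
    rw [next_pos h.one_le, prev_pos h.one_le, show -a + 1 = -(a - 1) by ring,
      show -a - 1 = -(a + 1) by ring] at ht
    refine ⟨P.map.triangle (A.dt ℓ v₀ t j b), ht.imp ?_ ?_⟩
    · rintro ⟨hr, ht⟩
      refine ⟨ht.rotate, ?_⟩
      rcases i.eq_zero_or_pos with rfl | hpos
      · exact .inr ⟨rfl, fun j hj b => h.circle_ne h0 hv (by omega) j b⟩
      · obtain ⟨b', hb'⟩ := h.exists_circle (v₀ := v₀) (t := t) hv (by omega)
        exact .inl ⟨_, b', by omega, hb'.symm⟩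
    · rintro ⟨hr, ht⟩
      refine ⟨ht.rotate', ?_⟩
      obtain ⟨b', hb'⟩ := h.exists_circle (v₀ := v₀) (t := t) hv (by omega)
      exact ⟨b', by omega, by rw [← hb']; congr 1; omega⟩

theorem IsCapFrame.interior_circle (h : A.IsCapFrame P k ℓ) (h0 : A.lev v₀ = 0) :
    {v | ∀ i < 3 * ((ℓ + 1) / 2) + 2, ∀ a, A.circle P ℓ v₀ i a ≠ v} =
      {v | ∃ t i a, Valid ℓ i a ∧ 3 * ((ℓ + 1) / 2) + 1 < row t i a ∧
        P.map.triangle (A.dt ℓ v₀ t i a) = v} := by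
  ext v
  constructor
  · intro hv
    obtain ⟨d, rfl⟩ := P.map.triangle_surjective v
    obtain ⟨t, i, a, hva, rfl⟩ := h.exists_dt h0 d
    refine ⟨t, i, a, hva, ?_, rfl⟩
    by_contra hr
    obtain ⟨b, hb⟩ := h.exists_circle (v₀ := v₀) (t := t) hva (by omega)
    exact hv _ (by omega) b hb
  · rintro ⟨t, i, a, hva, hr, rfl⟩ j - b
    exact h.circle_ne h0 hva hr j b

end LevelFrame


/-! ### The drawings for odd and for even numbers of middle circles -/

namespace LevelFrame

variable {V : Type*} {F : SimpleGraph V} {A : LevelFrame F} {P : PlaneEmbedding F} {k ℓ : ℕ}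
  {v₀ : V}

theorem exists_isCapFrame (hF : IsCapFullerene P k ℓ) : ∃ A, IsCapFrame A P k ℓ := by
  obtain ⟨hk, hl, hP, C, hC⟩ := hF
  obtain ⟨A, h1, h2, h3⟩ := C.exists_frame hC hP.1
  have hlen : ([k] ++ List.replicate ℓ (2 * k) ++ [k]).length = ℓ + 2 := by simp
  refine ⟨A, by omega, hl, h1, hP.2, by rw [h2, hlen]; push_cast; ring, ?_, ?_⟩
  · rintro v (hv | hv)
    · have := h3 v ⟨0, by omega⟩ (by rw [hv]; rfl)
      simpa using this
    · have := h3 v ⟨ℓ + 1, by omega⟩ (by rw [hv]; push_cast; rfl)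
      simpa [List.getElem_append] using this
  · intro v hv hv'
    obtain ⟨i, hi⟩ := Int.eq_ofNat_of_zero_le hv.le
    obtain ⟨i, rfl⟩ : ∃ j, i = j + 1 := ⟨i - 1, by omega⟩
    have := h3 v ⟨i + 1, by omega⟩ hi
    have hil : i < ℓ := by omega
    simpa [List.getElem_append, hil] using this

theorem IsCapFrame.exists_lev_zero (h : A.IsCapFrame P k ℓ) : ∃ v, A.lev v = 0 :=
  A.exists_lev 0 le_rfl (by rw [h.q_eq]; omega)

/-- the drawing of the leapfrog for an odd number of middle circles -/
theorem IsCapFrame.isCircularWith (h : A.IsCapFrame P k ℓ) (hP : P.IsFullerene) (hk : 3 ≤ k)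
    (hl : ℓ % 2 = 1) : P.map.leapfrog.graph.IsCircularWith
      ([k, 3 * k] ++ List.replicate ((3 * ℓ - 1) / 2) (4 * k) ++ [3 * k, k]) := by
  obtain ⟨v₀, h0⟩ := h.exists_lev_zero
  have hone := h.one_le
  have hlen : ([k, 3 * k] ++ List.replicate ((3 * ℓ - 1) / 2) (4 * k) ++ [3 * k, k]).length =
      3 * ((ℓ + 1) / 2) + 2 := by simp; omega
  have hI := h.intCircles h0 hP hk hlen (fun i hi => by
    unfold mult
    rcases i with _ | _ | i
    · rw [if_neg (by omega), if_neg (by omega), if_neg (by omega), if_pos (by omega)]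
      simp
    · rw [if_neg (by omega), if_neg (by omega), if_pos (by omega)]
      simp
    · rw [hlen] at hi
      by_cases c : i < (3 * ℓ - 1) / 2
      · rw [if_neg (by omega), if_neg (by omega), if_neg (by omega), if_neg (by omega)]
        simp [c]
      obtain rfl | rfl : i = (3 * ℓ - 1) / 2 ∨ i = (3 * ℓ - 1) / 2 + 1 := by omega
      · rw [if_neg (by omega), if_pos (by omega)]
        simp
      · rw [if_pos (by omega)]
        simp)
  obtain ⟨C, hC⟩ := hI.exists_circleDrawing (by simp)
  refine ⟨_, C, ?_⟩
  rw [hC, hlen, h.interior_circle h0]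
  ext v
  simp only [Set.mem_ofPred_eq, Set.mem_empty_iff_false, iff_false]
  rintro ⟨t, i, a, ⟨w1, w2, w3⟩, hr, -⟩
  -- For odd `ℓ` the largest row, that of the backward darts on level `ℓ + 1`, is the last circle.
  rcases t with _ | _ | _ <;> simp only [row] at hr
  · omega
  · omega
  · split_ifs at hr <;> omega

/-- For even `ℓ` only the darts along the outer cap lie beyond the last circle. The shift by `-2`
gives the same index to the two darts of one edge, which prepares the perfect matching. -/
theorem IsCapFrame.interior_circle_of_even (h : A.IsCapFrame P k ℓ) (h0 : A.lev v₀ = 0)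
    (hl : ℓ % 2 = 0) :
    {v | ∀ i < 3 * ((ℓ + 1) / 2) + 2, ∀ a, A.circle P ℓ v₀ i a ≠ v} =
      (Set.range fun z : ℤ => P.map.triangle (A.dt ℓ v₀ .bwd (ℓ + 1) (2 * z))) ∪
        Set.range fun z : ℤ => P.map.triangle (A.dt ℓ v₀ .fwd (ℓ + 1) (2 * z - 2)) := by
  have hone := h.one_le
  rw [h.interior_circle h0]
  ext v
  constructor
  · rintro ⟨t, i, a, ⟨w1, w2, w3⟩, hr, rfl⟩
    rcases t with _ | _ | _ <;> simp only [row] at hr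
    · obtain rfl : i = ℓ + 1 := by omega
      exact .inr ⟨a / 2 + 1, by beta_reduce; congr 2; omega⟩
    · obtain rfl : i = ℓ + 1 := by omega
      exact .inl ⟨a / 2, by beta_reduce; congr 2; omega⟩
    · split_ifs at hr <;> omega
  · rintro (⟨z, rfl⟩ | ⟨z, rfl⟩)
    · exact ⟨_, _, _, ⟨le_rfl, by omega, by omega⟩, by simp only [row]; omega, rfl⟩
    · exact ⟨_, _, _, ⟨le_rfl, by omega, by omega⟩, by simp only [row]; omega, rfl⟩

set_option maxHeartbeats 600000 in
/-- the drawing of the leapfrog for an even number of middle circles -/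
theorem IsCapFrame.exists_circleDrawing_sun (h : A.IsCapFrame P k ℓ) (hP : P.IsFullerene)
    (hk : 3 ≤ k) (hl : ℓ % 2 = 0) : ∃ (Q : PlaneEmbedding P.map.leapfrog.graph)
      (C : CircleDrawing Q (List.replicate (3 * ℓ / 2) (4 * k) ++ [3 * k, k])),
      C.interior.ncard = 2 * k ∧ C.InteriorIsSun k := by
  obtain ⟨v₀, h0⟩ := h.exists_lev_zero
  have hone := h.one_le
  have := P.finite_dart
  have hlen : (List.replicate (3 * ℓ / 2) (4 * k) ++ [3 * k, k]).length =
      3 * ((ℓ + 1) / 2) + 2 := by simp; omega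
  have hI := h.intCircles h0 hP hk hlen (fun i hi => by
    unfold mult
    rw [hlen] at hi
    by_cases c : i < 3 * ℓ / 2
    · rw [if_neg (by omega), if_neg (by omega), if_neg (by omega), if_neg (by omega)]
      simp [c]
    obtain rfl | rfl : i = 3 * ℓ / 2 ∨ i = 3 * ℓ / 2 + 1 := by omega
    · rw [if_neg (by omega), if_pos (by omega)]
      simp
    · rw [if_pos (by omega)]
      simp)
  obtain ⟨C, hC⟩ := hI.exists_circleDrawing (by simp)
  rw [hlen, h.interior_circle_of_even h0 hl] at hC
  have : NeZero k := ⟨by omega⟩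
  have hst : step ℓ (ℓ + 1) = 2 := step_cap (.inr rfl)
  have hv : ∀ z : ℤ, Valid ℓ (ℓ + 1) (2 * z) := fun z => ⟨le_rfl, by omega, by omega⟩
  let B : ℤ → F.Dart := fun z => A.dt ℓ v₀ .bwd (ℓ + 1) (2 * z)
  let W : ℤ → F.Dart := fun z => A.dt ℓ v₀ .fwd (ℓ + 1) (2 * z - 2)
  have hdvd : ∀ x y : ℤ, (2 * k : ℤ) ∣ 2 * x - 2 * y ↔ (x : ZMod k) = y := fun x y => by
    rw [← mul_sub, mul_dvd_mul_iff_left (by norm_num), eq_comm, ZMod.intCast_eq_intCast_iff_dvd_sub]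
  have hW : ∀ z, W z = A.dt ℓ v₀ .fwd (ℓ + 1) (2 * (z - 1)) := fun z => by
    simp only [W]; congr 1; ring
  have BB : ∀ x y : ℤ, B x = B y ↔ (x : ZMod k) = y := fun x y => by
    rw [h.dt_eq_dt h0 (hv _) (hv _), hdvd]; simp
  have WW : ∀ x y : ℤ, W x = W y ↔ (x : ZMod k) = y := fun x y => by
    rw [hW, hW, h.dt_eq_dt h0 (hv _) (hv _), hdvd]; simp
  have BW : ∀ x y : ℤ, B x ≠ W y := fun x y he => by
    rw [hW, h.dt_eq_dt h0 (hv _) (hv _)] at he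
    exact DartKind.noConfusion he.1
  have RB : ∀ x, P.map.rev (B x) = W x := fun x => h.rev_bwd le_rfl (by rw [hst])
  have RW : ∀ x, P.map.rev (W x) = B x := fun x => by rw [← RB, P.map.rev_rev]
  -- The backward darts of the last level bound the outer face of `F`; their triangles form the
  -- cycle `C_k`.
  have FB : ∀ x, P.map.face (B x) = B (x - 1) := fun x =>
    h.face_bwd h0 (hv _) (by rw [hst]; ring) (by push_cast; omega)
  have FW : ∀ x, P.map.face (W x) = A.dt ℓ v₀ .rung (ℓ + 1) (2 * x) := fun x => by
    rw [hW]
    exact h.face_fwd_rung h0 (hv _) (by rw [hst]; ring) (by push_cast; omega)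
  have FWB : ∀ x y, P.map.face (W x) ≠ B y := fun x y he => by
    rw [FW, h.dt_eq_dt h0 (hv _) (hv _)] at he
    exact DartKind.noConfusion he.1
  have FWW : ∀ x y, P.map.face (W x) ≠ W y := fun x y he => by
    rw [FW, hW, h.dt_eq_dt h0 (hv _) (hv _)] at he
    exact DartKind.noConfusion he.1
  have hs : ∀ a : ZMod k, ((a.cast : ℤ) : ZMod k) = a := fun a => ZMod.intCast_zmod_cast a
  let c : ZMod k → P.map.leapfrog.Vertex := fun a => P.map.triangle (B a.cast)
  let p : ZMod k → P.map.leapfrog.Vertex := fun a => P.map.triangle (W a.cast)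
  have hinj := P.map.triangle_injective
  have hcp : Function.Injective (Sum.elim c p) := by
    rintro (a | a) (b | b) hab <;> have hab := hinj hab
    · rw [BB, hs, hs] at hab; rw [hab]
    · exact absurd hab (BW _ _)
    · exact absurd hab.symm (BW _ _)
    · rw [WW, hs, hs] at hab; rw [hab]
  have hint : C.interior = Set.range c ∪ Set.range p := by
    rw [hC]
    congr 1
    · refine subset_antisymm ?_ ?_
      · rintro _ ⟨z, rfl⟩
        exact ⟨(z : ZMod k), congrArg P.map.triangle ((BB (z : ZMod k).cast z).2 (hs z))⟩
      · rintro _ ⟨a, rfl⟩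
        exact ⟨a.cast, rfl⟩
    · refine subset_antisymm ?_ ?_
      · rintro _ ⟨z, rfl⟩
        exact ⟨(z : ZMod k), congrArg P.map.triangle ((WW (z : ZMod k).cast z).2 (hs z))⟩
      · rintro _ ⟨a, rfl⟩
        exact ⟨a.cast, rfl⟩
  refine ⟨_, C, ?_, c, p, hcp, hint, ?_, ?_, ?_⟩
  · rw [hint, ← Set.Sum.elim_range, Set.ncard_range_of_injective hcp, Nat.card_sum]
    simp [two_mul]
  · intro a b
    simp only [c]
    rw [CombMap.leapfrog_adj, RB, FB, FB, Ne, BB, BB, BB, hs, hs]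
    push_cast
    have h1 : (1 : ZMod k) ≠ 0 := by
      have : Fact (1 < k) := ⟨by omega⟩
      exact one_ne_zero
    constructor
    · rintro ⟨-, h2 | h2 | h2⟩
      · exact absurd h2 (BW _ _)
      · exact .inr (by rw [h2, sub_add_cancel])
      · exact .inl (by rw [h2, sub_add_cancel])
    · rintro (rfl | rfl)
      · exact ⟨fun he => h1 (by simpa using he), .inr (.inr (by ring))⟩
      · exact ⟨fun he => h1 (by simpa using he), .inr (.inl (by ring))⟩
  · intro a b
    simp only [c, p]
    rw [CombMap.leapfrog_adj, RB, FB, WW, hs, hs]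
    constructor
    · rintro ⟨-, h2 | h2 | h2⟩
      · exact h2.symm
      · exact absurd h2.symm (BW _ _)
      · exact absurd h2.symm (FWB _ _)
    · rintro rfl
      exact ⟨BW _ _, .inl rfl⟩
  · intro a b
    simp only [p]
    rw [CombMap.leapfrog_adj, RW]
    rintro ⟨-, h2 | h2 | h2⟩
    · exact absurd h2.symm (BW _ _)
    · exact absurd h2.symm (FWW _ _)
    · exact absurd h2.symm (FWW _ _)

end LevelFrame


/-- the vertices `(j, Y)` of a triangulated cylinder with two cones; all `(j, 0)` represent the apex
of one cone, and all `(j, 2 * L)` the apex of the other one -/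
def CylinderPoint (L j Y : ℤ) : Prop :=
  (Y - j) % 2 = 0 ∧ 0 ≤ Y ∧ Y ≤ 2 * L ∧ (Y % 2 = 1 → 3 ≤ Y ∧ Y ≤ 2 * L - 3)

/-- the neighbours in a triangulated cylinder with two cones -/
def CylinderAdj (L j Y j' Y' : ℤ) : Prop :=
  (j' = j ∧ (Y' = Y + 2 ∨ Y' = Y - 2)) ∨ ((j' = j + 1 ∨ j' = j - 1) ∧ (Y' = Y + 1 ∨ Y' = Y - 1)) ∨
    ((j' = j + 2 ∨ j' = j - 2) ∧ Y' = Y ∧ (Y = 2 ∨ Y = 2 * L - 2)) ∨ (Y = 0 ∧ Y' = 2) ∨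
    (Y = 2 * L ∧ Y' = 2 * L - 2)

/-- The function `h` is the distance to one of the vertices, in a triangulated cylinder of
circumference `2 * k` with two cones. -/
structure IsCylinderDistance (k L : ℤ) (h : ℤ → ℤ → ℤ) : Prop where
  bottom : ∀ j j', h j 0 = h j' 0
  top : ∀ j j', h j (2 * L) = h j' (2 * L)
  period : ∀ j j' Y, CylinderPoint L j Y → 2 * k ∣ j - j' → h j Y = h j' Y
  nonneg : ∀ j Y, CylinderPoint L j Y → 0 ≤ h j Y
  vert : ∀ j Y, CylinderPoint L j Y → CylinderPoint L j (Y + 2) →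
    h j Y - h j (Y + 2) ≤ 1 ∧ h j (Y + 2) - h j Y ≤ 1
  diag : ∀ s j Y, s = 1 ∨ s = -1 → CylinderPoint L j Y → CylinderPoint L (j + s) (Y + 1) →
    h j Y - h (j + s) (Y + 1) ≤ 1 ∧ h (j + s) (Y + 1) - h j Y ≤ 1
  lower : ∀ j Y, CylinderPoint L j Y → 0 < h j Y → ∃ j' Y', CylinderPoint L j' Y' ∧
    CylinderAdj L j Y j' Y' ∧ h j' Y' = h j Y - 1
  exists_zero : ∃ j Y, CylinderPoint L j Y ∧ h j Y = 0
  unique : ∀ j Y j' Y', CylinderPoint L j Y → CylinderPoint L j' Y' → h j Y = 0 → h j' Y' = 0 →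
    Y = Y' ∧ (Y = 0 ∨ Y = 2 * L ∨ 2 * k ∣ j - j')

/-! ### Distances in a triangulated cylinder with two cones -/

namespace IsCylinderDistance

variable {k L N : ℤ} {h : ℤ → ℤ → ℤ}

/-- The condition `lower` yields a path of `h j Y` edges down to the zero, and `f` loses at most one
along each edge. Lower bounds for distances come from this with a suitable test function; `hf'` lets
`f` respect the identification of coordinates. -/
theorem sub_le (hh : IsCylinderDistance k L h) {f : ℤ → ℤ → ℤ}
    (hf : ∀ j Y j' Y', CylinderPoint L j Y → CylinderPoint L j' Y' → CylinderAdj L j Y j' Y' →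
      f j Y - f j' Y' ≤ 1)
    (hf' : ∀ j j' Y, Y = 0 ∨ Y = 2 * L ∨ 2 * k ∣ j - j' → f j Y = f j' Y)
    {j₀ Y₀ : ℤ} (h₀ : CylinderPoint L j₀ Y₀) (h₀' : h j₀ Y₀ = 0) {j Y : ℤ}
    (hp : CylinderPoint L j Y) : f j Y - f j₀ Y₀ ≤ h j Y := by
  obtain ⟨n, hn⟩ := Int.eq_ofNat_of_zero_le (hh.nonneg j Y hp)
  induction n generalizing j Y with
  | zero =>
    obtain ⟨rfl, h1⟩ := hh.unique _ _ _ _ hp h₀ hn h₀'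
    rw [hf' _ _ _ h1, hn]
    simp
  | succ n ih =>
    obtain ⟨j', Y', h1, h2, h3⟩ := hh.lower j Y hp (by omega)
    have := ih h1 (by omega)
    have := hf _ _ _ _ hp h1 h2
    omega

/-- Vertical steps descend by two. There is no point at height `1`, so from an odd height one first
comes down to `3` and takes a diagonal step to `2`. -/
theorem bottom_le (hh : IsCylinderDistance k L h) {j Y : ℤ} (hp : CylinderPoint L j Y) :
    h 0 0 ≤ h j Y + (Y + 1) / 2 := by
  have even : ∀ n : ℕ, ∀ j, CylinderPoint L j (2 * n) → h 0 0 ≤ h j (2 * n) + n := by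
    intro n
    induction n with
    | zero => intro j _; rw [hh.bottom 0 j]; simp
    | succ n ih =>
      intro j hp
      have hp' : CylinderPoint L j (2 * n) := by unfold CylinderPoint at *; omega
      have h1 := ih j hp'
      have e : (2 * (n : ℤ) + 2) = 2 * ((n + 1 : ℕ) : ℤ) := by push_cast; ring
      have h2 := hh.vert j (2 * n) hp' (by rwa [e])
      rw [e] at h2
      push_cast at *
      omega
  have odd : ∀ n : ℕ, ∀ j, CylinderPoint L j (2 * n + 3) → h 0 0 ≤ h j (2 * n + 3) + (n + 2) := by
    intro n
    induction n with
    | zero =>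
      intro j hp
      simp only [Nat.cast_zero, mul_zero, zero_add] at hp ⊢
      have hp' : CylinderPoint L (j - 1) 2 := by
        unfold CylinderPoint at *
        omega
      have h1 := even 1 (j - 1) hp'
      have h2 := hh.diag 1 (j - 1) 2 (.inl rfl) hp' (by rwa [sub_add_cancel])
      rw [sub_add_cancel] at h2
      norm_num at h1 h2
      omega
    | succ n ih =>
      intro j hp
      have hp' : CylinderPoint L j (2 * n + 3) := by unfold CylinderPoint at *; omega
      have h1 := ih j hp'
      have e : (2 * (n : ℤ) + 3 + 2) = 2 * ((n + 1 : ℕ) : ℤ) + 3 := by push_cast; ring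
      have h2 := hh.vert j (2 * n + 3) hp' (by rwa [e])
      rw [e] at h2
      push_cast at *
      omega
  rcases Int.emod_two_eq_zero_or_one Y with hY | hY
  · obtain ⟨n, hn⟩ := Int.eq_ofNat_of_zero_le (show 0 ≤ Y / 2 by have := hp.2.1; omega)
    obtain rfl : Y = 2 * n := by omega
    have := even n j hp
    omega
  · obtain ⟨n, hn⟩ := Int.eq_ofNat_of_zero_le (show 0 ≤ (Y - 3) / 2 by have := hp.2.2.2 hY; omega)
    obtain rfl : Y = 2 * n + 3 := by omega
    have := odd n j hp
    omega

theorem flip (hh : IsCylinderDistance k L h) :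
    IsCylinderDistance k L fun j Y => h j (2 * L - Y) := by
  have hp : ∀ {j Y}, CylinderPoint L j Y → CylinderPoint L j (2 * L - Y) := by
    intro j Y hp
    unfold CylinderPoint at *
    omega
  refine ⟨?_, ?_, ?_, ?_, ?_, ?_, ?_, ?_, ?_⟩
  · intro j j'
    simpa using hh.top j j'
  · intro j j'
    simpa using hh.bottom j j'
  · exact fun j j' Y h1 h2 => hh.period j j' _ (hp h1) h2
  · exact fun j Y h1 => hh.nonneg j _ (hp h1)
  · intro j Y h1 h2
    have := hh.vert j (2 * L - (Y + 2)) (hp h2) (by convert hp h1 using 1; ring)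
    rw [show 2 * L - (Y + 2) + 2 = 2 * L - Y by ring] at this
    exact this.symm
  · intro s j Y hs h1 h2
    have := hh.diag (-s) (j + s) (2 * L - (Y + 1)) (by omega) (hp h2)
      (by convert hp h1 using 1 <;> ring)
    rw [show 2 * L - (Y + 1) + 1 = 2 * L - Y by ring, show j + s + -s = j by ring] at this
    exact this.symm
  · intro j Y h1 h2
    obtain ⟨j', Y', h3, h4, h5⟩ := hh.lower j _ (hp h1) h2
    refine ⟨j', 2 * L - Y', hp h3, ?_, by rw [sub_sub_cancel]; exact h5⟩
    rcases h4 with h4 | h4 | h4 | h4 | h4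
    · exact .inl (by omega)
    · exact .inr (.inl (by omega))
    · exact .inr (.inr (.inl (by omega)))
    · exact .inr (.inr (.inr (.inr (by omega))))
    · exact .inr (.inr (.inr (.inl (by omega))))
  · obtain ⟨j, Y, h1, h2⟩ := hh.exists_zero
    exact ⟨j, 2 * L - Y, hp h1, by rw [sub_sub_cancel]; exact h2⟩
  · intro j Y j' Y' h1 h2 h3 h4
    obtain ⟨h5, h6⟩ := hh.unique _ _ _ _ (hp h1) (hp h2) h3 h4
    refine ⟨by omega, ?_⟩
    rcases h6 with h6 | h6 | h6
    · exact .inr (.inl (by omega))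
    · exact .inl (by omega)
    · exact .inr (.inr h6)

/-- The upper bound is the path of `bottom_le`. It is optimal because no edge changes the height
rounded up to half of it by more than one. -/
theorem bottom_eq (hh : IsCylinderDistance k L h) (hL : 0 ≤ L) {j Y : ℤ}
    (hp : CylinderPoint L j Y) (h0 : h j Y = 0) : h 0 0 = (Y + 1) / 2 := by
  have h1 := hh.bottom_le hp
  have h2 := hh.sub_le (f := fun _ Y => -((Y + 1) / 2))
    (fun j Y j' Y' h1 h2 h3 => by unfold CylinderPoint CylinderAdj at *; omega)
    (fun _ _ _ _ => rfl) hp h0 (j := 0) (Y := 0) (by unfold CylinderPoint; omega)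
  omega

theorem top_eq (hh : IsCylinderDistance k L h) (hL : 0 ≤ L) {j Y : ℤ}
    (hp : CylinderPoint L j Y) (h0 : h j Y = 0) : h 0 (2 * L) = (2 * L - Y + 1) / 2 := by
  have := hh.flip.bottom_eq hL (j := j) (Y := 2 * L - Y) (by unfold CylinderPoint at *; omega)
    (by rw [sub_sub_cancel]; exact h0)
  simpa using this

/-- A path with `a` diagonal steps in the direction `s`, completed by vertical steps if the rise
exceeds `a`; if the rise is less than `a`, the surplus diagonal steps zigzag. -/
theorem le_add (hh : IsCylinderDistance k L h) (hL : 4 ≤ L) {s j Y : ℤ} (hs : s = 1 ∨ s = -1)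
    (hp : CylinderPoint L j Y) (h2 : 2 ≤ Y) (hY : Y ≤ L) (a : ℕ) :
    ∀ Y', CylinderPoint L (j + s * a) Y' → Y ≤ Y' → Y' ≤ 2 * L - 2 →
      h (j + s * a) Y' ≤ h j Y + max (a : ℤ) ((a + Y' - Y) / 2) := by
  induction a with
  | zero =>
    have key : ∀ n : ℕ, CylinderPoint L j (Y + 2 * n) → h j (Y + 2 * n) ≤ h j Y + n := by
      intro n
      induction n with
      | zero => intro _; simp
      | succ n ih =>
        intro hp'
        have hp2 : CylinderPoint L j (Y + 2 * n) := by unfold CylinderPoint at *; omega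
        have h1 := ih hp2
        have e : Y + 2 * (n : ℤ) + 2 = Y + 2 * ((n + 1 : ℕ) : ℤ) := by push_cast; ring
        have h2 := hh.vert j _ hp2 (by rwa [e])
        rw [e] at h2
        push_cast at *
        omega
    intro Y' hp' h1 h3
    simp only [Nat.cast_zero, mul_zero, add_zero, zero_add] at *
    obtain ⟨n, hn⟩ := Int.eq_ofNat_of_zero_le (show 0 ≤ (Y' - Y) / 2 by omega)
    obtain rfl : Y' = Y + 2 * n := by unfold CylinderPoint at *; omega
    have := key n hp'
    omega
  | succ a ih =>
    intro Y' hp' h1 h3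
    have hpar : (Y' - Y) % 2 = ((a : ℤ) + 1) % 2 := by
      unfold CylinderPoint at *
      rcases hs with rfl | rfl <;> push_cast at * <;> omega
    have ej : j + s * ((a + 1 : ℕ) : ℤ) = j + s * a + s := by push_cast; ring
    rw [ej] at hp' ⊢
    generalize hx : j + s * (a : ℤ) = x at *
    rcases h1.lt_or_eq with h4 | rfl
    · have hp2 : CylinderPoint L x (Y' - 1) := by
        unfold CylinderPoint at *
        omega
      have h5 := ih (Y' - 1) hp2 (by omega) (by omega)
      have h6 := hh.diag s x (Y' - 1) hs hp2 (by rwa [sub_add_cancel])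
      rw [sub_add_cancel] at h6
      push_cast
      omega
    -- At height `Y` itself the last step comes down from `Y + 1`, so the path never leaves the
    -- strip above `Y`.
    · have hp2 : CylinderPoint L x (Y + 1) := by
        unfold CylinderPoint at *
        omega
      have h5 := ih (Y + 1) hp2 (by omega) (by omega)
      have h6 := hh.diag (-s) (x + s) Y (by omega) hp' (by rwa [add_neg_cancel_right])
      rw [add_neg_cancel_right] at h6
      push_cast
      omega

/-- a function that bounds the distance to `(x, 3)` from below; the first argument is the distance
to the column `x` -/
def barrier (L δ Y : ℤ) : ℤ :=
  if Y = 0 then 2 else if Y = 2 * L then 5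
  else min (max δ ((δ + max (Y - 3) (3 - Y) + 1) / 2)) (min ((Y + 1) / 2 + (δ - 1) / 2) 5)

/-- Away from the apices the barrier is a minimum of three terms: the length of a direct route, that
of a route along row `2`, where one edge passes two columns, and a cut-off at `5`. A minimum of
functions with increments at most one has this property too. -/
theorem barrier_sub_le_of_ne {Y Y' δ δ' : ℤ} (z : Y ≠ 0) (t : Y ≠ 2 * L) (z' : Y' ≠ 0)
    (t' : Y' ≠ 2 * L) (h1 : δ ≤ δ' + 1) (h2 : δ - δ' + (Y - Y') ≤ 2)
    (h3 : δ - δ' + (Y' - Y) ≤ 2) (h4 : (δ - 1) / 2 + (Y + 1) / 2 ≤ (δ' - 1) / 2 +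
        (Y' + 1) / 2 + 1) :
    barrier L δ Y - barrier L δ' Y' ≤ 1 := by
  have hmin : ∀ a b a' b' : ℤ, a ≤ a' + 1 → b ≤ b' + 1 →
      min a (min b 5) - min a' (min b' 5) ≤ 1 := by
    intro a b a' b' h1 h2
    omega
  rw [barrier, barrier, if_neg z, if_neg t, if_neg z', if_neg t']
  apply hmin <;> omega

/-- The edges at an apex and the horizontal edges in rows `2` and `2 * L - 2` need the explicit
values there: `(δ + 1) / 2` in row `2`, and `4` or `5` in row `2 * L - 2`, far from the point `(x,
3)`. -/
theorem barrier_sub_le (hL : 6 ≤ L) {j Y j' Y' δ δ' : ℤ} (h1 : CylinderPoint L j Y)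
    (h2 : CylinderPoint L j' Y') (h3 : CylinderAdj L j Y j' Y') (h0 : 0 ≤ δ) (h0' : 0 ≤ δ')
    (h5 : δ ≤ 6) (h5' : δ' ≤ 6) (hp : (δ - j) % 2 = 1) (hp' : (δ' - j') % 2 = 1)
    (hd : j - j' ≤ 2 → j' - j ≤ 2 →
      δ - δ' ≤ max (j - j') (j' - j) ∧ δ' - δ ≤ max (j - j') (j' - j)) :
    barrier L δ Y - barrier L δ' Y' ≤ 1 ∧ barrier L δ' Y' - barrier L δ Y ≤ 1 := by
  have e1 : (δ - 1 - Y) % 2 = 0 := by have := h1.1; omega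
  have e1' : (δ' - 1 - Y') % 2 = 0 := by have := h2.1; omega
  obtain ⟨-, y0, y1, y2⟩ := h1
  obtain ⟨-, y0', y1', y2'⟩ := h2
  have b2 : ∀ δ : ℤ, 0 ≤ δ → δ ≤ 6 → (δ - 1) % 2 = 0 →
      barrier L δ 2 = (δ + 1) / 2 := by
    intro δ h0 h5 h
    rw [barrier, if_neg (by omega), if_neg (by omega)]
    omega
  have bL : ∀ δ : ℤ, 0 ≤ δ → δ ≤ 6 → (δ - 1) % 2 = 0 →
      4 ≤ barrier L δ (2 * L - 2) ∧ barrier L δ (2 * L - 2) ≤ 5 := by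
    intro δ h0 h5 h
    rw [barrier, if_neg (by omega), if_neg (by omega)]
    omega
  have c0 : ∀ δ, barrier L δ 0 = 2 := fun δ => if_pos rfl
  have cL : ∀ δ, barrier L δ (2 * L) = 5 := fun δ => by
    rw [barrier, if_neg (by omega), if_pos rfl]
  by_cases z : Y = 0
  · obtain rfl : Y' = 2 := by unfold CylinderAdj at h3; omega
    have := b2 δ' h0' h5' (by omega)
    rw [z, c0]
    omega
  by_cases z' : Y' = 0
  · obtain rfl : Y = 2 := by unfold CylinderAdj at h3; omega
    have := b2 δ h0 h5 (by omega)
    rw [z', c0]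
    omega
  by_cases t : Y = 2 * L
  · obtain rfl : Y' = 2 * L - 2 := by unfold CylinderAdj at h3; omega
    have := bL δ' h0' h5' (by omega)
    rw [t, cL]
    omega
  by_cases t' : Y' = 2 * L
  · obtain rfl : Y = 2 * L - 2 := by unfold CylinderAdj at h3; omega
    have := bL δ h0 h5 (by omega)
    rw [t', cL]
    omega
  rcases h3 with ⟨rfl, h3⟩ | ⟨h3, h4⟩ | ⟨h3, rfl, rfl | rfl⟩ | ⟨rfl, rfl⟩ | ⟨rfl, rfl⟩
  · obtain rfl : δ = δ' := by
      have := hd (by omega) (by omega)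
      omega
    clear hd b2 bL c0 cL
    constructor <;> apply barrier_sub_le_of_ne <;> first | assumption | omega
  · have h5 := hd (by omega) (by omega)
    have : δ' = δ + 1 ∨ δ' = δ - 1 := by
      clear b2 bL hd
      omega
    clear hd b2 bL c0 cL h5 h3
    rcases this with rfl | rfl <;> constructor <;> apply barrier_sub_le_of_ne <;>
      first | assumption | omega
  · have := b2 δ h0 h5 (by omega)
    have := b2 δ' h0' h5' (by omega)
    have h6 := hd (by omega) (by omega)
    have : δ ≤ δ' + 2 ∧ δ' ≤ δ + 2 := by
      clear b2 bL hd this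
      omega
    clear hd b2 bL c0 cL h6 h3
    omega
  · have := bL δ h0 h5 (by omega)
    have := bL δ' h0' h5' (by omega)
    omega
  · exact absurd rfl z
  · exact absurd rfl t

/-- The distance to `x` modulo `2 * k`. -/
theorem exists_columnDistance (hk : k = 5 ∨ k = 6) (x : ℤ) : ∃ δ : ℤ → ℤ,
    (∀ j, 0 ≤ δ j ∧ δ j ≤ 6 ∧ (δ j - (j - x)) % 2 = 0) ∧
    (∀ j j', j - j' ≤ 2 → j' - j ≤ 2 → δ j - δ j' ≤ max (j - j') (j' - j)) ∧
    (∀ j j', 2 * k ∣ j - j' → δ j = δ j') ∧ δ x = 0 ∧ δ (x - 5) = 5 := by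
  refine ⟨fun j => min ((j - x) % (2 * k)) (2 * k - (j - x) % (2 * k)), ?_, ?_, ?_, ?_, ?_⟩ <;>
    rcases hk with rfl | rfl <;> intros <;> norm_num at * <;> omega

/-- The zeros of `h` and `N - h` are two vertices at distance `N` such that every vertex is on a
shortest path between them. A vertex whose two distances add up to more than `N` is produced. -/
theorem false_of_le (hh : IsCylinderDistance k L h)
    (hh' : IsCylinderDistance k L fun j Y => N - h j Y)
    (hk : k = 5 ∨ k = 6) (hL : 6 ≤ L) {j Y j' Y' : ℤ} (hf : CylinderPoint L j Y)
    (h0 : h j Y = 0) (hf' : CylinderPoint L j' Y') (h0' : N - h j' Y' = 0) (hle : Y ≤ Y') :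
    False := by
  have e1 := hh.bottom_eq (by omega) hf h0
  have e2 := hh.top_eq (by omega) hf h0
  have e3 := hh'.bottom_eq (by omega) hf' h0'
  have e4 := hh'.top_eq (by omega) hf' h0'
  -- Both apices are on shortest paths, so `N` is the sum of `Y / 2` and `Y' / 2`, both rounded up,
  -- and also the corresponding sum for `2L - Y` and `2L - Y'`.
  have hsum : Y + Y' = 2 * L := by
    unfold CylinderPoint at *
    omega
  have low := fun (p q : ℤ) (hp : CylinderPoint L p q) => hh'.sub_le
    (f := fun _ Y => (2 * L - Y + 1) / 2)
    (fun j Y j' Y' h1 h2 h3 => by unfold CylinderPoint CylinderAdj at *; omega)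
    (fun _ _ _ _ => rfl) hf' h0' hp
  by_cases hY : Y = 0
  -- If the two vertices are the apices, then `N = L`, but height `3` has distance at least `2` from
  -- the bottom and at least `L - 1` from the top.
  · have hp : CylinderPoint L 1 3 := by unfold CylinderPoint; omega
    have h1 := hh.sub_le (f := fun _ Y => (Y + 1) / 2)
      (fun j Y j' Y' h1 h2 h3 => by unfold CylinderPoint CylinderAdj at *; omega)
      (fun _ _ _ _ => rfl) hf h0 hp
    have h2 := low 1 3 hp
    norm_num at h1 h2
    omega
  have hY2 : 2 ≤ Y ∧ (Y % 2 = 1 → 3 ≤ Y) := by unfold CylinderPoint at hf; omega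
  -- The shorter way around the cylinder, with `s` for its direction and `a` for the number of
  -- columns.
  obtain ⟨s, a, hs, ha, hd⟩ : ∃ (s : ℤ) (a : ℕ), (s = 1 ∨ s = -1) ∧ (a : ℤ) ≤ k ∧
      2 * k ∣ j' - (j + s * a) := by
    by_cases c : (j' - j) % (2 * k) ≤ k
    · refine ⟨1, ((j' - j) % (2 * k)).toNat, .inl rfl, by omega, ?_⟩
      rcases hk with rfl | rfl <;> norm_num at * <;> omega
    · refine ⟨-1, (2 * k - (j' - j) % (2 * k)).toNat, .inr rfl, by omega, ?_⟩
      rcases hk with rfl | rfl <;> norm_num at * <;> omega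
  have hpath : h j' Y' ≤ max (a : ℤ) ((a + Y' - Y) / 2) := by
    have hp : CylinderPoint L (j + s * a) Y' := by
      obtain ⟨c, hc⟩ := hd
      have : j + s * a = j' - 2 * (k * c) := by linarith
      rw [this]
      unfold CylinderPoint at *
      omega
    have := hh.le_add (by omega) hs hf hY2.1 (by omega) a Y' hp hle (by omega)
    rw [← hh.period j' _ Y' hf' hd, h0] at this
    omega
  -- For odd `Y`, `N = L + 1` exceeds the length of the path just found. For even `Y`, `N = L`, and
  -- the path is long enough only if `Y ≤ a / 2 ≤ 3` or `a = L = 6`; in the latter case `Y ≤ L`.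
  have hY6 : Y % 2 = 0 ∧ Y ≤ 6 := by omega
  obtain ⟨δ, d1, d2, d3, d4, d5⟩ := exists_columnDistance hk (j + 5)
  have hj : j % 2 = 0 := by unfold CylinderPoint at hf; omega
  -- This point has distance at least `Y / 2 + 2` from the zero of `h` by the barrier, and at least
  -- `L - 1 - Y / 2` from the zero of `N - h` by its height. The sum exceeds `N = L`.
  have hp : CylinderPoint L (j + 5) 3 := by unfold CylinderPoint; omega
  have h1 := hh.sub_le (f := fun j Y => -barrier L (δ j) Y)
    (fun x Y x' Y' h1 h2 h3 => by
      obtain ⟨h4, h5, h6⟩ := d1 x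
      obtain ⟨h4', h5', h6'⟩ := d1 x'
      have := (barrier_sub_le hL h1 h2 h3 h4 h4' h5 h5' (by omega) (by omega)
        fun a b => ⟨d2 _ _ a b, by have := d2 _ _ b a; omega⟩).2
      omega)
    (fun x x' Y hx => by
      rcases hx with rfl | rfl | hx
      · simp [barrier]
      · simp [barrier]
      · rw [d3 _ _ hx]) hf h0 hp
  have h2 := low _ 3 hp
  have b1 : barrier L (δ (j + 5)) 3 = 0 := by
    rw [d4, barrier, if_neg (by omega), if_neg (by omega)]
    omega
  have b2 : barrier L (δ j) Y = Y / 2 + 2 := by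
    have : δ j = 5 := by rw [← d5]; congr 1; ring
    rw [this, barrier, if_neg (by omega), if_neg (by omega)]
    omega
  omega

end IsCylinderDistance


/-- Values at the vertices and at the faces of a plane graph (given at the darts of the face) that
form the distance to a vertex in the stellation. -/
structure IsRadialDistance {V : Type*} {F : SimpleGraph V} (P : PlaneEmbedding F) (av : V → ℤ)
    (bf : F.Dart → ℤ) : Prop where
  bf_face : ∀ d, bf (P.map.face d) = bf d
  av_nonneg : ∀ v, 0 ≤ av v
  bf_nonneg : ∀ d, 0 ≤ bf d
  av_le : ∀ d : F.Dart, av d.fst - av d.snd ≤ 1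
  av_bf : ∀ d, av d.fst - bf d ≤ 1 ∧ bf d - av d.fst ≤ 1
  lower_av : ∀ v, 0 < av v → ∃ d : F.Dart, d.fst = v ∧ (av d.snd = av v - 1 ∨ bf d = av v - 1)
  lower_bf : ∀ d, 0 < bf d → ∃ e, P.map.face.SameCycle d e ∧ av e.fst = bf d - 1
  unique_av : ∀ v w, av v = 0 → av w = 0 → v = w
  unique_bf : ∀ d e, bf d = 0 → bf e = 0 → P.map.face.SameCycle d e
  unique_av_bf : ∀ v d, av v = 0 → bf d ≠ 0
  exists_zero : (∃ v, av v = 0) ∨ ∃ d, bf d = 0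

/-! ### Distances between faces of the leapfrog as distances in the stellation -/

namespace PlaneEmbedding

open CombMap CombMap.StellationDart

variable {V : Type*} {F : SimpleGraph V} {P : PlaneEmbedding F}

/-- the value of a function on the faces of the leapfrog, at the vertex of the stellation that
corresponds to the face, given by a dart at that vertex -/
noncomputable def IsFullerene.stellationValue (hP : P.IsFullerene)
    (H : P.map.leapfrog.graph.Dart → ℤ) (x : StellationDart F.Dart) : ℤ :=
  H (hP.isSimple.dartEquiv (P.map.stellation.rev x))

/-- By duality faces of the leapfrog are vertices of the stellation, and crossing an edge of the
leapfrog is moving along an edge of the stellation. These edges are the old edges and the edges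
between a face and its vertices, which gives the separate conditions on `av` and `bf`. -/
theorem IsFullerene.isRadialDistance (hP : P.IsFullerene) {H : P.map.leapfrog.graph.Dart → ℤ}
    (hH : IsFaceDistance hP.leapfrogEmbedding H) :
    IsRadialDistance P (fun v => hP.stellationValue H (side (hP.exists_fst v).choose))
      (fun d => hP.stellationValue H (fromCenter d)) := by
  have := P.finite_dart
  generalize hK : hP.stellationValue H = K
  let S := P.map.stellation
  let φ := hP.isSimple.dartEquiv
  have hKx : ∀ x, K x = H (φ (S.rev x)) := fun x => by rw [← hK]; rfl
  have hKrev : ∀ x, K (S.rev x) = H (φ x) := fun x => by rw [hKx, S.rev_rev]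
  have hface : ∀ x, hP.leapfrogEmbedding.map.face (φ (S.rev x)) = φ (S.rev (S.rot x)) := fun x => by
    rw [P.map.semiconj_stellation_rev x]
    exact (hP.isSimple.semiconj_face _).symm
  have hiter : ∀ n x, hP.leapfrogEmbedding.map.face^[n] (φ (S.rev x)) = φ (S.rev
      (S.rot^[n] x)) := by
    intro n x
    induction n with
    | zero => rfl
    | succ n ih => rw [iterate_succ_apply', ih, hface, iterate_succ_apply']
  have : Finite P.map.leapfrog.graph.Dart := hP.leapfrogEmbedding.finite_dart
  have hcyc : ∀ x y, hP.leapfrogEmbedding.map.face.SameCycle (φ (S.rev x)) (φ (S.rev y)) →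
      ∃ n : ℕ, S.rot^[n] x = y := by
    intro x y hxy
    obtain ⟨n, hn⟩ := hxy.exists_nat_pow_eq
    rw [Equiv.Perm.coe_pow, hiter] at hn
    exact ⟨n, S.rev.injective (φ.injective hn)⟩
  have hrot : ∀ x, K (S.rot x) = K x := fun x => by rw [hKx, hKx, ← hface, hH.face]
  have hsymm : ∀ x, (φ x).symm = φ (S.rev x) := fun x => hP.isSimple.symm_dartEquiv x
  have hle : ∀ x, K x - K (S.rev x) ≤ 1 := fun x => by
    have := hH.symm_le (φ (S.rev x))
    rwa [hsymm, S.rev_rev, ← hKx, ← hKrev] at this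
  have hlow : ∀ x, 0 < K x → ∃ n : ℕ, K (S.rev (S.rot^[n] x)) = K x - 1 := by
    intro x hx
    obtain ⟨e, he, he'⟩ := hH.lower (φ (S.rev x)) (by rw [← hKx]; exact hx)
    obtain ⟨y, rfl⟩ := φ.surjective e
    obtain ⟨n, hn⟩ := hcyc x (S.rev y) (by rwa [S.rev_rev])
    refine ⟨n, ?_⟩
    rw [hn, hKx, hKx, ← he', hsymm, S.rev_rev]
  have huniq : ∀ x y, K x = 0 → K y = 0 → ∃ n : ℕ, S.rot^[n] x = y := by
    intro x y hx hy
    exact hcyc x y (hH.unique _ _ (by rw [← hKx, hx]) (by rw [← hKx, hy]))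
  have hside : ∀ d e : F.Dart, d.fst = e.fst → K (side d) = K (side e) := by
    intro d e h
    refine apply_eq_of_sameCycle (f := P.map.rot) (g := fun d => K (side d)) (fun d => ?_)
      ((P.sameCycle_rot_iff d e).2 h)
    rw [← P.map.stellation_rot_rot_side]
    exact (hrot _).trans (hrot _)
  have hto : ∀ d, K (toCenter d) = K (side (P.map.rev d)) := fun d => by
    rw [← P.map.stellation_rot_toCenter]
    exact (hrot _).symm
  have hav : ∀ d : F.Dart, K (side (hP.exists_fst d.fst).choose) = K (side d) := fun d =>
    hside _ _ (hP.exists_fst d.fst).choose_spec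
  have hfrom : ∀ d, K (S.rev (fromCenter d)) = K (side d) := fun d => by
    change K (toCenter (P.map.face.symm d)) = _
    rw [hto]
    refine hside _ _ ?_
    rw [fst_rev, ← fst_face, Equiv.apply_symm_apply]
  have hcase : ∀ (d : F.Dart) (n : ℕ), ∃ e : F.Dart,
      e.fst = d.fst ∧ S.rot^[n] (side d) = side e ∨
        e.snd = d.fst ∧ S.rot^[n] (side d) = toCenter e := by
    intro d n
    induction n with
    | zero => exact ⟨d, .inl ⟨rfl, rfl⟩⟩
    | succ n ih =>
      obtain ⟨e, ⟨h1, h2⟩ | ⟨h1, h2⟩⟩ := ih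
      · refine ⟨P.map.face.symm e, .inr ⟨?_, ?_⟩⟩
        · rw [← fst_face, Equiv.apply_symm_apply, h1]
        · rw [iterate_succ_apply', h2]; rfl
      · refine ⟨P.map.rev e, .inl ⟨by rw [fst_rev, h1], ?_⟩⟩
        rw [iterate_succ_apply', h2]; rfl
  refine ⟨?_, ?_, ?_, ?_, ?_, ?_, ?_, ?_, ?_, ?_, ?_⟩
  · exact fun d => hrot (fromCenter d)
  · exact fun v => by rw [hKx]; exact hH.nonneg _
  · exact fun d => by rw [hKx]; exact hH.nonneg _
  · intro d
    rw [hav, ← fst_rev (P := P), hav]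
    exact hle (side d)
  · intro d
    rw [hav]
    have h1 := hle (fromCenter d)
    have h2 := hle (S.rev (fromCenter d))
    rw [S.rev_rev] at h2
    rw [hfrom] at h1 h2
    exact ⟨h2, h1⟩
  · intro v hv
    obtain ⟨d, hd⟩ : ∃ d, d = (hP.exists_fst v).choose := ⟨_, rfl⟩
    have hdv : d.fst = v := by rw [hd]; exact (hP.exists_fst v).choose_spec
    rw [← hd] at hv ⊢
    obtain ⟨n, hn⟩ := hlow _ hv
    obtain ⟨e, ⟨h1, h2⟩ | ⟨h1, h2⟩⟩ := hcase d n
    · rw [h2] at hn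
      refine ⟨e, h1.trans hdv, .inl ?_⟩
      rw [← fst_rev (P := P), hav]
      exact hn
    · rw [h2] at hn
      refine ⟨P.map.face e, by rw [fst_face, h1, hdv], .inr hn⟩
  · intro d hd
    obtain ⟨n, hn⟩ := hlow _ hd
    rw [iterate_rot_fromCenter, hfrom] at hn
    refine ⟨P.map.face^[n] d, ⟨n, by rw [zpow_natCast, Equiv.Perm.coe_pow]⟩, ?_⟩
    rw [hav, hn]
  · intro v w hv hw
    obtain ⟨n, hn⟩ := huniq _ _ hv hw
    obtain ⟨e, ⟨h1, h2⟩ | ⟨h1, h2⟩⟩ := hcase (hP.exists_fst v).choose n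
    · rw [h2] at hn
      rw [← (hP.exists_fst v).choose_spec, ← h1, side.inj hn, (hP.exists_fst w).choose_spec]
    · rw [h2] at hn
      exact nomatch hn
  · intro d e hd he
    obtain ⟨n, hn⟩ := huniq _ _ hd he
    rw [iterate_rot_fromCenter] at hn
    exact ⟨n, by rw [zpow_natCast, Equiv.Perm.coe_pow]; exact fromCenter.inj hn⟩
  · intro v d hv hd
    obtain ⟨n, hn⟩ := huniq _ _ hd hv
    rw [iterate_rot_fromCenter] at hn
    exact nomatch hn
  · obtain ⟨e, he⟩ := hH.exists_zero
    obtain ⟨y, rfl⟩ := φ.surjective e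
    obtain ⟨x, rfl⟩ := S.rev.surjective y
    rw [← hKx] at he
    rcases x with d | d | d
    · exact .inl ⟨d.fst, by rw [hav, he]⟩
    · exact .inl ⟨(P.map.rev d).fst, by rw [hav, ← hto, he]⟩
    · exact .inr ⟨d, he⟩

end PlaneEmbedding


theorem sameCycle_induction {α : Type*} [Finite α] {f : Equiv.Perm α} {q : α → Prop} {d e : α}
    (hd : q d) (hf : ∀ x, q x → q (f x)) (h : f.SameCycle d e) : q e := by
  obtain ⟨n, rfl⟩ := h.exists_nat_pow_eq
  induction n with
  | zero => exact hd
  | succ n ih =>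
    rw [pow_succ', Equiv.Perm.mul_apply]
    exact hf _ (ih ⟨n, by rw [zpow_natCast]⟩)

/-! ### The stellation of a cap as a cylinder with two cones -/

namespace LevelFrame

variable {V : Type*} {F : SimpleGraph V} {A : LevelFrame F} {P : PlaneEmbedding F} {k ℓ : ℕ}
  {v₀ : V} {av : V → ℤ} {bf : F.Dart → ℤ}

/-- A function on the vertices and faces of a pentacap or hexacap as a function on a triangulated
cylinder with two cones. -/
def cyl (A : LevelFrame F) (ℓ : ℕ) (v₀ : V) (av : V → ℤ) (bf : F.Dart → ℤ) (j Y : ℤ) : ℤ :=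
  if Y = 0 then bf (A.dt ℓ v₀ .fwd 0 0)
  else if Y = 3 * ℓ + 6 then bf (A.dt ℓ v₀ .bwd (ℓ + 1) ℓ)
  else if Y % 3 = 0 then bf (A.dt ℓ v₀ .fwd (Y / 3).toNat (j - 1))
  else av (A.vt ℓ v₀ (Y / 3).toNat j)

theorem cyl_zero (j : ℤ) : A.cyl ℓ v₀ av bf j 0 = bf (A.dt ℓ v₀ .fwd 0 0) := if_pos rfl

theorem cyl_top {j Y : ℤ} (hY : Y = 3 * ℓ + 6) :
    A.cyl ℓ v₀ av bf j Y = bf (A.dt ℓ v₀ .bwd (ℓ + 1) ℓ) := by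
  rw [cyl, if_neg (by omega), if_pos hY]

theorem cyl_face {i : ℕ} {j Y a : ℤ} (h1 : 1 ≤ i) (h2 : i ≤ ℓ + 1) (hY : Y = 3 * i)
    (ha : a = j - 1) : A.cyl ℓ v₀ av bf j Y = bf (A.dt ℓ v₀ .fwd i a) := by
  rw [cyl, if_neg (by omega), if_neg (by omega), if_pos (by omega), ha]
  congr 2
  omega

theorem cyl_vertex {i : ℕ} {j Y : ℤ} (hY : Y = 3 * i + 1 ∨ Y = 3 * i + 2) :
    A.cyl ℓ v₀ av bf j Y = av (A.vt ℓ v₀ i j) := by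
  rw [cyl, if_neg (by omega), if_neg (by omega), if_neg (by omega)]
  congr 2
  omega

/-- The forward darts of level `0` all bound the innermost face, so the value at the apex does not
depend on the chosen dart. The following lemmas likewise locate the face to the left of each kind of
dart. -/
theorem bf_fwd_zero (h : A.IsCapFrame P k ℓ) (h0 : A.lev v₀ = 0)
    (hR : IsRadialDistance P av bf) {a : ℤ} (ha : a % 2 = 0) :
    bf (A.dt ℓ v₀ .fwd 0 a) = bf (A.dt ℓ v₀ .fwd 0 0) := by
  have hs0 : step ℓ 0 = 2 := step_cap (.inl rfl)
  have key : ∀ b : ℤ, bf (A.dt ℓ v₀ .fwd 0 (2 * (b + 1))) = bf (A.dt ℓ v₀ .fwd 0 (2 * b)) := by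
    intro b
    rw [← hR.bf_face (A.dt ℓ v₀ .fwd 0 (2 * b)), h.face_fwd h0 (b := 2 * (b + 1))
      ⟨by omega, by omega, by omega⟩ (by omega) (by omega)]
  obtain ⟨b, rfl⟩ : ∃ b, a = 2 * b := ⟨a / 2, by omega⟩
  induction b with
  | zero => rfl
  | succ b ih => rw [key, ih (by omega)]
  | pred b ih => rw [← key, sub_add_cancel, ih (by omega)]

theorem bf_bwd_last (h : A.IsCapFrame P k ℓ) (h0 : A.lev v₀ = 0)
    (hR : IsRadialDistance P av bf) {a : ℤ} (ha : (a - ℓ) % 2 = 0) :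
    bf (A.dt ℓ v₀ .bwd (ℓ + 1) a) = bf (A.dt ℓ v₀ .bwd (ℓ + 1) ℓ) := by
  have hsl : step ℓ (ℓ + 1) = 2 := step_cap (.inr rfl)
  have key : ∀ b : ℤ, bf (A.dt ℓ v₀ .bwd (ℓ + 1) (ℓ + 2 * (b + 1))) =
      bf (A.dt ℓ v₀ .bwd (ℓ + 1) (ℓ + 2 * b)) := by
    intro b
    rw [← hR.bf_face (A.dt ℓ v₀ .bwd (ℓ + 1) (ℓ + 2 * (b + 1))), h.face_bwd h0 (b := ℓ + 2 * b)
      ⟨by omega, by omega, by omega⟩ (by omega) (by omega)]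
  obtain ⟨b, rfl⟩ : ∃ b, a = ℓ + 2 * b := ⟨(a - ℓ) / 2, by omega⟩
  induction b with
  | zero => rw [mul_zero, add_zero]
  | succ b ih => rw [key, ih (by omega)]
  | pred b ih => rw [← key, sub_add_cancel, ih (by omega)]

theorem cyl_fwd_down {i : ℕ} {a j Y : ℤ} (hv : Valid ℓ i a) (ha : (a - i) % 2 = 1) (hj : j = a + 1)
    (hY : Y = 3 * i) :
    A.cyl ℓ v₀ av bf j Y = bf (A.dt ℓ v₀ .fwd i a) := by
  obtain ⟨w1, w2, w3⟩ := hv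
  exact cyl_face (by omega) w1 hY (by omega)

theorem cyl_fwd_up (h : A.IsCapFrame P k ℓ) (h0 : A.lev v₀ = 0)
    (hR : IsRadialDistance P av bf) {i : ℕ} {a j Y : ℤ} (hv : Valid ℓ i a) (ha : (a - i) % 2 = 0)
        (hj : j = a) (hY : Y = 3 * i) :
    A.cyl ℓ v₀ av bf j Y = bf (A.dt ℓ v₀ .fwd i a) := by
  obtain ⟨w1, w2, w3⟩ := hv
  rcases i.eq_zero_or_pos with rfl | hpos
  · obtain rfl : Y = 0 := by omega
    rw [cyl_zero, bf_fwd_zero h h0 hR (a := a) (by omega)]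
  · have hst : step ℓ i = 1 := step_mid hpos (by omega)
    rw [cyl_face hpos w1 hY rfl, ← hR.bf_face, h.face_fwd h0 (b := a) ⟨by omega, by omega, by omega⟩
      (by omega) (by omega)]

theorem cyl_rung_down (h : A.IsCapFrame P k ℓ) (h0 : A.lev v₀ = 0)
    (hR : IsRadialDistance P av bf) {i : ℕ} {a j Y : ℤ} (hv : Valid ℓ i a) (ha : (a - i) % 2 = 1)
        (hj : j = a - 1)
    (hY : Y = 3 * i) : A.cyl ℓ v₀ av bf j Y = bf (A.dt ℓ v₀ .rung i a) := by
  obtain ⟨w1, w2, w3⟩ := hv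
  rw [cyl_face (by omega) w1 hY rfl, ← hR.bf_face]
  by_cases hi : i = ℓ + 1
  · have hst : step ℓ i = 2 := step_cap (.inr hi)
    rw [h.face_fwd_rung h0 (b := a) ⟨by omega, by omega, by omega⟩ (by omega) (by omega)]
  · have hst : step ℓ i = 1 := step_mid (by omega) (by omega)
    rw [h.face_fwd h0 (b := a - 1) ⟨by omega, by omega, by omega⟩ (by omega) (by omega),
      ← hR.bf_face, h.face_fwd_rung h0 (b := a) ⟨by omega, by omega, by omega⟩ (by omega)
          (by omega)]

theorem cyl_bwd_up (h : A.IsCapFrame P k ℓ) (h0 : A.lev v₀ = 0)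
    (hR : IsRadialDistance P av bf) {i : ℕ} {a j Y : ℤ} (hv : Valid ℓ i a) (ha : (a - i) % 2 = 0)
        (hj : j = a - 1)
    (hY : Y = 3 * i + 3) : A.cyl ℓ v₀ av bf j Y = bf (A.dt ℓ v₀ .bwd i a) := by
  obtain ⟨w1, w2, w3⟩ := hv
  rw [cyl_rung_down h h0 hR (i := i + 1) (a := a) ⟨by omega, by omega, by omega⟩ (by omega) hj
    (by omega), ← hR.bf_face, h.face_rung_succ h0 (i := i) (b := a) (by omega) rfl rfl ha]

theorem cyl_bwd_down (h : A.IsCapFrame P k ℓ) (h0 : A.lev v₀ = 0)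
    (hR : IsRadialDistance P av bf) {i : ℕ} {a j Y : ℤ} (hv : Valid ℓ i a) (ha : (a - i) % 2 = 1)
        (hj : j = a)
    (hY : Y = 3 * i + 3) : A.cyl ℓ v₀ av bf j Y = bf (A.dt ℓ v₀ .bwd i a) := by
  obtain ⟨w1, w2, w3⟩ := hv
  by_cases hi : i = ℓ + 1
  · subst hi
    rw [cyl_top (by omega), bf_bwd_last h h0 hR (a := a) (by omega)]
  · have hst : step ℓ i = 1 := step_mid (by omega) (by omega)
    rw [cyl_bwd_up h h0 hR (i := i) (a := a + 1) ⟨by omega, by omega, by omega⟩ (by omega)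
      (by omega) hY, ← hR.bf_face, h.face_bwd h0 (b := a) ⟨by omega, by omega, by omega⟩
      (by omega) (by omega)]

theorem cyl_rung_up (h : A.IsCapFrame P k ℓ) (h0 : A.lev v₀ = 0)
    (hR : IsRadialDistance P av bf) {i : ℕ} {a j Y : ℤ} (hv : Valid ℓ i a) (ha : (a - i) % 2 = 0)
        (hj : j = a + 1)
    (hY : Y = 3 * i + 3) : A.cyl ℓ v₀ av bf j Y = bf (A.dt ℓ v₀ .rung i a) := by
  obtain ⟨w1, w2, w3⟩ := hv
  rw [← hR.bf_face, h.face_rung h0 (j := i + 1) (b := a) (by omega) rfl rfl ha]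
  exact cyl_face (by omega) (by omega) (by omega) (by omega)

theorem snd_fwd (h : A.IsCapFrame P k ℓ) {i : ℕ} (hi : i ≤ ℓ + 1) {a b : ℤ}
    (hb : b = a + step ℓ i) : (A.dt ℓ v₀ .fwd i a).snd = A.vt ℓ v₀ i b := by
  rw [hb, ← h.nx_vt i hi]; rfl

theorem snd_bwd (h : A.IsCapFrame P k ℓ) {i : ℕ} (hi : i ≤ ℓ + 1) {a b : ℤ}
    (hb : b = a - step ℓ i) : (A.dt ℓ v₀ .bwd i a).snd = A.vt ℓ v₀ i b := by
  rw [hb, ← h.inv_vt i hi]; rfl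

theorem snd_rung (h : A.IsCapFrame P k ℓ) (h0 : A.lev v₀ = 0) {i i' : ℕ} (hi : i ≤ ℓ) {a : ℤ}
    (ha : (a - i) % 2 = 0) (hi' : i' = i + 1) :
    (A.dt ℓ v₀ .rung i a).snd = A.vt ℓ v₀ i' a := by
  rw [hi', ← h.rung_vt h0 hi ha]; rfl

theorem snd_rung_succ (h : A.IsCapFrame P k ℓ) (h0 : A.lev v₀ = 0) {i i' : ℕ} (hi : i ≤ ℓ) {a : ℤ}
    (ha : (a - i) % 2 = 0) (hi' : i' = i + 1) :
    (A.dt ℓ v₀ .rung i' a).snd = A.vt ℓ v₀ i a := by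
  rw [hi', ← h.rung_vt' h0 hi ha]; rfl

end LevelFrame


namespace LevelFrame

variable {V : Type*} {F : SimpleGraph V} {A : LevelFrame F} {P : PlaneEmbedding F} {k ℓ : ℕ}
  {v₀ : V} {av : V → ℤ} {bf : F.Dart → ℤ}

/-- the three kinds of vertices of the stellation of a pentacap or hexacap, other than the two
apices, and the apices -/
theorem cylinderPoint_cases (hl : ℓ % 2 = 0) {L j Y : ℤ} (hL : 2 * L = 3 * ℓ + 6)
    (hp : CylinderPoint L j Y) : Y = 0 ∨ Y = 3 * ℓ + 6 ∨
      (∃ i : ℕ, 1 ≤ i ∧ i ≤ ℓ + 1 ∧ Y = 3 * i ∧ (j - i) % 2 = 0) ∨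
      ∃ i : ℕ, Valid ℓ i j ∧ ((j - i) % 2 = 0 ∧ Y = 3 * i + 2 ∨
          (j - i) % 2 = 1 ∧ Y = 3 * i + 1) := by
  obtain ⟨h1, h2, h3, h4⟩ := hp
  obtain ⟨i, hi⟩ : ∃ i : ℕ, (i : ℤ) = Y / 3 := ⟨(Y / 3).toNat, by omega⟩
  by_cases c1 : Y = 0
  · exact .inl c1
  by_cases c2 : Y = 3 * ℓ + 6
  · exact .inr (.inl c2)
  by_cases c3 : Y % 3 = 0
  · exact .inr (.inr (.inl ⟨i, by omega, by omega, by omega, by omega⟩))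
  · refine .inr (.inr (.inr ⟨i, ⟨by omega, by omega, by omega⟩, ?_⟩))
    omega

theorem cylinderPoint_face (hl : ℓ % 2 = 0) {L j Y : ℤ} (hL : 2 * L = 3 * ℓ + 6) {i : ℕ}
    (h1 : i ≤ ℓ + 2) (hj : (j - i) % 2 = 0) (hY : Y = 3 * i) :
    CylinderPoint L j Y := by
  unfold CylinderPoint
  omega

theorem cylinderPoint_vertex (hl : ℓ % 2 = 0) {L j Y : ℤ} (hL : 2 * L = 3 * ℓ + 6) {i : ℕ}
    (hv : Valid ℓ i j)
    (hY : (j - i) % 2 = 0 ∧ Y = 3 * i + 2 ∨ (j - i) % 2 = 1 ∧ Y = 3 * i + 1) :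
    CylinderPoint L j Y := by
  obtain ⟨w1, w2, w3⟩ := hv
  unfold CylinderPoint
  omega

theorem IsCapFrame.sameCycle_bottom (h : A.IsCapFrame P k ℓ) (h0 : A.lev v₀ = 0) {e : F.Dart}
    (he : P.map.face.SameCycle (A.dt ℓ v₀ .fwd 0 0) e) :
    ∃ a : ℤ, a % 2 = 0 ∧ e = A.dt ℓ v₀ .fwd 0 a := by
  have := P.finite_dart
  have hs0 : step ℓ 0 = 2 := step_cap (.inl rfl)
  refine sameCycle_induction (q := fun e => ∃ a : ℤ, a % 2 = 0 ∧ e = A.dt ℓ v₀ .fwd 0 a)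
    ⟨0, rfl, rfl⟩ ?_ he
  rintro _ ⟨a, ha, rfl⟩
  exact ⟨a + 2, by omega, h.face_fwd h0 ⟨by omega, by omega, by omega⟩ (by omega) (by omega)⟩

theorem IsCapFrame.sameCycle_top (h : A.IsCapFrame P k ℓ) (h0 : A.lev v₀ = 0) {e : F.Dart}
    (he : P.map.face.SameCycle (A.dt ℓ v₀ .bwd (ℓ + 1) ℓ) e) :
    ∃ a : ℤ, (a - ℓ) % 2 = 0 ∧ e = A.dt ℓ v₀ .bwd (ℓ + 1) a := by
  have := P.finite_dart
  have hsl : step ℓ (ℓ + 1) = 2 := step_cap (.inr rfl)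
  refine sameCycle_induction
    (q := fun e => ∃ a : ℤ, (a - ℓ) % 2 = 0 ∧ e = A.dt ℓ v₀ .bwd (ℓ + 1) a)
    ⟨ℓ, by omega, rfl⟩ ?_ he
  rintro _ ⟨a, ha, rfl⟩
  exact ⟨a - 2, by omega, h.face_bwd h0 ⟨by omega, by omega, by omega⟩ (by omega) (by omega)⟩

/-- The boundary of a face between two levels in cyclic order. The dart in the middle of a level is
absent where that level is a cap, since one step of the cap covers both angles. -/
theorem IsCapFrame.sameCycle_face (h : A.IsCapFrame P k ℓ) (h0 : A.lev v₀ = 0) {e : F.Dart}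
    {i : ℕ} {j : ℤ} (hi : i ≤ ℓ) (hj : (j - (i + 1)) % 2 = 0)
    (he : P.map.face.SameCycle (A.dt ℓ v₀ .fwd (i + 1) (j - 1)) e) :
    e = A.dt ℓ v₀ .fwd (i + 1) (j - 1) ∨ i + 1 ≤ ℓ ∧ e = A.dt ℓ v₀ .fwd (i + 1) j ∨
      e = A.dt ℓ v₀ .rung (i + 1) (j + 1) ∨ e = A.dt ℓ v₀ .bwd i (j + 1) ∨
      1 ≤ i ∧ e = A.dt ℓ v₀ .bwd i j ∨ e = A.dt ℓ v₀ .rung i (j - 1) := by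
  have := P.finite_dart
  have hs0 : step ℓ 0 = 2 := step_cap (.inl rfl)
  have hsl : step ℓ (ℓ + 1) = 2 := step_cap (.inr rfl)
  have hs1 : ∀ i, 0 < i → i ≤ ℓ → step ℓ i = 1 := fun i => step_mid
  refine sameCycle_induction (q := fun e => e = A.dt ℓ v₀ .fwd (i + 1) (j - 1) ∨
      i + 1 ≤ ℓ ∧ e = A.dt ℓ v₀ .fwd (i + 1) j ∨
      e = A.dt ℓ v₀ .rung (i + 1) (j + 1) ∨ e = A.dt ℓ v₀ .bwd i (j + 1) ∨
      1 ≤ i ∧ e = A.dt ℓ v₀ .bwd i j ∨ e = A.dt ℓ v₀ .rung i (j - 1)) (.inl rfl) ?_ he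
  rintro _ (rfl | ⟨hl, rfl⟩ | rfl | rfl | ⟨hl, rfl⟩ | rfl)
  · rcases hi.lt_or_eq with hl | rfl
    · have hst := hs1 (i + 1) (by omega) hl
      exact .inr (.inl ⟨hl, h.face_fwd h0 ⟨by omega, by omega, by omega⟩ (by omega)
        (by push_cast; omega)⟩)
    · exact .inr (.inr (.inl (h.face_fwd_rung h0 ⟨by omega, by omega, by omega⟩ (by omega)
        (by push_cast; omega))))
  · have hst := hs1 (i + 1) (by omega) hl
    exact .inr (.inr (.inl (h.face_fwd_rung h0 ⟨by omega, by omega, by omega⟩ (by omega)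
      (by push_cast; omega))))
  · exact .inr (.inr (.inr (.inl (h.face_rung_succ h0 hi rfl rfl (by omega)))))
  · rcases i.eq_zero_or_pos with rfl | hpos
    · exact .inr (.inr (.inr (.inr (.inr (h.face_bwd_rung h0 ⟨by omega, by omega, by omega⟩
        (by omega) (by omega))))))
    · have hst := hs1 i hpos hi
      exact .inr (.inr (.inr (.inr (.inl ⟨hpos, h.face_bwd h0 ⟨by omega, by omega, by omega⟩
        (by omega) (by omega)⟩))))
  · have hst := hs1 i hl hi
    exact .inr (.inr (.inr (.inr (.inr (h.face_bwd_rung h0 ⟨by omega, by omega, by omega⟩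
      (by omega) (by omega))))))
  · exact .inl (h.face_rung h0 hi rfl rfl (by omega))

/-- Faces below level `i` have height `3i`, its vertices with an inward rung `3i + 1`, those with an
outward rung `3i + 2`. So a vertical edge is a rung, or joins a face to the middle vertex of one of
its sides, or to a cap vertex if the face is an apex. -/
theorem IsCapFrame.cyl_vert (h : A.IsCapFrame P k ℓ) (h0 : A.lev v₀ = 0) (hl : ℓ % 2 = 0)
    (hR : IsRadialDistance P av bf) {L : ℤ} (hL : 2 * L = 3 * ℓ + 6) {j Y : ℤ}
    (hp : CylinderPoint L j Y) (hp' : CylinderPoint L j (Y + 2)) :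
    A.cyl ℓ v₀ av bf j Y - A.cyl ℓ v₀ av bf j (Y + 2) ≤ 1 ∧
      A.cyl ℓ v₀ av bf j (Y + 2) - A.cyl ℓ v₀ av bf j Y ≤ 1 := by
  have hY' := hp'.2.2.1
  have face : ∀ i : ℕ, Valid ℓ i j → (j - i) % 2 = 0 → Y = 3 * i →
      A.cyl ℓ v₀ av bf j Y - A.cyl ℓ v₀ av bf j (Y + 2) ≤ 1 ∧
      A.cyl ℓ v₀ av bf j (Y + 2) - A.cyl ℓ v₀ av bf j Y ≤ 1 := by
    intro i hv hj hY
    rw [cyl_fwd_up h h0 hR hv hj rfl hY, cyl_vertex (i := i) (by omega)]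
    exact (hR.av_bf (A.dt ℓ v₀ .fwd i j)).symm
  rcases cylinderPoint_cases hl hL hp with h1 | h1 | ⟨i, h1, h2, h3, h4⟩ |
    ⟨i, ⟨w1, w2, w3⟩, ⟨h4, h3⟩ | ⟨h4, h3⟩⟩
  · have := hp.1
    exact face 0 ⟨by omega, by omega, by omega⟩ (by omega) (by omega)
  · omega
  · refine face i ⟨by omega, by omega, ?_⟩ h4 h3
    have := hp.1
    have := hp'.2.2.2
    omega
  · have hi : i ≤ ℓ := by omega
    rw [cyl_vertex (i := i) (by omega), cyl_vertex (i := i + 1) (by omega)]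
    have e1 := hR.av_le (A.dt ℓ v₀ .rung i j)
    have e2 := hR.av_le (A.dt ℓ v₀ .rung (i + 1) j)
    rw [fst_dt, snd_rung h h0 hi h4 rfl] at e1
    rw [fst_dt, snd_rung_succ h h0 hi h4 rfl] at e2
    exact ⟨e1, e2⟩
  · rw [cyl_vertex (i := i) (by omega), cyl_bwd_down h h0 hR ⟨w1, w2, w3⟩ h4 rfl (by omega)]
    exact hR.av_bf (A.dt ℓ v₀ .bwd i j)

theorem IsCapFrame.cyl_diag (h : A.IsCapFrame P k ℓ) (h0 : A.lev v₀ = 0) (hl : ℓ % 2 = 0)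
    (hR : IsRadialDistance P av bf) {L : ℤ} (hL : 2 * L = 3 * ℓ + 6) {s j Y : ℤ}
    (hs : s = 1 ∨ s = -1) (hp : CylinderPoint L j Y) (hp' : CylinderPoint L (j + s) (Y + 1)) :
    A.cyl ℓ v₀ av bf j Y - A.cyl ℓ v₀ av bf (j + s) (Y + 1) ≤ 1 ∧
      A.cyl ℓ v₀ av bf (j + s) (Y + 1) - A.cyl ℓ v₀ av bf j Y ≤ 1 := by
  obtain ⟨p1, p2, p3, p4⟩ := hp'
  rcases cylinderPoint_cases hl hL hp with h1 | h1 | ⟨i, h1, h2, h3, h4⟩ |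
    ⟨i, ⟨w1, w2, w3⟩, ⟨h4, h3⟩ | ⟨h4, h3⟩⟩
  · omega
  · omega
  · rw [cyl_vertex (j := j + s) (i := i) (by omega)]
    rcases hs with rfl | rfl
    · rw [cyl_rung_down h h0 hR (i := i) (a := j + 1) ⟨by omega, by omega, by omega⟩ (by omega)
        (by omega) (by omega)]
      exact (hR.av_bf (A.dt ℓ v₀ .rung i (j + 1))).symm
    · rw [cyl_fwd_down (i := i) (a := j + -1) ⟨by omega, by omega, by omega⟩ (by omega)
        (by omega) (by omega)]
      exact (hR.av_bf (A.dt ℓ v₀ .fwd i (j + -1))).symm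
  · rw [cyl_vertex (j := j) (i := i) (by omega)]
    rcases hs with rfl | rfl
    · rw [cyl_rung_up h h0 hR (i := i) (a := j) ⟨by omega, by omega, by omega⟩ (by omega)
        (by omega) (by omega)]
      exact hR.av_bf (A.dt ℓ v₀ .rung i j)
    · rw [cyl_bwd_up h h0 hR (i := i) (a := j) ⟨by omega, by omega, by omega⟩ (by omega)
        (by omega) (by omega)]
      exact hR.av_bf (A.dt ℓ v₀ .bwd i j)
  · have hst : step ℓ i = 1 := step_mid (by omega) (by omega)
    rw [cyl_vertex (j := j) (i := i) (by omega), cyl_vertex (j := j + s) (i := i) (by omega)]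
    rcases hs with rfl | rfl
    · have e1 := hR.av_le (A.dt ℓ v₀ .fwd i j)
      have e2 := hR.av_le (A.dt ℓ v₀ .bwd i (j + 1))
      rw [fst_dt, snd_fwd h (b := j + 1) w1 (by omega)] at e1
      rw [fst_dt, snd_bwd h (b := j) w1 (by omega)] at e2
      exact ⟨e1, e2⟩
    · have e1 := hR.av_le (A.dt ℓ v₀ .bwd i j)
      have e2 := hR.av_le (A.dt ℓ v₀ .fwd i (j + -1))
      rw [fst_dt, snd_bwd h (b := j + -1) w1 (by omega)] at e1
      rw [fst_dt, snd_fwd h (b := j) w1 (by omega)] at e2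
      exact ⟨e1, e2⟩

end LevelFrame


namespace LevelFrame

variable {V : Type*} {F : SimpleGraph V} {A : LevelFrame F} {P : PlaneEmbedding F} {k ℓ : ℕ}
  {v₀ : V} {av : V → ℤ} {bf : F.Dart → ℤ}

/-- A vertex of `F` has six neighbours in the stellation, and each is located in the cylinder. The
two neighbours along a cap are two columns away in the same row; this is the reason for the
horizontal adjacencies. -/
theorem IsCapFrame.cyl_lower_up (h : A.IsCapFrame P k ℓ) (h0 : A.lev v₀ = 0) (hl : ℓ % 2 = 0)
    (hR : IsRadialDistance P av bf) {L : ℤ} (hL : 2 * L = 3 * ℓ + 6) {i : ℕ} {j Y : ℤ}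
    (hv : Valid ℓ i j) (hj : (j - i) % 2 = 0) (hY : Y = 3 * i + 2)
    (hpos : 0 < A.cyl ℓ v₀ av bf j Y) : ∃ j' Y', CylinderPoint L j' Y' ∧
      CylinderAdj L j Y j' Y' ∧ A.cyl ℓ v₀ av bf j' Y' = A.cyl ℓ v₀ av bf j Y - 1 := by
  rw [cyl_vertex (i := i) (by omega)] at hpos ⊢
  obtain ⟨w1, w2, w3⟩ := hv
  have hs : (step ℓ i = 1 ∧ 0 < i ∧ i ≤ ℓ) ∨ step ℓ i = 2 ∧ (i = 0) := by
    unfold step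
    split_ifs <;> omega
  obtain ⟨d, hd, hdv⟩ := hR.lower_av _ hpos
  obtain ⟨t, rfl⟩ := exists_dt_kind d i j hd.symm
  rcases t with _ | _ | _ <;> rcases hdv with hdv | hdv
  · rcases hs with ⟨hs, hi, hi'⟩ | ⟨hs, hi⟩
    · rw [snd_fwd h (b := j + 1) w1 (by omega)] at hdv
      refine ⟨j + 1, Y - 1, cylinderPoint_vertex hl hL (i := i) ⟨by omega, by omega, by omega⟩ (.inr
          ⟨by omega, by omega⟩), .inr (.inl ⟨by omega, by omega⟩), ?_⟩
      rw [cyl_vertex (i := i) (by omega), hdv]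
    · rw [snd_fwd h (b := j + 2) w1 (by omega)] at hdv
      refine ⟨j + 2, Y, cylinderPoint_vertex hl hL (i := i) ⟨by omega, by omega, by omega⟩ (.inl
          ⟨by omega, by omega⟩), .inr (.inr (.inl ⟨by omega, rfl, by omega⟩)), ?_⟩
      rw [cyl_vertex (i := i) (by omega), hdv]
  · refine ⟨j, Y - 2, cylinderPoint_face hl hL (i := i) (by omega) (by omega) (by omega), .inl
        ⟨rfl, by omega⟩, ?_⟩
    rw [cyl_fwd_up h h0 hR (i := i) (a := j) ⟨by omega, by omega, by omega⟩ (by omega) (by omega)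
        (by omega), hdv]
  · rcases hs with ⟨hs, hi, hi'⟩ | ⟨hs, hi⟩
    · rw [snd_bwd h (b := j - 1) w1 (by omega)] at hdv
      refine ⟨j - 1, Y - 1, cylinderPoint_vertex hl hL (i := i) ⟨by omega, by omega, by omega⟩ (.inr
          ⟨by omega, by omega⟩), .inr (.inl ⟨by omega, by omega⟩), ?_⟩
      rw [cyl_vertex (i := i) (by omega), hdv]
    · rw [snd_bwd h (b := j - 2) w1 (by omega)] at hdv
      refine ⟨j - 2, Y, cylinderPoint_vertex hl hL (i := i) ⟨by omega, by omega, by omega⟩ (.inl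
          ⟨by omega, by omega⟩), .inr (.inr (.inl ⟨by omega, rfl, by omega⟩)), ?_⟩
      rw [cyl_vertex (i := i) (by omega), hdv]
  · refine ⟨j - 1, Y + 1, cylinderPoint_face hl hL (i := i + 1) (by omega) (by omega) (by omega),
        .inr (.inl ⟨by omega, by omega⟩), ?_⟩
    rw [cyl_bwd_up h h0 hR (i := i) (a := j) ⟨by omega, by omega, by omega⟩ (by omega) (by omega)
        (by omega), hdv]
  · rw [snd_rung h h0 (i' := i + 1) (by omega) hj rfl] at hdv
    refine ⟨j, Y + 2, cylinderPoint_vertex hl hL (i := i + 1) ⟨by omega, by omega, by omega⟩ (.inr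
        ⟨by omega, by omega⟩), .inl ⟨rfl, by omega⟩, ?_⟩
    rw [cyl_vertex (i := i + 1) (by omega), hdv]
  · refine ⟨j + 1, Y + 1, cylinderPoint_face hl hL (i := i + 1) (by omega) (by omega) (by omega),
        .inr (.inl ⟨by omega, by omega⟩), ?_⟩
    rw [cyl_rung_up h h0 hR (i := i) (a := j) ⟨by omega, by omega, by omega⟩ (by omega) (by omega)
        (by omega), hdv]

theorem IsCapFrame.cyl_lower_down (h : A.IsCapFrame P k ℓ) (h0 : A.lev v₀ = 0) (hl : ℓ % 2 = 0)
    (hR : IsRadialDistance P av bf) {L : ℤ} (hL : 2 * L = 3 * ℓ + 6) {i : ℕ} {j Y : ℤ}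
    (hv : Valid ℓ i j) (hj : (j - i) % 2 = 1) (hY : Y = 3 * i + 1)
    (hpos : 0 < A.cyl ℓ v₀ av bf j Y) : ∃ j' Y', CylinderPoint L j' Y' ∧
      CylinderAdj L j Y j' Y' ∧ A.cyl ℓ v₀ av bf j' Y' = A.cyl ℓ v₀ av bf j Y - 1 := by
  rw [cyl_vertex (i := i) (by omega)] at hpos ⊢
  obtain ⟨w1, w2, w3⟩ := hv
  have hs : (step ℓ i = 1 ∧ 0 < i ∧ i ≤ ℓ) ∨ step ℓ i = 2 ∧ (i = ℓ + 1) := by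
    unfold step
    split_ifs <;> omega
  obtain ⟨d, hd, hdv⟩ := hR.lower_av _ hpos
  obtain ⟨t, rfl⟩ := exists_dt_kind d i j hd.symm
  rcases t with _ | _ | _ <;> rcases hdv with hdv | hdv
  · rcases hs with ⟨hs, hi, hi'⟩ | ⟨hs, hi⟩
    · rw [snd_fwd h (b := j + 1) w1 (by omega)] at hdv
      refine ⟨j + 1, Y + 1, cylinderPoint_vertex hl hL (i := i) ⟨by omega, by omega, by omega⟩ (.inl
          ⟨by omega, by omega⟩), .inr (.inl ⟨by omega, by omega⟩), ?_⟩
      rw [cyl_vertex (i := i) (by omega), hdv]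
    · rw [snd_fwd h (b := j + 2) w1 (by omega)] at hdv
      refine ⟨j + 2, Y, cylinderPoint_vertex hl hL (i := i) ⟨by omega, by omega, by omega⟩ (.inr
          ⟨by omega, by omega⟩), .inr (.inr (.inl ⟨by omega, rfl, by omega⟩)), ?_⟩
      rw [cyl_vertex (i := i) (by omega), hdv]
  · refine ⟨j + 1, Y - 1, cylinderPoint_face hl hL (i := i) (by omega) (by omega) (by omega), .inr
        (.inl ⟨by omega, by omega⟩), ?_⟩
    rw [cyl_fwd_down (i := i) (a := j) ⟨by omega, by omega, by omega⟩ (by omega) (by omega)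
        (by omega), hdv]
  · rcases hs with ⟨hs, hi, hi'⟩ | ⟨hs, hi⟩
    · rw [snd_bwd h (b := j - 1) w1 (by omega)] at hdv
      refine ⟨j - 1, Y + 1, cylinderPoint_vertex hl hL (i := i) ⟨by omega, by omega, by omega⟩ (.inl
          ⟨by omega, by omega⟩), .inr (.inl ⟨by omega, by omega⟩), ?_⟩
      rw [cyl_vertex (i := i) (by omega), hdv]
    · rw [snd_bwd h (b := j - 2) w1 (by omega)] at hdv
      refine ⟨j - 2, Y, cylinderPoint_vertex hl hL (i := i) ⟨by omega, by omega, by omega⟩ (.inr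
          ⟨by omega, by omega⟩), .inr (.inr (.inl ⟨by omega, rfl, by omega⟩)), ?_⟩
      rw [cyl_vertex (i := i) (by omega), hdv]
  · refine ⟨j, Y + 2, cylinderPoint_face hl hL (i := i + 1) (by omega) (by omega) (by omega), .inl
        ⟨rfl, by omega⟩, ?_⟩
    rw [cyl_bwd_down h h0 hR (i := i) (a := j) ⟨by omega, by omega, by omega⟩ (by omega) (by omega)
        (by omega), hdv]
  · rw [snd_rung_succ h h0 (i := i - 1) (by omega) (by omega) (by omega)] at hdv
    refine ⟨j, Y - 2, cylinderPoint_vertex hl hL (i := i - 1) ⟨by omega, by omega, by omega⟩ (.inl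
        ⟨by omega, by omega⟩), .inl ⟨rfl, by omega⟩, ?_⟩
    rw [cyl_vertex (i := i - 1) (by omega), hdv]
  · refine ⟨j - 1, Y - 1, cylinderPoint_face hl hL (i := i) (by omega) (by omega) (by omega), .inr
        (.inl ⟨by omega, by omega⟩), ?_⟩
    rw [cyl_rung_down h h0 hR (i := i) (a := j) ⟨by omega, by omega, by omega⟩ (by omega) (by omega)
        (by omega), hdv]

theorem IsCapFrame.cyl_lower_face (h : A.IsCapFrame P k ℓ) (h0 : A.lev v₀ = 0) (hl : ℓ % 2 = 0)
    (hR : IsRadialDistance P av bf) {L : ℤ} (hL : 2 * L = 3 * ℓ + 6) {i : ℕ} {j Y : ℤ}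
    (hi : i ≤ ℓ) (hj : (j - (i + 1)) % 2 = 0) (hY : Y = 3 * i + 3)
    (hpos : 0 < A.cyl ℓ v₀ av bf j Y) : ∃ j' Y', CylinderPoint L j' Y' ∧
      CylinderAdj L j Y j' Y' ∧ A.cyl ℓ v₀ av bf j' Y' = A.cyl ℓ v₀ av bf j Y - 1 := by
  rw [cyl_face (i := i + 1) (a := j - 1) (by omega) (by omega) (by omega) rfl] at hpos ⊢
  obtain ⟨e, he, hev⟩ := hR.lower_bf _ hpos
  rcases h.sameCycle_face h0 hi hj he with rfl | ⟨hi', rfl⟩ | rfl | rfl | ⟨hi', rfl⟩ | rfl <;>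
    rw [fst_dt] at hev
  · refine ⟨j - 1, Y + 1, cylinderPoint_vertex hl hL (i := i + 1) ⟨by omega, by omega, by omega⟩
      (.inr ⟨by omega, by omega⟩), .inr (.inl ⟨by omega, by omega⟩), ?_⟩
    rw [cyl_vertex (i := i + 1) (by omega), hev]
  · refine ⟨j, Y + 2, cylinderPoint_vertex hl hL (i := i + 1) ⟨by omega, by omega, by omega⟩
      (.inl ⟨by omega, by omega⟩), .inl ⟨rfl, by omega⟩, ?_⟩
    rw [cyl_vertex (i := i + 1) (by omega), hev]
  · refine ⟨j + 1, Y + 1, cylinderPoint_vertex hl hL (i := i + 1) ⟨by omega, by omega, by omega⟩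
      (.inr ⟨by omega, by omega⟩), .inr (.inl ⟨by omega, by omega⟩), ?_⟩
    rw [cyl_vertex (i := i + 1) (by omega), hev]
  · refine ⟨j + 1, Y - 1, cylinderPoint_vertex hl hL (i := i) ⟨by omega, by omega, by omega⟩
      (.inl ⟨by omega, by omega⟩), .inr (.inl ⟨by omega, by omega⟩), ?_⟩
    rw [cyl_vertex (i := i) (by omega), hev]
  · refine ⟨j, Y - 2, cylinderPoint_vertex hl hL (i := i) ⟨by omega, by omega, by omega⟩
      (.inr ⟨by omega, by omega⟩), .inl ⟨rfl, by omega⟩, ?_⟩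
    rw [cyl_vertex (i := i) (by omega), hev]
  · refine ⟨j - 1, Y - 1, cylinderPoint_vertex hl hL (i := i) ⟨by omega, by omega, by omega⟩
      (.inl ⟨by omega, by omega⟩), .inr (.inl ⟨by omega, by omega⟩), ?_⟩
    rw [cyl_vertex (i := i) (by omega), hev]

theorem IsCapFrame.isCylinderDistance (h : A.IsCapFrame P k ℓ) (h0 : A.lev v₀ = 0) (hl : ℓ % 2 = 0)
    (hR : IsRadialDistance P av bf) {L : ℤ} (hL : 2 * L = 3 * ℓ + 6) :
    IsCylinderDistance k L (A.cyl ℓ v₀ av bf) := by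
  have hone := h.one_le
  -- the values at the faces, and the values at the vertices
  have face : ∀ j Y, CylinderPoint L j Y → (∃ i : ℕ, Valid ℓ i j ∧
      ((j - i) % 2 = 0 ∧ Y = 3 * i + 2 ∨ (j - i) % 2 = 1 ∧ Y = 3 * i + 1) ∧
      A.cyl ℓ v₀ av bf j Y = av (A.vt ℓ v₀ i j)) ∨
      ∃ d, A.cyl ℓ v₀ av bf j Y = bf d ∧ (Y = 0 ∧ d = A.dt ℓ v₀ .fwd 0 0 ∨
        Y = 2 * L ∧ d = A.dt ℓ v₀ .bwd (ℓ + 1) ℓ ∨ ∃ i : ℕ, i ≤ ℓ ∧ (j - (i + 1)) % 2 = 0 ∧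
          Y = 3 * i + 3 ∧ d = A.dt ℓ v₀ .fwd (i + 1) (j - 1)) := by
    intro j Y hp
    rcases cylinderPoint_cases hl hL hp with h1 | h1 | ⟨i, h1, h2, h3, h4⟩ | ⟨i, hv, h4⟩
    · exact .inr ⟨_, by rw [h1, cyl_zero], .inl ⟨h1, rfl⟩⟩
    · exact .inr ⟨_, cyl_top h1, .inr (.inl ⟨by omega, rfl⟩)⟩
    · obtain ⟨i, rfl⟩ := Nat.exists_eq_succ_of_ne_zero (show i ≠ 0 by omega)
      rw [Nat.succ_eq_add_one] at *
      exact .inr ⟨_, cyl_face h1 h2 h3 rfl, .inr (.inr ⟨i, by omega, by omega, by omega, rfl⟩)⟩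
    · exact .inl ⟨i, hv, h4, cyl_vertex (by omega)⟩
  refine ⟨?_, ?_, ?_, ?_, ?_, ?_, ?_, ?_, ?_⟩
  · intro j j'
    rw [cyl_zero, cyl_zero]
  · intro j j'
    rw [cyl_top hL, cyl_top hL]
  · intro j j' Y hp hd
    have hpar : j' % 2 = j % 2 := by
      obtain ⟨c, hc⟩ := hd
      rw [mul_assoc] at hc
      omega
    rcases cylinderPoint_cases hl hL hp with h1 | h1 | ⟨i, h1, h2, h3, h4⟩ | ⟨i, ⟨w1, w2, w3⟩, h4⟩
    · rw [h1, cyl_zero, cyl_zero]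
    · rw [cyl_top h1, cyl_top h1]
    · rw [cyl_face h1 h2 h3 rfl, cyl_face h1 h2 h3 rfl]
      congr 1
      rw [h.dt_eq_dt h0 ⟨by omega, by omega, by omega⟩ ⟨by omega, by omega, by omega⟩]
      exact ⟨rfl, rfl, by rwa [sub_sub_sub_cancel_right]⟩
    · rw [cyl_vertex (i := i) (by omega), cyl_vertex (i := i) (by omega)]
      congr 1
      rwa [h.vt_eq_vt h0 ⟨by omega, by omega, by omega⟩ ⟨by omega, by omega, by omega⟩]
  · intro j Y hp
    rcases face j Y hp with ⟨i, -, -, h1⟩ | ⟨d, h1, -⟩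
    · rw [h1]; exact hR.av_nonneg _
    · rw [h1]; exact hR.bf_nonneg _
  · exact fun j Y h1 h2 => h.cyl_vert h0 hl hR hL h1 h2
  · exact fun s j Y hs h1 h2 => h.cyl_diag h0 hl hR hL hs h1 h2
  · intro j Y hp hpos
    rcases cylinderPoint_cases hl hL hp with h1 | h1 | ⟨i, h1, h2, h3, h4⟩ | ⟨i, hv, h4 | h4⟩
    · rw [h1, cyl_zero] at hpos ⊢
      obtain ⟨e, he, hev⟩ := hR.lower_bf _ hpos
      obtain ⟨a, ha, rfl⟩ := h.sameCycle_bottom h0 he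
      rw [fst_dt] at hev
      refine ⟨a, 2, cylinderPoint_vertex hl hL (i := 0) ⟨by omega, by omega, by omega⟩ (.inl
          ⟨by omega, by omega⟩),
        .inr (.inr (.inr (.inl ⟨rfl, rfl⟩))), ?_⟩
      rw [cyl_vertex (i := 0) (by omega), hev]
    · rw [cyl_top h1] at hpos ⊢
      obtain ⟨e, he, hev⟩ := hR.lower_bf _ hpos
      obtain ⟨a, ha, rfl⟩ := h.sameCycle_top h0 he
      rw [fst_dt] at hev
      refine ⟨a, 2 * L - 2, cylinderPoint_vertex hl hL (i := ℓ + 1) ⟨by omega, by omega, by omega⟩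
          (.inr ⟨by omega, by omega⟩),
        .inr (.inr (.inr (.inr ⟨by omega, rfl⟩))), ?_⟩
      rw [cyl_vertex (i := ℓ + 1) (by omega), hev]
    · obtain ⟨i, rfl⟩ := Nat.exists_eq_succ_of_ne_zero (show i ≠ 0 by omega)
      rw [Nat.succ_eq_add_one] at *
      exact h.cyl_lower_face h0 hl hR hL (i := i) (by omega) (by omega) (by omega) hpos
    · exact h.cyl_lower_up h0 hl hR hL hv h4.1 h4.2 hpos
    · exact h.cyl_lower_down h0 hl hR hL hv h4.1 h4.2 hpos
  · rcases hR.exists_zero with ⟨v, hv⟩ | ⟨d, hd⟩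
    · obtain ⟨i, a, hva, rfl⟩ := h.exists_vt h0 v
      have hY : (a - i) % 2 = 0 ∧ 3 * (i : ℤ) + 2 - (a - i) % 2 = 3 * i + 2 ∨
          (a - i) % 2 = 1 ∧ 3 * (i : ℤ) + 2 - (a - i) % 2 = 3 * i + 1 := by omega
      exact ⟨a, _, cylinderPoint_vertex hl hL hva hY, by rw [cyl_vertex (i := i) (by omega), hv]⟩
    · obtain ⟨t, i, a, ⟨w1, w2, w3⟩, rfl⟩ := h.exists_dt h0 d
      rcases Int.emod_two_eq_zero_or_one (a - i) with ha | ha <;> rcases t with _ | _ | _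
      · exact ⟨a, 3 * i, cylinderPoint_face hl hL (i := i) (by omega) (by omega) rfl, by
          rw [cyl_fwd_up h h0 hR ⟨by omega, by omega, by omega⟩ ha rfl rfl, hd]⟩
      · exact ⟨a - 1, 3 * i + 3, cylinderPoint_face hl hL (i := i + 1) (by omega) (by omega)
            (by omega), by
          rw [cyl_bwd_up h h0 hR ⟨by omega, by omega, by omega⟩ ha rfl rfl, hd]⟩
      · exact ⟨a + 1, 3 * i + 3, cylinderPoint_face hl hL (i := i + 1) (by omega) (by omega)
            (by omega), by
          rw [cyl_rung_up h h0 hR ⟨by omega, by omega, by omega⟩ ha rfl rfl, hd]⟩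
      · exact ⟨a + 1, 3 * i, cylinderPoint_face hl hL (i := i) (by omega) (by omega) rfl, by
          rw [cyl_fwd_down ⟨by omega, by omega, by omega⟩ ha rfl rfl, hd]⟩
      · exact ⟨a, 3 * i + 3, cylinderPoint_face hl hL (i := i + 1) (by omega) (by omega)
            (by omega), by
          rw [cyl_bwd_down h h0 hR ⟨by omega, by omega, by omega⟩ ha rfl rfl, hd]⟩
      · exact ⟨a - 1, 3 * i, cylinderPoint_face hl hL (i := i) (by omega) (by omega) rfl, by
          rw [cyl_rung_down h h0 hR ⟨by omega, by omega, by omega⟩ ha rfl rfl, hd]⟩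
  -- Two zeros are the same vertex or the same face of `F`. For faces, the list of darts on the
  -- boundary shows that the representing darts agree up to the period.
  · intro j Y j' Y' hp hp' hz hz'
    rcases face j Y hp with ⟨i, hv, hY, h1⟩ | ⟨d, h1, hd⟩ <;>
      rcases face j' Y' hp' with ⟨i', hv', hY', h1'⟩ | ⟨d', h1', hd'⟩ <;> rw [h1] at hz <;>
      rw [h1'] at hz'
    · have he := hR.unique_av _ _ hz hz'
      have hi : i = i' := by
        have e1 := h.lev_vt h0 hv.1 j
        rw [he, h.lev_vt h0 hv'.1] at e1
        exact_mod_cast e1.symm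
      subst hi
      have hdv := (h.vt_eq_vt h0 hv hv').1 he
      have hpar : j % 2 = j' % 2 := by
        obtain ⟨c, hc⟩ := hdv
        rw [mul_assoc] at hc
        omega
      exact ⟨by omega, .inr (.inr hdv)⟩
    · exact absurd hz' (hR.unique_av_bf _ _ hz)
    · exact absurd hz (hR.unique_av_bf _ _ hz')
    · have hc := hR.unique_bf _ _ hz hz'
      have hc' := hc.symm
      rcases hd with ⟨hY, rfl⟩ | ⟨hY, rfl⟩ | ⟨i, hi, hj, hY, rfl⟩ <;>
        rcases hd' with ⟨hY', rfl⟩ | ⟨hY', rfl⟩ | ⟨i', hi', hj', hY', rfl⟩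
      · exact ⟨by omega, .inl hY⟩
      · obtain ⟨a, ha, he⟩ := h.sameCycle_bottom h0 hc
        exact DartKind.noConfusion ((h.dt_eq_dt h0 ⟨by omega, by omega, by omega⟩
            ⟨by omega, by omega, by omega⟩).1 he).1
      · obtain ⟨a, ha, he⟩ := h.sameCycle_bottom h0 hc
        have := ((h.dt_eq_dt h0 ⟨by omega, by omega, by omega⟩
            ⟨by omega, by omega, by omega⟩).1 he).2.1
        omega
      · obtain ⟨a, ha, he⟩ := h.sameCycle_bottom h0 hc'
        exact DartKind.noConfusion ((h.dt_eq_dt h0 ⟨by omega, by omega, by omega⟩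
            ⟨by omega, by omega, by omega⟩).1 he).1
      · exact ⟨by omega, .inr (.inl hY)⟩
      · obtain ⟨a, ha, he⟩ := h.sameCycle_top h0 hc
        exact DartKind.noConfusion ((h.dt_eq_dt h0 ⟨by omega, by omega, by omega⟩
            ⟨by omega, by omega, by omega⟩).1 he).1
      · obtain ⟨a, ha, he⟩ := h.sameCycle_bottom h0 hc'
        have := ((h.dt_eq_dt h0 ⟨by omega, by omega, by omega⟩
            ⟨by omega, by omega, by omega⟩).1 he).2.1
        omega
      · obtain ⟨a, ha, he⟩ := h.sameCycle_top h0 hc'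
        exact DartKind.noConfusion ((h.dt_eq_dt h0 ⟨by omega, by omega, by omega⟩
            ⟨by omega, by omega, by omega⟩).1 he).1
      · rcases h.sameCycle_face h0 hi hj hc with he | ⟨hl', he⟩ | he | he | ⟨hl', he⟩ | he <;>
          have he := (h.dt_eq_dt h0 ⟨by omega, by omega, by omega⟩
              ⟨by omega, by omega, by omega⟩).1 he
        · obtain ⟨-, hii, hdv⟩ := he
          refine ⟨by omega, .inr (.inr ?_)⟩
          rw [sub_sub_sub_cancel_right] at hdv
          rwa [dvd_sub_comm]
        · obtain ⟨-, hii, c, hdv⟩ := he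
          rw [mul_assoc] at hdv
          omega
        all_goals exact DartKind.noConfusion he.1

end LevelFrame


/-! ### Non-circularity for an even number of middle circles -/

namespace LevelFrame

variable {V : Type*} {F : SimpleGraph V} {A : LevelFrame F} {P : PlaneEmbedding F} {k ℓ : ℕ}

theorem cyl_sub {v₀ : V} {av : V → ℤ} {bf : F.Dart → ℤ} (N : ℤ) :
    A.cyl ℓ v₀ (fun v => N - av v) (fun d => N - bf d) =
      fun j Y => N - A.cyl ℓ v₀ av bf j Y := by
  funext j Y
  unfold cyl
  split_ifs <;> rfl

/-- With an even number of middle circles, the leapfrog is not circular. -/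
theorem IsCapFrame.not_isCircular (h : A.IsCapFrame P k ℓ) (hP : P.IsFullerene)
    (hk : k = 5 ∨ k = 6) (hl : ℓ % 2 = 0) : ¬ P.map.leapfrog.graph.IsCircular := by
  rintro ⟨m, Q, C, hC⟩
  have hone := h.one_le
  obtain ⟨v₀, h0⟩ := h.exists_lev_zero
  have hQ := hP.isFullerene_leapfrogEmbedding
  -- The frame `B` comes from the hypothetical drawing, whose faces are not known to be short. The
  -- height is measured in the leapfrog drawing instead, whose dual is known.
  obtain ⟨B, hB, -, -⟩ := C.exists_frame hC hQ.1
  obtain ⟨H, N, hH, hH'⟩ := B.exists_isFaceDistance hQ.2 hP.noShortCycle hB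
  -- The height of the cylinder is even just because `ℓ` is; moreover `ℓ ≥ 2`, so `L ≥ 6`.
  obtain ⟨L, hL⟩ : ∃ L : ℤ, 2 * L = 3 * ℓ + 6 := ⟨3 * (ℓ / 2) + 3, by omega⟩
  have h1 := h.isCylinderDistance h0 hl (hP.isRadialDistance hH) hL
  have h2 := h.isCylinderDistance h0 hl (hP.isRadialDistance hH') hL
  have e := cyl_sub (A := A) (ℓ := ℓ) (v₀ := v₀)
    (av := fun v => hP.stellationValue H (.side (hP.exists_fst v).choose))
    (bf := fun d => hP.stellationValue H (.fromCenter d)) N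
  change IsCylinderDistance k L (A.cyl ℓ v₀ (fun v => N - hP.stellationValue H _)
    (fun d => N - hP.stellationValue H _)) at h2
  rw [e] at h2
  have h3 : IsCylinderDistance k L fun j Y => N - (N - A.cyl ℓ v₀
      (fun v => hP.stellationValue H (.side (hP.exists_fst v).choose))
      (fun d => hP.stellationValue H (.fromCenter d)) j Y) := by
    simpa only [sub_sub_cancel] using h1
  have hk' : (k : ℤ) = 5 ∨ (k : ℤ) = 6 := by omega
  obtain ⟨j, Y, hp, hz⟩ := h1.exists_zero
  obtain ⟨j', Y', hp', hz'⟩ := h2.exists_zero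
  -- The situation is symmetric in `h` and `N - h`, so the lower of the two vertices may be taken as
  -- the zero of the first function.
  rcases le_total Y Y' with hle | hle
  · exact h1.false_of_le h2 hk' (by omega) hp hz hp' hz' hle
  · exact h2.false_of_le h3 hk' (by omega) hp' hz' hp (by rw [sub_sub_cancel]; exact hz) hle

end LevelFrame

theorem theorem6p2 {V : Type*} {F : SimpleGraph V} (P : PlaneEmbedding F) (k ℓ : ℕ)
    (hF : IsCapFullerene P k ℓ) :
    P.leapfrog.IsFullerene ∧
    (P.leapfrog.IsCircular ↔ Odd ℓ) ∧
    (Odd ℓ → P.leapfrog.IsCircularWith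
      ([k, 3 * k] ++ List.replicate ((3 * ℓ - 1) / 2) (4 * k) ++ [3 * k, k])) ∧
    (Even ℓ → ∃ (Q : PlaneEmbedding P.leapfrog)
      (C : CircleDrawing Q (List.replicate (3 * ℓ / 2) (4 * k) ++ [3 * k, k])),
      C.interior.ncard = 2 * k ∧ C.InteriorIsSun k) := by
  obtain ⟨A, hA⟩ := LevelFrame.exists_isCapFrame hF
  obtain ⟨hk, -, hP, -⟩ := hF
  have odd : Odd ℓ → P.leapfrog.IsCircularWith
      ([k, 3 * k] ++ List.replicate ((3 * ℓ - 1) / 2) (4 * k) ++ [3 * k, k]) := fun h =>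
    hA.isCircularWith hP (by omega) (Nat.odd_iff.1 h)
  refine ⟨⟨hP.leapfrogEmbedding, hP.isFullerene_leapfrogEmbedding⟩, ⟨fun hc => ?_, fun h =>
    ⟨_, odd h⟩⟩, odd, fun h => hA.exists_circleDrawing_sun hP (by omega) (Nat.even_iff.1 h)⟩
  by_contra ho
  exact hA.not_isCircular hP hk (by rw [Nat.odd_iff] at ho; omega) hc
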